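/- Let $R=[0,1]^3$, let $A,B\subset(0,1)$ be finite sets, and put $S=\{(x,y,z)\in R:\ x\in A\ \text{or}\ y\in B\}$. Let $f=(f_1,f_2,f_3)$ be a map with $f(R)\subset R$ such that, for some constant $\lambda>2$: - $f$ is $C^2$ on $R\setminus S$, with bounded first and second derivatives there; - everywhere on $R\setminus S$, $$\Big|\tfrac{\partial f_1}{\partial x}\Big|-\Big|\tfrac{\partial f_1}{\partial y}\Big|-\Big|\tfrac{\partial f_1}{\partial z}\Big|\ \ge\ \lambda,\qquad \Big|\tfrac{\partial f_2}{\partial y}\Big|-\Big|\tfrac{\partial f_2}{\partial x}\Big|-\Big|\tfrac{\partial f_2}{\partial z}\Big|\ \ge\ \lambda;$$ - everywhere on $R\setminus S$, all the partial derivatives of $f_1,f_2,f_3$ other than $\partial f_1/\partial x$ and $\partial f_2/\partial y$ are at most $\lambda/8$ in absolute value. Let $J=[x_0,x_1]\times[y_0,y_1]\subset[0,1]^2$ be a rectangle with $x_0<x_1$, $y_0<y_1$, and let $\alpha:J\to[0,1]$ be a $C^2$ function such that the angle between the normal of $\mathrm{graph}(\alpha)$ and the $z$-axis is at most $45$ degrees,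 that is, $1/\sqrt{1+\alpha_x^2+\alpha_y^2}\ge\sqrt2/2$ on $J$. Let $\pi(x,y,z)=(x,y)$, let $m$ be Lebesgue measure on the plane, let $\mu_0$ be the measure on $\mathrm{graph}(\alpha)$ for which $\pi_*\mu_0$ is the normalized Lebesgue measure on $J$, and put $\mu_k=(f^k)_*\mu_0$. For $h\in L^1(\mathbb{R}^2)$ put $$\|h\|_{BV}=\sup\Big\{\int_{\mathbb{R}^2} h\,\mathrm{div}\,\psi\,dm:\ \psi=(\psi_1,\psi_2)\in C^1_c(\mathbb{R}^2,\mathbb{R}^2),\ \max(|\psi_1|,|\psi_2|)\le 1\Big\}.$$ Then there is a constant $M<\infty$ such that: 1. for every $k\ge0$ the measure $\pi_*\mu_k$ has a density $\hat\rho_k\ge 0$ with respect to $m$, supported in $[0,1]^2$, with $\|\hat\rho_k\|_{BV}\le M$; 2. there is a Borel probability measure $\mu$ on $R$ with $f_*\mu=\mu$ that is the weak-* limit of the averages $\frac1{n_i}\sum_{k=1}^{n_i}\mu_k$ along some sequence $n_1<n_2<\cdots$, and $\pi_*\mu$ has a density $\rho\ge 0$ with respect to $m$, supported in $[0,1]^2$,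 of bounded variation, with $\|\rho\|_{BV}\le M$. -/

import Mathlib

open Set Filter Topology MeasureTheory
open scoped NNReal ENNReal BoundedContinuousFunction

noncomputable section

/-- Three-dimensional space; the coordinates `p 0, p 1, p 2` are `x, y, z`. -/
abbrev Space3 : Type := Fin 3 → ℝ

/-- The cube `R = [0,1]^3`. -/
def cubeR : Set Space3 := {p | ∀ i, p i ∈ Icc (0 : ℝ) 1}

/-- The singular set `S = S₁ ∪ S₂`, where `S₁ = A × [0,1] × [0,1]` and `S₂ = [0,1] × B × [0,1]`
for the finite sets of cut points `A = {a_1, …, a_p}` and `B = {b_1, …, b_q}`. -/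
def singularSet (A B : Finset ℝ) : Set Space3 := {p | p ∈ cubeR ∧ (p 0 ∈ A ∨ p 1 ∈ B)}

/-- The domain of smoothness `R - S`. -/
def regularSet (A B : Finset ℝ) : Set Space3 := cubeR \ singularSet A B

/-- `∂f_{i+1}/∂x_{j+1}` at a point `p` of `R - S` (one-sided on the faces of the cube). -/
def partialDeriv (A B : Finset ℝ) (f : Space3 → Space3) (p : Space3) (i j : Fin 3) : ℝ :=
  fderivWithin ℝ f (regularSet A B) p (Pi.single j 1) i

/-- `f` is a `C^2` map on `R - S` with bounded first and second derivatives there. -/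
def SmoothBounded (A B : Finset ℝ) (f : Space3 → Space3) : Prop :=
  ContDiffOn ℝ 2 f (regularSet A B) ∧
    ∃ C : ℝ, ∀ p ∈ regularSet A B,
      ‖iteratedFDerivWithin ℝ 1 f (regularSet A B) p‖ ≤ C ∧
      ‖iteratedFDerivWithin ℝ 2 f (regularSet A B) p‖ ≤ C

/-- `|∂f₁/∂x| - |∂f₁/∂y| - |∂f₁/∂z|` and `|∂f₂/∂y| - |∂f₂/∂x| - |∂f₂/∂z|` are bounded below
by `lam` on `R - S`. -/
def DominatedExpansion (A B : Finset ℝ) (f : Space3 → Space3) (lam : ℝ) : Prop :=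
  ∀ p ∈ regularSet A B,
    lam ≤ |partialDeriv A B f p 0 0| - |partialDeriv A B f p 0 1| - |partialDeriv A B f p 0 2| ∧
    lam ≤ |partialDeriv A B f p 1 1| - |partialDeriv A B f p 1 0| - |partialDeriv A B f p 1 2|

/-- All partial derivatives other than `∂f₁/∂x` and `∂f₂/∂y` are at most `lam / 8` in absolute
value on `R - S`. -/
def SmallCoupling (A B : Finset ℝ) (f : Space3 → Space3) (lam : ℝ) : Prop :=
  ∀ p ∈ regularSet A B, ∀ i j : Fin 3, (i, j) ≠ (0, 0) → (i, j) ≠ (1, 1) →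
    |partialDeriv A B f p i j| ≤ lam / 8

/-- The projection `p_x × p_y` to the `xy`-plane. -/
def projXY (p : Space3) : ℝ × ℝ := (p 0, p 1)

/-- The parametrization `(x, y) ↦ (x, y, α(x, y))` of the graph of `α`. -/
def graphMap (α : ℝ × ℝ → ℝ) (q : ℝ × ℝ) : Space3 := ![q.1, q.2, α q]

/-- The angle between the normal `(-α_x, -α_y, 1)` of the graph of `α` over `J` and the `z`-axis is
at most 45 degrees: the absolute value of its cosine is at least `√2 / 2`. -/
def NormalNearZAxis (J : Set (ℝ × ℝ)) (α : ℝ × ℝ → ℝ) : Prop :=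
  ∀ q ∈ J, Real.sqrt 2 / 2 ≤
    |1 / Real.sqrt (1 + (fderivWithin ℝ α J q (1, 0)) ^ 2 + (fderivWithin ℝ α J q (0, 1)) ^ 2)|

/-- The measure `μ₀` on the graph of `α` over `J` whose projection to the `xy`-plane is the
normalized Lebesgue measure on `J`. -/
def graphMeasure (J : Set (ℝ × ℝ)) (α : ℝ × ℝ → ℝ) : Measure Space3 :=
  ((volume J)⁻¹ • volume.restrict J).map (graphMap α)

/-- The pushforward `μ_k = (f^k)_* μ₀`. -/
def pushedMeasure (f : Space3 → Space3) (J : Set (ℝ × ℝ)) (α : ℝ × ℝ → ℝ) (k : ℕ) :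
    Measure Space3 :=
  (graphMeasure J α).map (f^[k])

/-- The divergence of a vector field on the plane. -/
def planeDiv (ψ : ℝ × ℝ → ℝ × ℝ) (q : ℝ × ℝ) : ℝ :=
  (fderiv ℝ ψ q (1, 0)).1 + (fderiv ℝ ψ q (0, 1)).2

/-- The variation `‖h‖_BV = sup ∫ h div ψ` over the compactly supported `C^1` vector fields `ψ` on
the plane with `‖ψ‖_∞ ≤ 1` (the largest absolute value of a component of `ψ`). -/
def bvNorm (h : ℝ × ℝ → ℝ) : ℝ≥0∞ :=
  ⨆ (ψ : ℝ × ℝ → ℝ × ℝ) (_ : ContDiff ℝ 1 ψ) (_ : HasCompactSupport ψ)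
    (_ : ∀ q, |(ψ q).1| ≤ 1 ∧ |(ψ q).2| ≤ 1),
    ENNReal.ofReal (∫ q, h q * planeDiv ψ q)

/-- `ρ` is a nonnegative integrable function supported in `[0,1]^2`, it is the Lebesgue density of
`ν`, and `‖ρ‖_BV ≤ M`. -/
structure IsBVDensity (ν : Measure (ℝ × ℝ)) (ρ : ℝ × ℝ → ℝ) (M : ℝ≥0) : Prop where
  integrable : Integrable ρ volume
  support_subset : Function.support ρ ⊆ Icc (0 : ℝ) 1 ×ˢ Icc (0 : ℝ) 1
  nonneg : ∀ q, 0 ≤ ρ q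
  eq_withDensity : ν = volume.withDensity (fun q => ENNReal.ofReal (ρ q))
  bvNorm_le : bvNorm ρ ≤ (M : ℝ≥0∞)

/-- `μ` is a Borel probability measure on `R` that is invariant under `f`. -/
structure IsInvariantProbability (f : Space3 → Space3) (μ : Measure Space3) : Prop where
  isProbability : IsProbabilityMeasure μ
  on_cube : μ cubeRᶜ = 0
  aemeasurable : AEMeasurable f μ
  map_eq : μ.map f = μ

/-- `μ` is the weak-* limit of the averages `(1 / n_i) ∑_{k = 1}^{n_i} μ_k` along some subsequence
`n_1 < n_2 < ⋯`. -/
def IsCesaroLimit (μs : ℕ → Measure Space3) (μ : Measure Space3) : Prop :=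
  ∃ n : ℕ → ℕ, StrictMono n ∧ ∀ φ : Space3 →ᵇ ℝ,
    Tendsto (fun i => (1 / (n i : ℝ)) * ∑ k ∈ Finset.Icc 1 (n i), ∫ p, φ p ∂(μs k)) atTop
      (𝓝 (∫ p, φ p ∂μ))

end

open Set Filter Topology MeasureTheory
open scoped NNReal ENNReal BoundedContinuousFunction

noncomputable section

/-! The iterated surface is never reparametrized. It is described by `u = f^k ∘ graphMap α` on the
open set `W` of initial points whose orbit has avoided the cuts up to time `k - 1`, and Lebesgue
measure on `W` is the mass being transported. With `F = π ∘ u` and the frame `G = (DF)⁻¹`, a test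
field `ψ` pulls back to `Φ = ψ ∘ F`, and `div ψ` at `F w` is the trace of `DΦ ∘ G`. The variation of
the projected density is thus controlled by `FrameVariationLE W G M`, which needs neither
injectivity of `F` nor a change of variables, so overlapping branches and Jacobian distortion cause
no trouble.

One iterate replaces `G` by `G ∘ L`, where `L` inverts the derivative of the projected map along the
surface and `‖L‖ ≤ 1/l`. Since the trace is cyclic, `tr (DΦ G L)` equals `tr (D(LΦ) G)` up to a term
bounded by the derivative of `L`, that is, by second derivatives of `f` and the curvature of the
surface. The field `LΦ` has norm at most `1/l` but is smooth only off the new cuts. Extending it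
across them costs a factor 2 (`exists_cut_bound`): it is multiplied by cutoffs, after adding a
bounded field that gives the derivatives of the cutoffs a favourable sign. The result is a
Lasota-Yorke inequality `M' = (2/l) M + const` (`exists_frameVariation_step`), contracting with `l =
lam > 2`. `IsMovingGraph.exists_step` also propagates the slope and curvature bounds;
`exists_uniform_movingGraph` sums up.

A plane measure whose distributional gradient is bounded is absolutely continuous, by mollification
and the Sobolev inequality from `W^{1,1}` to `L²` in dimension two. Hence the preimages of the cuts
are null and each `W` has full measure in `J`. The variation bound is tested against continuous
functions, so it survives Cesàro averages and weak limits; the limit measure therefore gives the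
cuts no mass, `f` is continuous almost everywhere for it, and the limit is invariant. -/

/-! ### Measures of bounded variation in the plane are absolutely continuous -/

/-- A smooth even compactly supported probability density on the plane. -/
structure IsMollifier (φ : ℝ × ℝ → ℝ) : Prop where
  contDiff : ContDiff ℝ 1 φ
  hasCompactSupport : HasCompactSupport φ
  nonneg : ∀ x, 0 ≤ φ x
  even : ∀ x, φ (-x) = φ x
  integral_eq_one : ∫ x, φ x = 1

theorem ContDiffBump.isMollifier_normed (φ : ContDiffBump (0 : ℝ × ℝ)) :
    IsMollifier (φ.normed volume) where
  contDiff := φ.contDiff_normed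
  hasCompactSupport := φ.hasCompactSupport_normed
  nonneg := φ.nonneg_normed
  even := φ.normed_neg
  integral_eq_one := φ.integral_normed

namespace IsMollifier

variable {φ : ℝ × ℝ → ℝ}

theorem integrable (hφ : IsMollifier φ) : Integrable φ volume :=
  hφ.contDiff.continuous.integrable_of_hasCompactSupport hφ.hasCompactSupport

theorem fderiv_neg (hφ : IsMollifier φ) (x v : ℝ × ℝ) : fderiv ℝ φ (-x) v = -fderiv ℝ φ x v := by
  have h1 : HasFDerivAt φ (fderiv ℝ φ (-x)) (-x) :=
    (hφ.contDiff.differentiable one_ne_zero _).hasFDerivAt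
  have h2 : HasFDerivAt (fun y => φ (-y)) ((fderiv ℝ φ (-x)).comp (-ContinuousLinearMap.id ℝ _)) x :=
    h1.comp x (hasFDerivAt_id x).neg
  have h3 : (fun y => φ (-y)) = φ := funext hφ.even
  rw [h3] at h2
  rw [h2.fderiv]
  simp

/-- Convolving an integrable weight against a measure with a mollifier. -/
theorem hasFDerivAt_integral (hφ : IsMollifier φ) (ν : Measure (ℝ × ℝ)) {s : ℝ × ℝ → ℝ}
    (hs : Integrable s ν) :
    ContDiff ℝ 1 (fun x => ∫ t, s t * φ (x - t) ∂ν) ∧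
      ∀ x v, fderiv ℝ (fun x => ∫ t, s t * φ (x - t) ∂ν) x v =
        ∫ t, s t * fderiv ℝ φ (x - t) v ∂ν := by
  have he : (fun x => ∫ t, s t * φ (x - t) ∂ν) =
      convolution s φ (ContinuousLinearMap.lsmul ℝ ℝ) ν := by
    ext x; simp [convolution_lsmul]
  refine ⟨?_, fun x v => ?_⟩
  · rw [he]
    exact hφ.hasCompactSupport.contDiff_convolution_right _ hs.locallyIntegrable hφ.contDiff
  have hφ' : Continuous (fderiv ℝ φ) := hφ.contDiff.continuous_fderiv one_ne_zero
  obtain ⟨C, hC⟩ := (hφ.hasCompactSupport.fderiv ℝ).exists_bound_of_continuous hφ'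
  obtain ⟨C₀, hC₀⟩ := hφ.hasCompactSupport.exists_bound_of_continuous hφ.contDiff.continuous
  have hm : ∀ x, AEStronglyMeasurable (fun t => φ (x - t)) ν := fun x =>
    (hφ.contDiff.continuous.comp (continuous_const.sub continuous_id)).aestronglyMeasurable
  have hm' : AEStronglyMeasurable (fun t => fderiv ℝ φ (x - t)) ν :=
    (hφ'.comp (continuous_const.sub continuous_id)).aestronglyMeasurable
  have hi : Integrable (fun t => s t • fderiv ℝ φ (x - t)) ν :=
    (hs.norm.mul_const C).mono' (hs.aestronglyMeasurable.smul hm') (ae_of_all _ fun t => by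
      rw [norm_smul]; exact mul_le_mul_of_nonneg_left (hC _) (norm_nonneg _))
  have hd : HasFDerivAt (fun x => ∫ t, s t * φ (x - t) ∂ν) (∫ t, s t • fderiv ℝ φ (x - t) ∂ν) x :=
    hasFDerivAt_integral_of_dominated_of_fderiv_le (s := univ) (bound := fun t => ‖s t‖ * C)
      (F' := fun y t => s t • fderiv ℝ φ (y - t))
      univ_mem (Eventually.of_forall fun y => hs.aestronglyMeasurable.mul (hm y))
      (hs.mul_bdd (hm x) (ae_of_all _ fun t => hC₀ _)) hi.aestronglyMeasurable
      (ae_of_all _ fun t y _ => by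
        rw [norm_smul]; exact mul_le_mul_of_nonneg_left (hC _) (norm_nonneg _))
      (hs.norm.mul_const C) (ae_of_all _ fun t y _ => by
        have h1 : HasFDerivAt φ (fderiv ℝ φ (y - t)) (y - t) :=
          (hφ.contDiff.differentiable one_ne_zero _).hasFDerivAt
        have h2 := h1.comp y ((hasFDerivAt_id y).sub_const t)
        exact h2.const_mul (s t))
  rw [hd.fderiv, ContinuousLinearMap.integral_apply hi]
  simp

theorem hasCompactSupport_integral (hφ : IsMollifier φ) (ν : Measure (ℝ × ℝ)) {s : ℝ × ℝ → ℝ}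
    {K : Set (ℝ × ℝ)} (hK : IsCompact K) (hs : ∀ᵐ t ∂ν, t ∉ K → s t = 0) :
    HasCompactSupport (fun x => ∫ t, s t * φ (x - t) ∂ν) := by
  refine HasCompactSupport.intro (hK.add hφ.hasCompactSupport.isCompact) fun x hx => ?_
  refine integral_eq_zero_of_ae ?_
  filter_upwards [hs] with t ht
  by_cases htK : t ∈ K
  · have : φ (x - t) = 0 := by
      by_contra h
      exact hx ⟨t, htK, x - t, subset_tsupport _ h, by simp⟩
    simp [this]
  · simp [ht htK]

theorem exists_fderiv_bound (hφ : IsMollifier φ) (v : ℝ × ℝ) : ∃ C, ∀ x, |fderiv ℝ φ x v| ≤ C := by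
  have h1 : Continuous fun x => fderiv ℝ φ x v :=
    (hφ.contDiff.continuous_fderiv one_ne_zero).clm_apply continuous_const
  have h2 : HasCompactSupport fun x => fderiv ℝ φ x v := hφ.hasCompactSupport.fderiv_apply ℝ v
  obtain ⟨C, hC⟩ := h2.exists_bound_of_continuous h1
  exact ⟨C, fun x => hC x⟩

theorem abs_integral_le (hφ : IsMollifier φ) {s : ℝ × ℝ → ℝ} (hs : ∀ x, |s x| ≤ 1) (x : ℝ × ℝ) :
    |∫ t, s t * φ (x - t)| ≤ 1 := by
  have h1 : Integrable (fun t => φ (x - t)) volume := hφ.integrable.comp_sub_left x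
  calc |∫ t, s t * φ (x - t)| ≤ ∫ t, φ (x - t) := by
        rw [← Real.norm_eq_abs]
        refine norm_integral_le_of_norm_le h1 (ae_of_all _ fun t => ?_)
        rw [norm_mul, Real.norm_eq_abs, Real.norm_eq_abs, abs_of_nonneg (hφ.nonneg _)]
        exact mul_le_of_le_one_left (hφ.nonneg _) (hs t)
    _ = 1 := by rw [integral_sub_left_eq_self φ volume x, hφ.integral_eq_one]

/-- The `L¹` norm of the gradient of a mollified measure is controlled by the variation of the
measure. -/
theorem integral_abs_fderiv_le (hφ : IsMollifier φ) (ν : Measure (ℝ × ℝ)) [IsFiniteMeasure ν]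
    {K : Set (ℝ × ℝ)} (hK : IsCompact K) (hνK : ν Kᶜ = 0) {M : ℝ}
    (hM : ∀ ψ : ℝ × ℝ → ℝ × ℝ, ContDiff ℝ 1 ψ → HasCompactSupport ψ →
      (∀ q, |(ψ q).1| ≤ 1 ∧ |(ψ q).2| ≤ 1) → ∫ q, planeDiv ψ q ∂ν ≤ M) :
    ContDiff ℝ 1 (fun x => ∫ t, φ (x - t) ∂ν) ∧ HasCompactSupport (fun x => ∫ t, φ (x - t) ∂ν) ∧
      eLpNorm (fderiv ℝ (fun x => ∫ t, φ (x - t) ∂ν)) 1 volume ≤ ENNReal.ofReal M := by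
  have hae : ∀ᵐ t ∂ν, t ∉ K → (1 : ℝ) = 0 := by
    have : ∀ᵐ t ∂ν, t ∈ K := hνK
    filter_upwards [this] with t ht h using absurd ht h
  have h1 := hφ.hasFDerivAt_integral ν (s := fun _ => 1) (integrable_const _)
  have h2 := hφ.hasCompactSupport_integral ν (s := fun _ => 1) hK hae
  simp only [one_mul] at h1 h2
  set h : ℝ × ℝ → ℝ := fun x => ∫ t, φ (x - t) ∂ν with hh
  refine ⟨h1.1, h2, ?_⟩
  have hcont : ∀ v, Continuous fun x => fderiv ℝ h x v := fun v =>
    (h1.1.continuous_fderiv one_ne_zero).clm_apply continuous_const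
  have hcs : ∀ v, HasCompactSupport fun x => fderiv ℝ h x v := fun v => h2.fderiv_apply ℝ v
  have hint : ∀ v, Integrable (fun x => fderiv ℝ h x v) volume := fun v =>
    (hcont v).integrable_of_hasCompactSupport (hcs v)
  -- the sign of a directional derivative
  set s : ℝ × ℝ → ℝ × ℝ → ℝ := fun v x => (SignType.sign (fderiv ℝ h x v) : ℝ) with hs
  have hsm : ∀ v, Measurable (s v) := fun v => by
    have hsg : Measurable (fun r : ℝ => ((SignType.sign r : SignType) : ℝ)) := by
      have : (fun r : ℝ => ((SignType.sign r : SignType) : ℝ)) =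
          fun r => if 0 < r then 1 else if r < 0 then -1 else 0 := by
        ext r; rw [sign_apply]; split_ifs <;> simp
      rw [this]
      exact Measurable.ite measurableSet_Ioi measurable_const
        (Measurable.ite measurableSet_Iio measurable_const measurable_const)
    exact hsg.comp (hcont v).measurable
  have hs1 : ∀ v x, |s v x| ≤ 1 := fun v x => by
    simp only [hs]; rcases SignType.sign (fderiv ℝ h x v) with _ | _ | _ <;> simp
  have hs0 : ∀ v x, x ∉ tsupport (fun x => fderiv ℝ h x v) → s v x = 0 := fun v x hx => by
    have : fderiv ℝ h x v = 0 :=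
      image_eq_zero_of_notMem_tsupport (f := fun x => fderiv ℝ h x v) hx
    simp [hs, this]
  have hsi : ∀ v, Integrable (s v) volume := fun v => by
    have hi : IntegrableOn (s v) (tsupport fun x => fderiv ℝ h x v) volume :=
      Measure.integrableOn_of_bounded (M := 1) (hcs v).isCompact.measure_lt_top.ne
        (hsm v).aestronglyMeasurable (ae_of_all _ fun x => hs1 v x)
    exact (integrableOn_iff_integrable_of_support_subset fun x hx => by
      by_contra hx'; exact hx (hs0 v x hx')).1 hi
  set S : ℝ × ℝ → ℝ × ℝ → ℝ := fun v x => ∫ t, s v t * φ (x - t) with hSdef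
  have hS : ∀ v, ContDiff ℝ 1 (S v) ∧ ∀ x w, fderiv ℝ (S v) x w =
      ∫ t, s v t * fderiv ℝ φ (x - t) w := fun v => hφ.hasFDerivAt_integral volume (hsi v)
  have hSc : ∀ v, HasCompactSupport (S v) := fun v => hφ.hasCompactSupport_integral volume (s := s v) (hcs v).isCompact
    (ae_of_all _ (hs0 v))
  have hS1 : ∀ v x, |S v x| ≤ 1 := fun v => hφ.abs_integral_le (hs1 v)
  -- Fubini moves the derivative from `S v` onto `h`. The sign changes because the derivative of an
  -- even mollifier is odd, and `s v` times the derivative of `h` is its absolute value.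
  have hkey : ∀ v, ∫ t, -fderiv ℝ (S v) t v ∂ν = ∫ x, |fderiv ℝ h x v| := fun v => by
    obtain ⟨C, hC⟩ := hφ.exists_fderiv_bound v
    have hFm : Continuous fun p : (ℝ × ℝ) × (ℝ × ℝ) => fderiv ℝ φ (p.2 - p.1) v :=
      ((hφ.contDiff.continuous_fderiv one_ne_zero).comp (by fun_prop)).clm_apply continuous_const
    have hF : Integrable (Function.uncurry fun (t x : ℝ × ℝ) => s v x * fderiv ℝ φ (x - t) v)
        (ν.prod volume) := by
      have hi : Integrable (fun p : (ℝ × ℝ) × (ℝ × ℝ) => s v p.2) (ν.prod volume) :=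
        (hsi v).comp_snd ν
      exact hi.mul_bdd hFm.aestronglyMeasurable (ae_of_all _ fun p => hC _)
    calc ∫ t, -fderiv ℝ (S v) t v ∂ν = ∫ t, (∫ x, s v x * fderiv ℝ φ (x - t) v) ∂ν := by
          refine integral_congr_ae (ae_of_all _ fun t => ?_)
          simp only [(hS v).2, ← integral_neg]
          refine integral_congr_ae (ae_of_all _ fun x => ?_)
          have := hφ.fderiv_neg (x - t) v
          rw [neg_sub] at this
          simp [this]
      _ = ∫ x, ∫ t, s v x * fderiv ℝ φ (x - t) v ∂ν := integral_integral_swap hF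
      _ = ∫ x, |fderiv ℝ h x v| := by
          refine integral_congr_ae (ae_of_all _ fun x => ?_)
          simp only
          rw [integral_const_mul, ← h1.2 x v]
          exact sign_mul_self _
  -- The test field is minus the mollified signs of the two partial derivatives; mollification makes
  -- it smooth and keeps its components within `[-1, 1]`.
  have hΨ := hM (fun t => (-S (1, 0) t, -S (0, 1) t)) ((hS _).1.neg.prodMk (hS _).1.neg)
    (by
      refine HasCompactSupport.intro ((hSc (1, 0)).isCompact.union (hSc (0, 1)).isCompact)
        fun x hx => ?_
      rw [mem_union, not_or] at hx
      simp [image_eq_zero_of_notMem_tsupport hx.1, image_eq_zero_of_notMem_tsupport hx.2])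
    (fun q => by simpa using ⟨hS1 _ q, hS1 _ q⟩)
  have hdiv : ∀ t, planeDiv (fun t => (-S (1, 0) t, -S (0, 1) t)) t =
      -fderiv ℝ (S (1, 0)) t (1, 0) + -fderiv ℝ (S (0, 1)) t (0, 1) := fun t => by
    have hd : ∀ v, HasFDerivAt (fun t => -S v t) (-fderiv ℝ (S v) t) t :=
      fun v => ((hS v).1.differentiable one_ne_zero t).hasFDerivAt.neg
    rw [planeDiv, ((hd (1, 0)).prodMk (hd (0, 1))).fderiv]
    simp
  have hSi : ∀ v, Integrable (fun t => -fderiv ℝ (S v) t v) ν := fun v => by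
    have hc : Continuous fun x => fderiv ℝ (S v) x v :=
      ((hS v).1.continuous_fderiv one_ne_zero).clm_apply continuous_const
    exact (hc.integrable_of_hasCompactSupport ((hSc v).fderiv_apply ℝ v)).neg
  simp only [hdiv] at hΨ
  rw [integral_add (hSi _) (hSi _), hkey, hkey, ← integral_add (hint _).abs (hint _).abs] at hΨ
  rw [eLpNorm_one_eq_lintegral_enorm]
  calc ∫⁻ x, ‖fderiv ℝ h x‖ₑ ≤ ∫⁻ x, ENNReal.ofReal (|fderiv ℝ h x (1, 0)| + |fderiv ℝ h x (0, 1)|) := by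
        refine lintegral_mono fun x => ?_
        rw [← ofReal_norm]
        refine ENNReal.ofReal_le_ofReal (ContinuousLinearMap.opNorm_le_bound _
          (add_nonneg (abs_nonneg _) (abs_nonneg _)) ?_)
        intro v
        have : fderiv ℝ h x v = v.1 * fderiv ℝ h x (1, 0) + v.2 * fderiv ℝ h x (0, 1) := by
          conv_lhs => rw [show v = v.1 • ((1 : ℝ), (0 : ℝ)) + v.2 • ((0 : ℝ), (1 : ℝ)) by
            ext <;> simp]
          rw [map_add, map_smul, map_smul]; rfl
        rw [this, Real.norm_eq_abs]
        refine (abs_add_le _ _).trans ?_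
        rw [abs_mul, abs_mul, add_mul, mul_comm, mul_comm |v.2|]
        gcongr
        · exact norm_fst_le v
        · exact norm_snd_le v
    _ = ENNReal.ofReal (∫ x, (|fderiv ℝ h x (1, 0)| + |fderiv ℝ h x (0, 1)|)) :=
        (ofReal_integral_eq_lintegral_ofReal ((hint _).abs.add (hint _).abs)
          (ae_of_all _ fun x => add_nonneg (abs_nonneg _) (abs_nonneg _))).symm
    _ ≤ ENNReal.ofReal M := ENNReal.ofReal_le_ofReal hΨ

/-- Duality between a mollified function and a mollified measure. -/
theorem integral_mul_le (hφ : IsMollifier φ) (ν : Measure (ℝ × ℝ)) [IsFiniteMeasure ν]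
    {K : Set (ℝ × ℝ)} (hK : IsCompact K) (hνK : ν Kᶜ = 0) {M : ℝ}
    (hM : ∀ ψ : ℝ × ℝ → ℝ × ℝ, ContDiff ℝ 1 ψ → HasCompactSupport ψ →
      (∀ q, |(ψ q).1| ≤ 1 ∧ |(ψ q).2| ≤ 1) → ∫ q, planeDiv ψ q ∂ν ≤ M)
    {g : ℝ × ℝ → ℝ} (hg : Continuous g) (hgc : HasCompactSupport g) (hg0 : ∀ x, 0 ≤ g x) :
    ENNReal.ofReal (∫ t, (∫ x, g x * φ (t - x)) ∂ν) ≤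
      eLpNorm g 2 volume * (eLpNormLESNormFDerivOneConst (volume : Measure (ℝ × ℝ)) 2 *
        ENNReal.ofReal M) := by
  obtain ⟨h1, h2, h3⟩ := hφ.integral_abs_fderiv_le ν hK hνK hM
  set h : ℝ × ℝ → ℝ := fun x => ∫ t, φ (x - t) ∂ν with hh
  -- In dimension two the Sobolev exponent of an integrable gradient is the conjugate of 2, namely 2
  -- itself.
  have hgns := eLpNorm_le_eLpNorm_fderiv_one volume h1 h2 (p := 2) (by
    have : Module.finrank ℝ (ℝ × ℝ) = 2 := by simp
    rw [this]
    exact NNReal.HolderConjugate.two_two)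
  have hsw : ∫ t, (∫ x, g x * φ (t - x)) ∂ν = ∫ x, g x * h x := by
    obtain ⟨C, hC⟩ := hφ.hasCompactSupport.exists_bound_of_continuous hφ.contDiff.continuous
    have hF : Integrable (Function.uncurry fun (t x : ℝ × ℝ) => g x * φ (t - x))
        (ν.prod volume) := by
      have hi : Integrable (fun p : (ℝ × ℝ) × (ℝ × ℝ) => g p.2) (ν.prod volume) :=
        (hg.integrable_of_hasCompactSupport hgc).comp_snd ν
      have hc : Continuous fun p : (ℝ × ℝ) × (ℝ × ℝ) => φ (p.1 - p.2) :=
        hφ.contDiff.continuous.comp (by fun_prop)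
      exact hi.mul_bdd hc.aestronglyMeasurable (ae_of_all _ fun p => hC _)
    rw [integral_integral_swap hF]
    refine integral_congr_ae (ae_of_all _ fun x => ?_)
    simp only [hh]
    rw [integral_const_mul]
    congr 1
    refine integral_congr_ae (ae_of_all _ fun t => ?_)
    simp only
    rw [← hφ.even, neg_sub]
  rw [hsw]
  have hgm : AEStronglyMeasurable g volume := hg.aestronglyMeasurable
  have hhm : AEStronglyMeasurable h volume := h1.continuous.aestronglyMeasurable
  have hh0 : ∀ x, 0 ≤ h x := fun x => integral_nonneg fun t => hφ.nonneg _
  have hhold := eLpNorm_smul_le_mul_eLpNorm (p := 2) (q := 2) (r := 1) hhm hgm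
  calc ENNReal.ofReal (∫ x, g x * h x) = eLpNorm (g • h) 1 volume := by
        rw [eLpNorm_one_eq_lintegral_enorm, ofReal_integral_eq_lintegral_ofReal]
        · refine lintegral_congr fun x => ?_
          rw [Pi.smul_apply', smul_eq_mul, Real.enorm_of_nonneg (mul_nonneg (hg0 x) (hh0 x))]
        · exact (hg.mul h1.continuous).integrable_of_hasCompactSupport hgc.mul_right
        · exact ae_of_all _ fun x => mul_nonneg (hg0 x) (hh0 x)
    _ ≤ _ := hhold.trans (by gcongr; exact hgns.trans (mul_le_mul_right h3 _))

end IsMollifier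

/-- A finite compactly supported measure on the plane whose distributional divergence is bounded
is absolutely continuous with respect to Lebesgue measure. -/
theorem absolutelyContinuous_of_integral_planeDiv_le (ν : Measure (ℝ × ℝ)) [IsFiniteMeasure ν]
    {K : Set (ℝ × ℝ)} (hK : IsCompact K) (hνK : ν Kᶜ = 0) {M : ℝ}
    (hM : ∀ ψ : ℝ × ℝ → ℝ × ℝ, ContDiff ℝ 1 ψ → HasCompactSupport ψ →
      (∀ q, |(ψ q).1| ≤ 1 ∧ |(ψ q).2| ≤ 1) → ∫ q, planeDiv ψ q ∂ν ≤ M) :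
    ν ≪ volume := by
  set c : ℝ≥0∞ := eLpNormLESNormFDerivOneConst (volume : Measure (ℝ × ℝ)) 2 * ENNReal.ofReal M
    with hc
  have hctop : c ≠ ⊤ := ENNReal.mul_ne_top ENNReal.coe_ne_top ENNReal.ofReal_ne_top
  -- the estimate for continuous compactly supported functions
  have hdual : ∀ g : ℝ × ℝ → ℝ, Continuous g → HasCompactSupport g → (∀ x, g x ∈ Icc (0 : ℝ) 1) →
      ENNReal.ofReal (∫ t, g t ∂ν) ≤ eLpNorm g 2 volume * c := by
    intro g hg hgc hg01
    set φ : ℕ → ContDiffBump (0 : ℝ × ℝ) := fun n =>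
      ⟨(1 / ((n : ℝ) + 1)) / 2, 1 / ((n : ℝ) + 1), by positivity, half_lt_self (by positivity)⟩
      with hφ
    have hlim : Tendsto (fun n => (φ n).rOut) atTop (𝓝 0) :=
      tendsto_one_div_add_atTop_nhds_zero_nat
    have hpt : ∀ t, Tendsto (fun n => ∫ x, g x * (φ n).normed volume (t - x)) atTop (𝓝 (g t)) := by
      intro t
      refine (ContDiffBump.convolution_tendsto_right_of_continuous (μ := volume) hlim hg t).congr
        fun n => ?_
      rw [convolution_lsmul_swap]
      exact integral_congr_ae (ae_of_all _ fun x => mul_comm _ _)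
    have hint : Tendsto (fun n => ∫ t, (∫ x, g x * (φ n).normed volume (t - x)) ∂ν) atTop
        (𝓝 (∫ t, g t ∂ν)) := by
      refine tendsto_integral_of_dominated_convergence (fun _ => 1) (fun n => ?_)
        (integrable_const _) (fun n => ae_of_all _ fun t => ?_) (ae_of_all _ hpt)
      · exact ((φ n).isMollifier_normed.hasFDerivAt_integral volume
          (hg.integrable_of_hasCompactSupport hgc)).1.continuous.aestronglyMeasurable
      · exact (φ n).isMollifier_normed.abs_integral_le
          (fun x => by rw [abs_of_nonneg (hg01 x).1]; exact (hg01 x).2) t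
    refine le_of_tendsto ((ENNReal.continuous_ofReal.tendsto _).comp hint)
      (Eventually.of_forall fun n => ?_)
    exact (φ n).isMollifier_normed.integral_mul_le ν hK hνK hM hg hgc fun x => (hg01 x).1
  -- compact null sets
  have hcompact : ∀ C : Set (ℝ × ℝ), IsCompact C → volume C = 0 → ν C = 0 := by
    intro C hC hC0
    -- A Urysohn function between `C` and an open set `U` of measure below `ε` dominates the
    -- indicator of `C`, while its `L²` norm is at most `ε ^ (1/2)`.
    have hsmall : ∀ ε : ℝ≥0∞, ε ≠ 0 → ν C ≤ ε ^ (1 / 2 : ℝ) * c := by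
      intro ε hε
      obtain ⟨U, hCU, hUo, hU⟩ := C.exists_isOpen_lt_of_lt ε (μ := volume)
        (by rw [hC0]; exact pos_iff_ne_zero.2 hε)
      obtain ⟨g, hg1, hg0, hgc, hg01⟩ := exists_continuous_one_zero_of_isCompact hC
        hUo.isClosed_compl (disjoint_compl_right_iff_subset.2 hCU)
      have hgi : Integrable g ν := g.continuous.integrable_of_hasCompactSupport hgc
      calc ν C = ∫⁻ _ in C, 1 ∂ν := by simp
        _ ≤ ∫⁻ x in C, ENNReal.ofReal (g x) ∂ν :=
            setLIntegral_mono' hC.measurableSet fun x hx => by simp [hg1 hx]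
        _ ≤ ∫⁻ x, ENNReal.ofReal (g x) ∂ν := setLIntegral_le_lintegral _ _
        _ = ENNReal.ofReal (∫ x, g x ∂ν) :=
            (ofReal_integral_eq_lintegral_ofReal hgi (ae_of_all _ fun x => (hg01 x).1)).symm
        _ ≤ eLpNorm g 2 volume * c := hdual g g.continuous hgc hg01
        _ ≤ ε ^ (1 / 2 : ℝ) * c := by
            gcongr
            calc eLpNorm g 2 volume ≤ eLpNorm (U.indicator fun _ => (1 : ℝ)) 2 volume := by
                  refine eLpNorm_mono fun x => ?_
                  by_cases hx : x ∈ U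
                  · rw [indicator_of_mem hx, Real.norm_of_nonneg (hg01 x).1]
                    simpa using (hg01 x).2
                  · rw [hg0 hx]; simp
              _ ≤ ε ^ (1 / 2 : ℝ) := by
                  rw [eLpNorm_indicator_const hUo.measurableSet (by simp) (by simp)]
                  simp only [enorm_one, one_mul, ENNReal.toReal_ofNat]
                  gcongr
    have hlim : Tendsto (fun ε : ℝ≥0∞ => ε ^ (1 / 2 : ℝ) * c) (𝓝[≠] 0) (𝓝 0) := by
      have h1 : Tendsto (fun ε : ℝ≥0∞ => ε ^ (1 / 2 : ℝ)) (𝓝[≠] 0) (𝓝 0) := by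
        have := (ENNReal.continuous_rpow_const (y := 1 / 2)).tendsto (0 : ℝ≥0∞)
        rw [ENNReal.zero_rpow_of_pos (by norm_num)] at this
        exact this.mono_left nhdsWithin_le_nhds
      simpa using ENNReal.Tendsto.mul_const h1 (Or.inr hctop)
    have := ge_of_tendsto hlim (eventually_nhdsWithin_of_forall fun ε hε => hsmall ε hε)
    exact le_antisymm this bot_le
  refine Measure.AbsolutelyContinuous.mk fun s hs hs0 => ?_
  by_contra hne
  obtain ⟨C, hCs, hC, hlt⟩ := hs.exists_isCompact_lt_add (measure_ne_top ν s) hne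
  rw [hcompact C hC (measure_mono_null hCs hs0), zero_add] at hlt
  exact lt_irrefl _ hlt

/-! ### Cutoff functions adapted to a finite set of cut points -/

/-- A smooth even well profile: zero near the origin, one at distance at least `r`. -/
def wellProfile (r t : ℝ) : ℝ := Real.smoothTransition (2 * (t / r) ^ 2 - 1)

theorem wellProfile_contDiff (r : ℝ) : ContDiff ℝ 1 (wellProfile r) :=
  Real.smoothTransition.contDiff.comp (by fun_prop)

theorem wellProfile_mem_Icc (r t : ℝ) : wellProfile r t ∈ Icc (0 : ℝ) 1 :=
  ⟨Real.smoothTransition.nonneg _, Real.smoothTransition.le_one _⟩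

theorem wellProfile_eq_zero {r t : ℝ} (hr : 0 < r) (ht : |t| ≤ r / 2) : wellProfile r t = 0 := by
  refine Real.smoothTransition.zero_of_nonpos ?_
  have h1 : |t / r| ≤ 1 / 2 := by
    rw [abs_div, abs_of_pos hr, div_le_div_iff₀ hr two_pos]; linarith
  have h2 : (t / r) ^ 2 ≤ (1 / 2) ^ 2 := sq_le_sq' (abs_le.1 h1).1 (abs_le.1 h1).2
  linarith

theorem wellProfile_eq_one {r t : ℝ} (hr : 0 < r) (ht : r ≤ |t|) : wellProfile r t = 1 := by
  refine Real.smoothTransition.one_of_one_le ?_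
  have h1 : 1 ≤ |t / r| := by rwa [abs_div, abs_of_pos hr, one_le_div hr]
  have h2 : 1 ≤ (t / r) ^ 2 := by rw [← sq_abs]; exact one_le_pow₀ h1
  linarith

theorem deriv_wellProfile_eq_zero {r t : ℝ} (hr : 0 < r) (ht : r < |t|) :
    deriv (wellProfile r) t = 0 := by
  have : wellProfile r =ᶠ[𝓝 t] fun _ => 1 := by
    filter_upwards [(continuous_abs.tendsto t).eventually (lt_mem_nhds ht)] with s hs
      using wellProfile_eq_one hr hs.le
  rw [this.deriv_eq, deriv_const]

/-- The profile depends on `t` through `t ^ 2` and increases with it, so off the origin its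
derivative, when nonzero, has the sign of `t`. This is what makes `ζ` the sign of the derivative of
the cutoffs. -/
theorem mul_deriv_wellProfile_nonneg (r t : ℝ) : 0 ≤ t * deriv (wellProfile r) t := by
  have h1 : HasDerivAt (fun t : ℝ => 2 * (t / r) ^ 2 - 1) (2 * (2 * (t / r) * (1 / r))) t := by
    have := ((((hasDerivAt_id t).div_const r).pow 2).const_mul 2).sub_const 1
    simpa using this
  have h2 : HasDerivAt Real.smoothTransition (deriv Real.smoothTransition (2 * (t / r) ^ 2 - 1))
      (2 * (t / r) ^ 2 - 1) :=
    ((Real.smoothTransition.contDiff (n := 1)).differentiable (by norm_num) _).hasDerivAt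
  have h3 : HasDerivAt (wellProfile r) _ t := h2.comp t h1
  rw [h3.deriv]
  have h4 : 0 ≤ deriv Real.smoothTransition (2 * (t / r) ^ 2 - 1) :=
    Real.smoothTransition.monotone.deriv_nonneg
  have h5 : t * (deriv Real.smoothTransition (2 * (t / r) ^ 2 - 1) * (2 * (2 * (t / r) * (1 / r)))) =
      4 * (t / r) ^ 2 * deriv Real.smoothTransition (2 * (t / r) ^ 2 - 1) := by ring
  rw [h5]
  positivity

theorem exists_deriv_wellProfile_bound {r : ℝ} (hr : 0 < r) :
    ∃ C, ∀ t, |deriv (wellProfile r) t| ≤ C := by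
  have hc : Continuous (deriv (wellProfile r)) :=
    (wellProfile_contDiff r).continuous_deriv le_rfl
  have hs : HasCompactSupport (deriv (wellProfile r)) := by
    refine HasCompactSupport.intro (isCompact_Icc (a := -r) (b := r)) fun t ht => ?_
    refine deriv_wellProfile_eq_zero hr ?_
    by_contra h
    exact ht (abs_le.1 (not_lt.1 h))
  obtain ⟨C, hC⟩ := hs.exists_bound_of_continuous hc
  exact ⟨C, fun t => hC t⟩

/-- The sign function, localized near the origin. -/
def localSign (r t : ℝ) : ℝ := (SignType.sign t : ℝ) * (1 - wellProfile r t)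

/-- Off the origin the sign is locally constant, so only the smooth factor is differentiated. -/
theorem hasDerivAt_localSign (r : ℝ) {t : ℝ} (ht : t ≠ 0) :
    ContDiffAt ℝ 1 (localSign r) t ∧
      deriv (localSign r) t = -((SignType.sign t : ℝ) * deriv (wellProfile r) t) := by
  have h1 : localSign r =ᶠ[𝓝 t] fun s => (SignType.sign t : ℝ) * (1 - wellProfile r s) := by
    rcases lt_or_gt_of_ne ht with h | h
    · filter_upwards [gt_mem_nhds h] with s hs
      simp [localSign, sign_neg h, sign_neg hs]
    · filter_upwards [lt_mem_nhds h] with s hs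
      simp [localSign, sign_pos h, sign_pos hs]
  refine ⟨ContDiffAt.congr_of_eventuallyEq ?_ h1, ?_⟩
  · exact contDiffAt_const.mul (contDiffAt_const.sub (wellProfile_contDiff r).contDiffAt)
  · rw [h1.deriv_eq]
    have : HasDerivAt (wellProfile r) (deriv (wellProfile r) t) t :=
      ((wellProfile_contDiff r).differentiable one_ne_zero t).hasDerivAt
    rw [((this.const_sub 1).const_mul _).deriv]
    ring

theorem abs_sign_le_one (t : ℝ) : |(SignType.sign t : ℝ)| ≤ 1 := by
  rcases SignType.sign t with _ | _ | _ <;> simp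

/-- Near any point at most one translate of a function supported in `[-2δ, 2δ]` contributes. -/
theorem sum_translates_eq {A : Finset ℝ} {δ : ℝ}
    (hA : ∀ a ∈ A, ∀ b ∈ A, a ≠ b → 5 * δ ≤ |a - b|) (hδ : 0 < δ) (x : ℝ) :
    (∃ a ∈ A, ∀ h : ℝ → ℝ, (∀ t, 2 * δ < |t| → h t = 0) → ∑ b ∈ A, h (x - b) = h (x - a)) ∨
      ∀ h : ℝ → ℝ, (∀ t, 2 * δ < |t| → h t = 0) → ∑ b ∈ A, h (x - b) = 0 := by
  by_cases hx : ∃ a ∈ A, |x - a| ≤ 2 * δ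
  · obtain ⟨a, ha, hxa⟩ := hx
    refine Or.inl ⟨a, ha, fun h hh => Finset.sum_eq_single_of_mem a ha fun b hb hba => hh _ ?_⟩
    have h1 := hA b hb a ha hba
    have h2 : |b - a| ≤ |x - a| + |x - b| := by
      have : b - a = (x - a) - (x - b) := by ring
      rw [this]; exact abs_sub _ _
    linarith
  · push Not at hx
    exact Or.inr fun h hh => Finset.sum_eq_zero fun b hb => hh _ (hx b hb)

/-- Cutoffs `η n` vanishing near a finite set `A` and increasing to one off `A`, with a bounded
function `ζ`, smooth off `A`, equal to the sign of the derivative of `η n` wherever that derivative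
does not vanish. -/
theorem exists_cutoffs (A : Finset ℝ) : ∃ (ζ : ℝ → ℝ) (C : ℝ) (η : ℕ → ℝ → ℝ),
    0 ≤ C ∧ (∀ x ∉ A, ContDiffAt ℝ 1 ζ x) ∧ (∀ x, |ζ x| ≤ 1) ∧ (∀ x ∉ A, |deriv ζ x| ≤ C) ∧
    (∀ n, ContDiff ℝ 1 (η n)) ∧ (∀ n x, η n x ∈ Icc (0 : ℝ) 1) ∧
    (∀ n, ∀ a ∈ A, ∀ᶠ x in 𝓝 a, η n x = 0) ∧
    (∀ n, ∀ x ∉ A, |deriv (η n) x| ≤ deriv (η n) x * ζ x) ∧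
    (∀ n, ∃ K, ∀ x, |deriv (η n) x| ≤ K) ∧ ∀ x ∉ A, Tendsto (fun n => η n x) atTop (𝓝 1) := by
  -- A separation of `5 * δ` leaves a strict margin: a point within `2 * δ` of one cut point is at
  -- least `3 * δ` away from every other.
  obtain ⟨δ, hA, hδ⟩ : ∃ δ : ℝ, (∀ p ∈ A.offDiag, 5 * δ ≤ |p.1 - p.2|) ∧ 0 < δ := by
    have h1 : ∀ᶠ δ : ℝ in 𝓝[>] 0, ∀ p ∈ A.offDiag, 5 * δ ≤ |p.1 - p.2| := by
      rw [Finset.eventually_all]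
      intro p hp
      have hp' : 0 < |p.1 - p.2| := abs_pos.2 (sub_ne_zero.2 (Finset.mem_offDiag.1 hp).2.2)
      have : Tendsto (fun δ : ℝ => 5 * δ) (𝓝[>] 0) (𝓝 (5 * 0)) :=
        ((continuous_const.mul continuous_id).tendsto 0).mono_left nhdsWithin_le_nhds
      rw [mul_zero] at this
      exact (this.eventually (gt_mem_nhds hp')).mono fun _ h => h.le
    exact (h1.and self_mem_nhdsWithin).exists
  have hA' : ∀ a ∈ A, ∀ b ∈ A, a ≠ b → 5 * δ ≤ |a - b| := fun a ha b hb hab =>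
    hA (a, b) (Finset.mem_offDiag.2 ⟨ha, hb, hab⟩)
  have hsum := sum_translates_eq hA' hδ
  -- The wells shrink with `n`, so the cutoffs tend to one, whereas `ζ` is built at the fixed scale
  -- `2 * δ`; this is why the bound on its derivative does not depend on `n`.
  set r : ℕ → ℝ := fun n => δ * (1 / ((n : ℝ) + 1)) with hr
  have hr0 : ∀ n, 0 < r n := fun n => by positivity
  have hrδ : ∀ n, r n ≤ δ := fun n => mul_le_of_le_one_right hδ.le (by
    rw [div_le_one (by positivity)]; linarith [n.cast_nonneg (α := ℝ)])
  have h2δ : (0 : ℝ) < 2 * δ := by linarith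
  obtain ⟨C, hC⟩ := exists_deriv_wellProfile_bound h2δ
  have hC0 : 0 ≤ C := (abs_nonneg _).trans (hC 0)
  have hη' : ∀ n x, deriv (fun x => 1 - ∑ a ∈ A, (1 - wellProfile (r n) (x - a))) x =
      ∑ a ∈ A, deriv (wellProfile (r n)) (x - a) := fun n x => by
    have h1 : ∀ a ∈ A, HasDerivAt (fun x => 1 - wellProfile (r n) (x - a))
        (-deriv (wellProfile (r n)) (x - a)) x := fun a _ => by
      have h2 : HasDerivAt (wellProfile (r n)) (deriv (wellProfile (r n)) (x - a)) (x - a) :=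
        ((wellProfile_contDiff _).differentiable one_ne_zero _).hasDerivAt
      exact (h2.comp_sub_const x a).const_sub 1
    rw [((HasDerivAt.fun_sum h1).const_sub 1).deriv]
    simp
  have hW : ∀ n t, 2 * δ < |t| → 1 - wellProfile (r n) t = 0 := fun n t ht => by
    rw [wellProfile_eq_one (hr0 n) (by linarith [hrδ n]), sub_self]
  have hW' : ∀ n t, 2 * δ < |t| → deriv (wellProfile (r n)) t = 0 := fun n t ht =>
    deriv_wellProfile_eq_zero (hr0 n) (by linarith [hrδ n])
  have hS : ∀ t, 2 * δ < |t| → localSign (2 * δ) t = 0 := fun t ht => by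
    simp [localSign, wellProfile_eq_one h2δ ht.le]
  have hsub : ∀ {x}, x ∉ A → ∀ a ∈ A, x - a ≠ 0 := fun hx a ha h => hx (by
    rw [sub_eq_zero.1 h]; exact ha)
  have hζ : ∀ x ∉ A, ∀ a ∈ A, ContDiffAt ℝ 1 (fun x => localSign (2 * δ) (x - a)) x :=
    fun x hx a ha => ContDiffAt.comp (g := localSign (2 * δ)) x (hasDerivAt_localSign _ (hsub hx a ha)).1
      (contDiffAt_id.sub contDiffAt_const)
  refine ⟨fun x => ∑ a ∈ A, localSign (2 * δ) (x - a), C,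
    fun n x => 1 - ∑ a ∈ A, (1 - wellProfile (r n) (x - a)), hC0, ?_, ?_, ?_, ?_, ?_, ?_, ?_, ?_, ?_⟩
  · exact fun x hx => ContDiffAt.sum fun a ha => hζ x hx a ha
  · intro x
    have hb : ∀ t, |localSign (2 * δ) t| ≤ 1 := fun t => by
      rw [localSign, abs_mul]
      have h1 := wellProfile_mem_Icc (2 * δ) t
      exact mul_le_one₀ (abs_sign_le_one t) (abs_nonneg _) (abs_le.2 ⟨by linarith [h1.2], by linarith [h1.1]⟩)
    rcases hsum x with ⟨a, _, h⟩ | h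
    · simp only [h _ hS]; exact hb _
    · simp only [h _ hS]; simp
  · intro x hx
    have h1 : deriv (fun x => ∑ a ∈ A, localSign (2 * δ) (x - a)) x =
        ∑ a ∈ A, -((SignType.sign (x - a) : ℝ) * deriv (wellProfile (2 * δ)) (x - a)) := by
      rw [deriv_fun_sum fun a ha => (hζ x hx a ha).differentiableAt one_ne_zero]
      refine Finset.sum_congr rfl fun a ha => ?_
      rw [deriv_comp_sub_const, (hasDerivAt_localSign _ (hsub hx a ha)).2]
    have hh : ∀ t, 2 * δ < |t| → -((SignType.sign t : ℝ) * deriv (wellProfile (2 * δ)) t) = 0 :=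
      fun t ht => by simp [deriv_wellProfile_eq_zero h2δ ht]
    rw [h1]
    rcases hsum x with ⟨a, _, h⟩ | h
    · rw [h _ hh, abs_neg, abs_mul]
      exact (mul_le_of_le_one_left (abs_nonneg _) (abs_sign_le_one _)).trans (hC _)
    · rw [h _ hh]; simpa using hC0
  · exact fun n => contDiff_const.sub (ContDiff.sum fun a _ => contDiff_const.sub
      ((wellProfile_contDiff _).comp (contDiff_id.sub contDiff_const)))
  · intro n x
    rcases hsum x with ⟨a, _, h⟩ | h
    · simp only [h _ (hW n), sub_sub_cancel]; exact wellProfile_mem_Icc _ _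
    · simp only [h _ (hW n)]; simp
  · intro n a ha
    have : ∀ᶠ x in 𝓝 a, |x - a| < r n / 2 := by
      have := Metric.ball_mem_nhds a (half_pos (hr0 n))
      filter_upwards [this] with x hx
      simpa [Real.dist_eq] using hx
    filter_upwards [this] with x hx
    rw [Finset.sum_eq_single_of_mem a ha fun b hb hba => hW n _ ?_,
      wellProfile_eq_zero (hr0 n) hx.le]
    · ring
    · have h1 := hA' b hb a ha hba
      have h2 : |b - a| ≤ |x - a| + |x - b| := by
        have : b - a = (x - a) - (x - b) := by ring
        rw [this]; exact abs_sub _ _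
      linarith [hrδ n]
  · intro n x hx
    rw [hη']
    simp only
    rcases hsum x with ⟨a, ha, h⟩ | h
    · rw [h _ (hW' n), h _ hS]
      -- Within `δ` of `a` the localized sign is the exact sign; beyond it the derivative of the
      -- cutoff vanishes because `r n ≤ δ`.
      by_cases ht : |x - a| ≤ δ
      · have h1 : localSign (2 * δ) (x - a) = (SignType.sign (x - a) : ℝ) := by
          rw [localSign, wellProfile_eq_zero h2δ (by linarith)]; ring
        have h2 := mul_deriv_wellProfile_nonneg (r n) (x - a)
        rw [h1]
        rcases lt_or_gt_of_ne (hsub hx a ha) with h3 | h3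
        · have : deriv (wellProfile (r n)) (x - a) ≤ 0 := by
            by_contra h4; push Not at h4; nlinarith
          rw [sign_neg h3, abs_of_nonpos this]; simp
        · have : 0 ≤ deriv (wellProfile (r n)) (x - a) := by
            by_contra h4; push Not at h4; nlinarith
          rw [sign_pos h3, abs_of_nonneg this]; simp
      · rw [deriv_wellProfile_eq_zero (hr0 n) (by linarith [hrδ n, not_le.1 ht])]; simp
    · rw [h _ (hW' n)]; simp
  · intro n
    obtain ⟨K, hK⟩ := exists_deriv_wellProfile_bound (hr0 n)
    refine ⟨K, fun x => ?_⟩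
    rw [hη']
    rcases hsum x with ⟨a, ha, h⟩ | h
    · rw [h _ (hW' n)]; exact hK _
    · rw [h _ (hW' n), abs_zero]; exact (abs_nonneg _).trans (hK 0)
  · intro x hx
    have h1 : ∀ᶠ n in atTop, ∀ a ∈ A, r n ≤ |x - a| := by
      rw [Finset.eventually_all]
      intro a ha
      have h2 : Tendsto r atTop (𝓝 (δ * 0)) := tendsto_one_div_add_atTop_nhds_zero_nat.const_mul δ
      rw [mul_zero] at h2
      exact (h2.eventually (gt_mem_nhds (abs_pos.2 (hsub hx a ha)))).mono fun _ h => h.le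
    refine tendsto_const_nhds.congr' ?_
    filter_upwards [h1] with n hn
    rw [Finset.sum_eq_zero fun a ha => ?_, sub_zero]
    rw [wellProfile_eq_one (hr0 n) (hn a ha), sub_self]

/-! ### The variation functional in moving frames -/

/-- The trace of an endomorphism of the plane. -/
def planeTrace (L : ℝ × ℝ →L[ℝ] ℝ × ℝ) : ℝ := (L (1, 0)).1 + (L (0, 1)).2

theorem plane_decomp (v : ℝ × ℝ) : v = v.1 • ((1 : ℝ), (0 : ℝ)) + v.2 • ((0 : ℝ), (1 : ℝ)) := by
  ext <;> simp

/-- Cyclicity is what transfers the contraction from the frame to the test field in the Lasota-Yorke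
step. -/
theorem planeTrace_comp_comm (X Y : ℝ × ℝ →L[ℝ] ℝ × ℝ) :
    planeTrace (X ∘L Y) = planeTrace (Y ∘L X) := by
  simp only [planeTrace, ContinuousLinearMap.comp_apply]
  rw [plane_decomp (Y (1, 0)), plane_decomp (Y (0, 1)), plane_decomp (X (1, 0)),
    plane_decomp (X (0, 1))]
  simp only [map_add, map_smul, Prod.fst_add, Prod.snd_add, Prod.smul_fst, Prod.smul_snd,
    smul_eq_mul]
  ring

theorem planeTrace_add (X Y : ℝ × ℝ →L[ℝ] ℝ × ℝ) :
    planeTrace (X + Y) = planeTrace X + planeTrace Y := by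
  simp only [planeTrace, _root_.add_apply, Prod.fst_add, Prod.snd_add]; ring

theorem planeTrace_smul (c : ℝ) (X : ℝ × ℝ →L[ℝ] ℝ × ℝ) :
    planeTrace (c • X) = c * planeTrace X := by
  simp [planeTrace, mul_add]

theorem abs_planeTrace_le_of_apply {X : ℝ × ℝ →L[ℝ] ℝ × ℝ} {C : ℝ} (h : ∀ v, ‖X v‖ ≤ C * ‖v‖) :
    |planeTrace X| ≤ 2 * C := by
  have h1 := h (1, 0)
  have h2 := h (0, 1)
  have h3 : ‖((1 : ℝ), (0 : ℝ))‖ = 1 := by simp [Prod.norm_def]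
  have h4 : ‖((0 : ℝ), (1 : ℝ))‖ = 1 := by simp [Prod.norm_def]
  rw [h3, mul_one] at h1
  rw [h4, mul_one] at h2
  calc |planeTrace X| ≤ |(X (1, 0)).1| + |(X (0, 1)).2| := abs_add_le _ _
    _ ≤ C + C := add_le_add ((norm_fst_le _).trans h1) ((norm_snd_le _).trans h2)
    _ = 2 * C := by ring

theorem continuous_planeTrace : Continuous planeTrace := by
  unfold planeTrace; fun_prop

theorem abs_planeTrace_le (X : ℝ × ℝ →L[ℝ] ℝ × ℝ) : |planeTrace X| ≤ 2 * ‖X‖ :=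
  abs_planeTrace_le_of_apply X.le_opNorm

/-- The variation of Lebesgue measure on `W`, computed along the frame `G`, is at most `M`. The test
fields are `C¹` on `W` but need not vanish near the boundary of `W`. -/
def FrameVariationLE (W : Set (ℝ × ℝ)) (G : ℝ × ℝ → ℝ × ℝ →L[ℝ] ℝ × ℝ) (M : ℝ) : Prop :=
  ∀ Φ : ℝ × ℝ → ℝ × ℝ, ContDiffOn ℝ 1 Φ W → (∀ w ∈ W, ‖Φ w‖ ≤ 1) →
    (∃ K, ∀ w ∈ W, ‖fderiv ℝ Φ w ∘L G w‖ ≤ K) →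
    ∫ w in W, planeTrace (fderiv ℝ Φ w ∘L G w) ≤ M

/-- Both sides are homogeneous in the test field, so it can be rescaled to norm one. -/
theorem FrameVariationLE.of_norm_le {W : Set (ℝ × ℝ)}
    {G : ℝ × ℝ → ℝ × ℝ →L[ℝ] ℝ × ℝ} {M : ℝ}
    (h : FrameVariationLE W G M) {s : ℝ} (hs : 0 < s) {Φ : ℝ × ℝ → ℝ × ℝ} (hΦ : ContDiffOn ℝ 1 Φ W)
    (hΦs : ∀ w ∈ W, ‖Φ w‖ ≤ s) (hK : ∃ K, ∀ w ∈ W, ‖fderiv ℝ Φ w ∘L G w‖ ≤ K) :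
    ∫ w in W, planeTrace (fderiv ℝ Φ w ∘L G w) ≤ s * M := by
  obtain ⟨K, hK⟩ := hK
  have hd : ∀ w, fderiv ℝ (fun w => s⁻¹ • Φ w) w = s⁻¹ • fderiv ℝ Φ w := fun w =>
    congrFun (fderiv_const_smul_field s⁻¹) w
  have h1 := h (fun w => s⁻¹ • Φ w) (hΦ.const_smul _) (fun w hw => by
      rw [norm_smul, Real.norm_of_nonneg (inv_nonneg.2 hs.le), inv_mul_le_iff₀ hs, mul_one]
      exact hΦs w hw) ⟨s⁻¹ * K, fun w hw => by
      rw [hd, ContinuousLinearMap.smul_comp, norm_smul, Real.norm_of_nonneg (inv_nonneg.2 hs.le)]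
      exact mul_le_mul_of_nonneg_left (hK w hw) (inv_nonneg.2 hs.le)⟩
  simp only [hd, ContinuousLinearMap.smul_comp, planeTrace_smul] at h1
  rwa [integral_const_mul, inv_mul_le_iff₀ hs] at h1

theorem continuousOn_fderiv_comp {W : Set (ℝ × ℝ)} (hW : IsOpen W)
    {G : ℝ × ℝ → ℝ × ℝ →L[ℝ] ℝ × ℝ} (hG : ContinuousOn G W)
    {Φ : ℝ × ℝ → ℝ × ℝ} (hΦ : ContDiffOn ℝ 1 Φ W) :
    ContinuousOn (fun w => fderiv ℝ Φ w ∘L G w) W :=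
  (hΦ.continuousOn_fderiv_of_isOpen hW le_rfl).clm_comp hG

theorem integrableOn_planeTrace {W : Set (ℝ × ℝ)} (hW : IsOpen W) (hWv : volume W ≤ 1)
    {T : ℝ × ℝ → ℝ × ℝ →L[ℝ] ℝ × ℝ} (hT : ContinuousOn T W)
    {K : ℝ} (hK : ∀ w ∈ W, ‖T w‖ ≤ K) : IntegrableOn (fun w => planeTrace (T w)) W volume := by
  have : IsFiniteMeasure (volume.restrict W) :=
    ⟨by simpa using hWv.trans_lt ENNReal.one_lt_top⟩
  refine Integrable.of_bound (C := 2 * K) ?_ ?_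
  · exact (continuous_planeTrace.comp_continuousOn hT).aestronglyMeasurable hW.measurableSet
  · filter_upwards [ae_restrict_mem hW.measurableSet] with w hw
    exact (abs_planeTrace_le _).trans (by linarith [hK w hw])

/-- Cutting the domain along the preimages of finitely many vertical and horizontal lines at most
doubles the variation, up to an additive constant. -/
theorem exists_cut_bound (A B : Finset ℝ) : ∃ C : ℝ, 0 ≤ C ∧
    ∀ (W W' : Set (ℝ × ℝ)) (F : ℝ × ℝ → ℝ × ℝ) (G : ℝ × ℝ → ℝ × ℝ →L[ℝ] ℝ × ℝ) (M s : ℝ)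
      (χ : ℝ × ℝ → ℝ × ℝ), IsOpen W → volume W ≤ 1 → ContDiffOn ℝ 1 F W → ContinuousOn G W →
      (∀ w ∈ W, fderiv ℝ F w ∘L G w = ContinuousLinearMap.id ℝ _) →
      W' = {w ∈ W | (F w).1 ∉ A ∧ (F w).2 ∉ B} → IsOpen W' → FrameVariationLE W G M → 0 < s →
      ContDiffOn ℝ 1 χ W' → (∀ w ∈ W', ‖χ w‖ ≤ s) →
      (∃ K, ∀ w ∈ W', ‖fderiv ℝ χ w ∘L G w‖ ≤ K) →
      ∫ w in W', planeTrace (fderiv ℝ χ w ∘L G w) ≤ 2 * s * M + s * C := by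
  obtain ⟨ζ₁, C₁, η₁, hC₁, hζ₁, hζ₁', hζ₁C, hη₁, hη₁', hη₁A, hη₁ζ, hη₁K, hη₁l⟩ := exists_cutoffs A
  obtain ⟨ζ₂, C₂, η₂, hC₂, hζ₂, hζ₂', hζ₂C, hη₂, hη₂', hη₂A, hη₂ζ, hη₂K, hη₂l⟩ := exists_cutoffs B
  refine ⟨C₁ + C₂, add_nonneg hC₁ hC₂, ?_⟩
  intro W W' F G M s χ hW hWv hF hG hFG hW' hW'o hM hs hχ hχs ⟨K, hK⟩
  have hsub : W' ⊆ W := by rw [hW']; exact sep_subset _ _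
  have hA : ∀ w ∈ W', (F w).1 ∉ A := fun w hw => by rw [hW'] at hw; exact hw.2.1
  have hB : ∀ w ∈ W', (F w).2 ∉ B := fun w hw => by rw [hW'] at hw; exact hw.2.2
  set H : ℕ → ℝ × ℝ → ℝ := fun n w => η₁ n (F w).1 * η₂ n (F w).2 with hH
  have hH01 : ∀ n w, H n w ∈ Icc (0 : ℝ) 1 := fun n w =>
    ⟨mul_nonneg (hη₁' n _).1 (hη₂' n _).1, mul_le_one₀ (hη₁' n _).2 (hη₂' n _).1 (hη₂' n _).2⟩
  set Z : ℝ × ℝ → ℝ × ℝ := fun w => (ζ₁ (F w).1, ζ₂ (F w).2) with hZ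
  classical
  -- The cutoff `H n` lets the field extend by zero across the cuts. The added `s • Z` doubles the
  -- sup norm, which is the price of the cut, but gives the terms containing derivatives of the
  -- cutoffs a nonnegative sign.
  set ψ : ℕ → ℝ × ℝ → ℝ × ℝ := fun n w => if w ∈ W' then H n w • (χ w + s • Z w) else 0 with hψ
  have hFd : ∀ w ∈ W, HasFDerivAt F (fderiv ℝ F w) w := fun w hw =>
    ((hF.differentiableOn one_ne_zero).differentiableAt (hW.mem_nhds hw)).hasFDerivAt
  have hψe : ∀ n, ∀ w ∈ W', ψ n =ᶠ[𝓝 w] fun w => H n w • (χ w + s • Z w) := fun n w hw => by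
    filter_upwards [hW'o.mem_nhds hw] with w' hw'
    simp [hψ, hw']
  have hψ0 : ∀ n, ∀ w ∈ W \ W', ψ n =ᶠ[𝓝 w] fun _ => 0 := fun n w hw => by
    have hFc : ContinuousAt F w := hF.continuousOn.continuousAt (hW.mem_nhds hw.1)
    have hH0 : ∀ᶠ w' in 𝓝 w, H n w' = 0 := by
      have : (F w).1 ∈ A ∨ (F w).2 ∈ B := by
        by_contra h
        rw [not_or] at h
        exact hw.2 (by rw [hW']; exact ⟨hw.1, h⟩)
      rcases this with h | h
      · filter_upwards [(continuousAt_fst.comp hFc).eventually (hη₁A n _ h)] with w' hw'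
        have : η₁ n (F w').1 = 0 := hw'
        simp [hH, this]
      · filter_upwards [(continuousAt_snd.comp hFc).eventually (hη₂A n _ h)] with w' hw'
        have : η₂ n (F w').2 = 0 := hw'
        simp [hH, this]
    filter_upwards [hH0] with w' hw'
    simp [hψ, hw']
  have hψC : ∀ n, ContDiffOn ℝ 1 (ψ n) W := fun n w hw => by
    by_cases hw' : w ∈ W'
    · have hFw : ContDiffAt ℝ 1 F w := hF.contDiffAt (hW.mem_nhds hw)
      have h1 : ContDiffAt ℝ 1 (H n) w :=
        ((hη₁ n).contDiffAt.comp w hFw.fst).mul ((hη₂ n).contDiffAt.comp w hFw.snd)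
      have h2 : ContDiffAt ℝ 1 Z w :=
        (ContDiffAt.comp w (hζ₁ _ (hA w hw')) hFw.fst).prodMk
          (ContDiffAt.comp w (hζ₂ _ (hB w hw')) hFw.snd)
      have h3 : ContDiffAt ℝ 1 (fun w => H n w • (χ w + s • Z w)) w :=
        h1.smul ((hχ.contDiffAt (hW'o.mem_nhds hw')).add (h2.const_smul s))
      exact (h3.congr_of_eventuallyEq (hψe n w hw')).contDiffWithinAt
    · exact (contDiffAt_const.congr_of_eventuallyEq (hψ0 n w ⟨hw, hw'⟩)).contDiffWithinAt
  have hZ1 : ∀ w, ‖Z w‖ ≤ 1 := fun w => by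
    rw [Prod.norm_def]; exact max_le (hζ₁' _) (hζ₂' _)
  have hχZ : ∀ w ∈ W', ‖χ w + s • Z w‖ ≤ 2 * s := fun w hw => by
    refine (norm_add_le _ _).trans ?_
    rw [norm_smul, Real.norm_of_nonneg hs.le]
    nlinarith [hχs w hw, hZ1 w]
  have hψ1 : ∀ n, ∀ w ∈ W, ‖ψ n w‖ ≤ 2 * s := fun n w _ => by
    by_cases hw' : w ∈ W'
    · simp only [hψ, hw', if_true]
      rw [norm_smul, Real.norm_of_nonneg (hH01 n w).1]
      exact (mul_le_of_le_one_left (norm_nonneg _) (hH01 n w).2).trans (hχZ w hw')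
    · simp only [hψ, hw', if_false, norm_zero]; linarith
  -- the frame derivative of `ψ n`
  have hψd : ∀ n, ∀ w ∈ W', ∀ v, (fderiv ℝ (ψ n) w ∘L G w) v =
      (deriv (η₁ n) (F w).1 * η₂ n (F w).2 * v.1 + η₁ n (F w).1 * deriv (η₂ n) (F w).2 * v.2) •
        (χ w + s • Z w) +
      H n w • ((fderiv ℝ χ w ∘L G w) v +
        s • (deriv ζ₁ (F w).1 * v.1, deriv ζ₂ (F w).2 * v.2)) := fun n w hw v => by
    -- Since `G` inverts the derivative of `F`, functions of `F` are differentiated along the frame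
    -- as functions of the plane coordinates.
    have hFGv : fderiv ℝ F w (G w v) = v := by
      have := congrArg (fun L => L v) (hFG w (hsub hw)); simpa using this
    have hF1 := (hFd w (hsub hw)).fst
    have hF2 := (hFd w (hsub hw)).snd
    have e1 : HasFDerivAt (fun w => η₁ n (F w).1) _ w :=
      (((hη₁ n).differentiable one_ne_zero (F w).1).hasDerivAt).comp_hasFDerivAt w hF1
    have e2 : HasFDerivAt (fun w => η₂ n (F w).2) _ w :=
      (((hη₂ n).differentiable one_ne_zero (F w).2).hasDerivAt).comp_hasFDerivAt w hF2
    have z1 : HasFDerivAt (fun w => ζ₁ (F w).1) _ w :=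
      (((hζ₁ _ (hA w hw)).differentiableAt one_ne_zero).hasDerivAt).comp_hasFDerivAt w hF1
    have z2 : HasFDerivAt (fun w => ζ₂ (F w).2) _ w :=
      (((hζ₂ _ (hB w hw)).differentiableAt one_ne_zero).hasDerivAt).comp_hasFDerivAt w hF2
    have hχd : HasFDerivAt χ (fderiv ℝ χ w) w :=
      ((hχ.differentiableOn one_ne_zero).differentiableAt (hW'o.mem_nhds hw)).hasFDerivAt
    have hHd : HasFDerivAt (H n) _ w := e1.mul e2
    have hd : HasFDerivAt (fun w => H n w • (χ w + s • Z w)) _ w :=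
      hHd.smul (hχd.add ((z1.prodMk z2).const_smul s))
    rw [(hψe n w hw).fderiv_eq, hd.fderiv]
    simp only [ContinuousLinearMap.comp_apply, _root_.add_apply,
      _root_.smul_apply, ContinuousLinearMap.smulRight_apply,
      ContinuousLinearMap.prod_apply, ContinuousLinearMap.coe_fst', ContinuousLinearMap.coe_snd',
      hFGv, smul_eq_mul]
    rw [add_comm]
    congr 2
    ring
  -- This bound may blow up with `n`; it only makes `ψ n` an admissible test field.
  have hψK : ∀ n, ∃ K', ∀ w ∈ W, ‖fderiv ℝ (ψ n) w ∘L G w‖ ≤ K' := fun n => by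
    obtain ⟨K₁, hK₁⟩ := hη₁K n
    obtain ⟨K₂, hK₂⟩ := hη₂K n
    have hK₁0 : 0 ≤ K₁ := (abs_nonneg _).trans (hK₁ 0)
    have hK₂0 : 0 ≤ K₂ := (abs_nonneg _).trans (hK₂ 0)
    refine ⟨(K₁ + K₂) * (2 * s) + (|K| + s * (C₁ + C₂)), fun w hw => ?_⟩
    have hnn : 0 ≤ (K₁ + K₂) * (2 * s) + (|K| + s * (C₁ + C₂)) := by positivity
    by_cases hw' : w ∈ W'
    · refine ContinuousLinearMap.opNorm_le_bound _ hnn fun v => ?_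
      rw [hψd n w hw' v, add_mul]
      have hv1 : |v.1| ≤ ‖v‖ := norm_fst_le v
      have hv2 : |v.2| ≤ ‖v‖ := norm_snd_le v
      refine (norm_add_le _ _).trans (add_le_add ?_ ?_)
      · rw [norm_smul, show (K₁ + K₂) * (2 * s) * ‖v‖ = (K₁ + K₂) * ‖v‖ * (2 * s) by ring]
        refine mul_le_mul ?_ (hχZ w hw') (norm_nonneg _) (by positivity)
        rw [Real.norm_eq_abs, add_mul]
        refine (abs_add_le _ _).trans (add_le_add ?_ ?_)
        · rw [abs_mul, abs_mul, abs_of_nonneg (hη₂' n _).1]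
          refine mul_le_mul ?_ hv1 (abs_nonneg _) hK₁0
          exact (mul_le_of_le_one_right (abs_nonneg _) (hη₂' n _).2).trans (hK₁ _)
        · rw [abs_mul, abs_mul, abs_of_nonneg (hη₁' n _).1]
          refine mul_le_mul ?_ hv2 (abs_nonneg _) hK₂0
          exact (mul_le_of_le_one_left (abs_nonneg _) (hη₁' n _).2).trans (hK₂ _)
      · rw [norm_smul, Real.norm_of_nonneg (hH01 n w).1]
        refine (mul_le_of_le_one_left (norm_nonneg _) (hH01 n w).2).trans ?_
        rw [add_mul]
        refine (norm_add_le _ _).trans (add_le_add ?_ ?_)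
        · exact (ContinuousLinearMap.le_opNorm _ _).trans
            (mul_le_mul_of_nonneg_right ((hK w hw').trans (le_abs_self K)) (norm_nonneg _))
        · rw [norm_smul, Real.norm_of_nonneg hs.le, mul_assoc]
          refine mul_le_mul_of_nonneg_left ?_ hs.le
          rw [Prod.norm_def, add_mul]
          have h1 : |deriv ζ₁ (F w).1 * v.1| ≤ C₁ * ‖v‖ := by
            rw [abs_mul]; exact mul_le_mul (hζ₁C _ (hA w hw')) hv1 (abs_nonneg _) hC₁
          have h2 : |deriv ζ₂ (F w).2 * v.2| ≤ C₂ * ‖v‖ := by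
            rw [abs_mul]; exact mul_le_mul (hζ₂C _ (hB w hw')) hv2 (abs_nonneg _) hC₂
          have h3 : 0 ≤ C₁ * ‖v‖ := by positivity
          have h4 : 0 ≤ C₂ * ‖v‖ := by positivity
          exact max_le (h1.trans (by linarith)) (h2.trans (by linarith))
    · rw [(hψ0 n w ⟨hw, hw'⟩).fderiv_eq]
      simpa using hnn
  have hψM : ∀ n, ∫ w in W, planeTrace (fderiv ℝ (ψ n) w ∘L G w) ≤ 2 * s * M := fun n =>
    hM.of_norm_le (by linarith) (hψC n) (hψ1 n) (hψK n)
  have hψW' : ∀ n, ∫ w in W, planeTrace (fderiv ℝ (ψ n) w ∘L G w) =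
      ∫ w in W', planeTrace (fderiv ℝ (ψ n) w ∘L G w) := fun n => by
    refine setIntegral_eq_of_subset_of_forall_sdiff_eq_zero hW.measurableSet hsub fun w hw => ?_
    rw [(hψ0 n w hw).fderiv_eq]
    simp [planeTrace]
  have hW'v : volume W' ≤ 1 := (measure_mono hsub).trans hWv
  have hW'f : volume W' ≠ ⊤ := (hW'v.trans_lt ENNReal.one_lt_top).ne
  have : IsFiniteMeasure (volume.restrict W') := ⟨by simpa using hW'f.lt_top⟩
  -- pointwise comparison
  have hpt : ∀ n, ∀ w ∈ W', planeTrace (fderiv ℝ χ w ∘L G w) ≤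
      planeTrace (fderiv ℝ (ψ n) w ∘L G w) + (s * (C₁ + C₂) + 2 * K * (1 - H n w)) := by
    intro n w hw
    have hK2 := (abs_planeTrace_le (fderiv ℝ χ w ∘L G w)).trans
      (mul_le_mul_of_nonneg_left (hK w hw) two_pos.le)
    have e : planeTrace (fderiv ℝ (ψ n) w ∘L G w) =
        η₂ n (F w).2 * (deriv (η₁ n) (F w).1 * ((χ w).1 + s * ζ₁ (F w).1)) +
        η₁ n (F w).1 * (deriv (η₂ n) (F w).2 * ((χ w).2 + s * ζ₂ (F w).2)) +
        H n w * (planeTrace (fderiv ℝ χ w ∘L G w) + s * (deriv ζ₁ (F w).1 + deriv ζ₂ (F w).2)) := by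
      conv_lhs => rw [planeTrace]
      rw [hψd n w hw, hψd n w hw, planeTrace]
      simp only [hZ, Prod.fst_add, Prod.snd_add, Prod.smul_fst, Prod.smul_snd, smul_eq_mul]
      ring
    -- Here `d` is the derivative of a cutoff, `c` a component of `χ` and `z` the value of `ζ`: `s *
    -- (d * z)` is at least `s * |d|`, which absorbs `d * c`.
    have aux : ∀ d c z : ℝ, |d| ≤ d * z → |c| ≤ s → 0 ≤ d * (c + s * z) := fun d c z hd hc => by
      have h1 : -(|d| * s) ≤ d * c := by
        have : |d * c| ≤ |d| * s := by
          rw [abs_mul]; exact mul_le_mul_of_nonneg_left hc (abs_nonneg _)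
        exact (abs_le.1 this).1
      nlinarith
    have hc1 : |(χ w).1| ≤ s := (norm_fst_le _).trans (hχs w hw)
    have hc2 : |(χ w).2| ≤ s := (norm_snd_le _).trans (hχs w hw)
    have h1 := mul_nonneg (hη₂' n (F w).2).1 (aux _ _ _ (hη₁ζ n _ (hA w hw)) hc1)
    have h2 := mul_nonneg (hη₁' n (F w).1).1 (aux _ _ _ (hη₂ζ n _ (hB w hw)) hc2)
    have h3 : -(s * (C₁ + C₂)) ≤ H n w * (s * (deriv ζ₁ (F w).1 + deriv ζ₂ (F w).2)) := by
      have h4 : |H n w * (s * (deriv ζ₁ (F w).1 + deriv ζ₂ (F w).2))| ≤ s * (C₁ + C₂) := by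
        rw [abs_mul, abs_of_nonneg (hH01 n w).1, abs_mul, abs_of_pos hs]
        refine (mul_le_of_le_one_left (by positivity) (hH01 n w).2).trans ?_
        exact mul_le_mul_of_nonneg_left ((abs_add_le _ _).trans
          (add_le_add (hζ₁C _ (hA w hw)) (hζ₂C _ (hB w hw)))) hs.le
      exact (abs_le.1 h4).1
    have h5 : planeTrace (fderiv ℝ χ w ∘L G w) * (1 - H n w) ≤ 2 * K * (1 - H n w) :=
      mul_le_mul_of_nonneg_right ((le_abs_self _).trans hK2) (by linarith [(hH01 n w).2])
    rw [e]
    linarith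
  have hHc : ∀ n, ContinuousOn (H n) W' := fun n =>
    ((hη₁ n).continuous.comp_continuousOn (hF.continuousOn.mono hsub).fst).mul
      ((hη₂ n).continuous.comp_continuousOn (hF.continuousOn.mono hsub).snd)
  have hHi : ∀ n, IntegrableOn (fun w => 1 - H n w) W' volume := fun n =>
    Integrable.of_bound (C := 1)
      ((continuousOn_const.sub (hHc n)).aestronglyMeasurable hW'o.measurableSet)
      (ae_of_all _ fun w => by
        rw [Real.norm_eq_abs, abs_le]; constructor <;> linarith [(hH01 n w).1, (hH01 n w).2])
  have hbound : ∀ n, ∫ w in W', planeTrace (fderiv ℝ χ w ∘L G w) ≤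
      2 * s * M + s * (C₁ + C₂) + 2 * K * ∫ w in W', (1 - H n w) := fun n => by
    obtain ⟨K', hK'⟩ := hψK n
    have i1 : IntegrableOn (fun w => planeTrace (fderiv ℝ χ w ∘L G w)) W' volume :=
      integrableOn_planeTrace hW'o hW'v (continuousOn_fderiv_comp hW'o (hG.mono hsub) hχ) hK
    have i2 : IntegrableOn (fun w => planeTrace (fderiv ℝ (ψ n) w ∘L G w)) W' volume :=
      integrableOn_planeTrace hW'o hW'v
        (continuousOn_fderiv_comp hW'o (hG.mono hsub) ((hψC n).mono hsub))
        fun w hw => hK' w (hsub hw)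
    have i3 : IntegrableOn (fun _ => s * (C₁ + C₂)) W' (volume : Measure (ℝ × ℝ)) :=
      integrable_const _
    have i4 : IntegrableOn (fun w => 2 * K * (1 - H n w)) W' volume := (hHi n).const_mul _
    have h1 := setIntegral_mono_on i1 (i2.add (i3.add i4)) hW'o.measurableSet (hpt n)
    refine h1.trans ?_
    have h2 : ∫ w in W', (planeTrace (fderiv ℝ (ψ n) w ∘L G w) +
        (s * (C₁ + C₂) + 2 * K * (1 - H n w))) = (∫ w in W', planeTrace (fderiv ℝ (ψ n) w ∘L G w)) +
        ((∫ _ in W', s * (C₁ + C₂)) + 2 * K * ∫ w in W', (1 - H n w)) := by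
      refine (integral_add i2 (i3.add i4)).trans ?_
      congr 1
      refine (integral_add i3 i4).trans ?_
      congr 1
      exact integral_const_mul _ _
    refine h2.le.trans ?_
    rw [← hψW' n]
    have h3 : ∫ _ in W', s * (C₁ + C₂) ∂(volume : Measure (ℝ × ℝ)) ≤ s * (C₁ + C₂) := by
      rw [setIntegral_const, smul_eq_mul]
      refine mul_le_of_le_one_left (by positivity) ?_
      exact ENNReal.toReal_le_of_le_ofReal zero_le_one (by simpa using hW'v)
    linarith [hψM n]
  -- The non-uniform constant `K` multiplies only this integral, so it disappears in the limit.
  have hlim : Tendsto (fun n => ∫ w in W', (1 - H n w)) atTop (𝓝 0) := by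
    have : Tendsto (fun n => ∫ w in W', (1 - H n w)) atTop (𝓝 (∫ w in W', (0 : ℝ))) := by
      refine tendsto_integral_of_dominated_convergence (fun _ => 1)
        (fun n => (hHi n).aestronglyMeasurable) (integrable_const _)
        (fun n => ae_of_all _ fun w => ?_) ?_
      · rw [Real.norm_eq_abs, abs_le]; constructor <;> linarith [(hH01 n w).1, (hH01 n w).2]
      · filter_upwards [ae_restrict_mem hW'o.measurableSet] with w hw
        have := tendsto_const_nhds (x := (1 : ℝ)).sub
          ((hη₁l _ (hA w hw)).mul (hη₂l _ (hB w hw)))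
        simpa using this
    simpa using this
  have hlim' : Tendsto (fun n => 2 * s * M + s * (C₁ + C₂) + 2 * K * ∫ w in W', (1 - H n w)) atTop
      (𝓝 (2 * s * M + s * (C₁ + C₂))) := by
    simpa using (hlim.const_mul (2 * K)).const_add (2 * s * M + s * (C₁ + C₂))
  exact ge_of_tendsto' hlim' hbound

/-- One Lasota-Yorke step: the frame is composed with `L`, whose norm is at most `1 / l`, after
cutting along the preimages of finitely many vertical and horizontal lines. -/
theorem exists_frameVariation_step (A B : Finset ℝ) : ∃ C : ℝ, 0 ≤ C ∧
    ∀ (W W' : Set (ℝ × ℝ)) (F : ℝ × ℝ → ℝ × ℝ) (G L : ℝ × ℝ → ℝ × ℝ →L[ℝ] ℝ × ℝ) (M l β : ℝ),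
      IsOpen W → volume W ≤ 1 → ContDiffOn ℝ 1 F W → ContinuousOn G W →
      (∀ w ∈ W, fderiv ℝ F w ∘L G w = ContinuousLinearMap.id ℝ _) →
      W' = {w ∈ W | (F w).1 ∉ A ∧ (F w).2 ∉ B} → IsOpen W' → FrameVariationLE W G M → 0 < l →
      0 ≤ β → ContDiffOn ℝ 1 L W' → (∀ w ∈ W', ‖L w‖ ≤ 1 / l) →
      (∀ w ∈ W', ∀ v, ‖fderiv ℝ L w (G w v)‖ ≤ β * ‖v‖) →
      (∃ K, ∀ w ∈ W', ∃ X, ‖X‖ ≤ K ∧ L w ∘L X = ContinuousLinearMap.id ℝ _) →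
      FrameVariationLE W' (fun w => G w ∘L L w) (2 / l * M + (1 / l * C + 2 * β)) := by
  obtain ⟨C, hC, hcut⟩ := exists_cut_bound A B
  refine ⟨C, hC, ?_⟩
  intro W W' F G L M l β hW hWv hF hG hFG hW' hW'o hM hl hβ hL hLl hLβ ⟨K, hK⟩ Φ hΦ hΦ1 ⟨K₁, hK₁⟩
  have hsub : W' ⊆ W := by rw [hW']; exact sep_subset _ _
  have hW'v : volume W' ≤ 1 := (measure_mono hsub).trans hWv
  -- The contraction is applied to the field instead of the frame: `χ` has norm at most `1 / l`, and
  -- this is the gain in the inequality.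
  set χ : ℝ × ℝ → ℝ × ℝ := fun w => L w (Φ w) with hχ
  have hχC : ContDiffOn ℝ 1 χ W' := hL.clm_apply hΦ
  have hχd : ∀ w ∈ W', ∀ v, (fderiv ℝ χ w ∘L G w) v =
      L w ((fderiv ℝ Φ w ∘L G w) v) + fderiv ℝ L w (G w v) (Φ w) := fun w hw v => by
    have h1 : HasFDerivAt L (fderiv ℝ L w) w :=
      ((hL.differentiableOn one_ne_zero).differentiableAt (hW'o.mem_nhds hw)).hasFDerivAt
    have h2 : HasFDerivAt Φ (fderiv ℝ Φ w) w :=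
      ((hΦ.differentiableOn one_ne_zero).differentiableAt (hW'o.mem_nhds hw)).hasFDerivAt
    rw [(h1.clm_apply h2).fderiv]
    simp
  -- The test field is controlled only along the contracted frame `G ∘L L`; the bounded right
  -- inverse `X` of `L` recovers a bound along `G`.
  have hΦG : ∀ w ∈ W', ∃ X, ‖X‖ ≤ K ∧ fderiv ℝ Φ w ∘L G w =
      (fderiv ℝ Φ w ∘L (G w ∘L L w)) ∘L X := fun w hw => by
    obtain ⟨X, hX, hLX⟩ := hK w hw
    refine ⟨X, hX, ?_⟩
    rw [ContinuousLinearMap.comp_assoc, ContinuousLinearMap.comp_assoc, hLX,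
      ContinuousLinearMap.comp_id]
  have hΦK : ∀ w ∈ W', ‖fderiv ℝ Φ w ∘L G w‖ ≤ |K₁| * |K| := fun w hw => by
    obtain ⟨X, hX, e⟩ := hΦG w hw
    rw [e]
    exact (ContinuousLinearMap.opNorm_comp_le _ _).trans
      (mul_le_mul ((hK₁ w hw).trans (le_abs_self _)) (hX.trans (le_abs_self _)) (norm_nonneg _)
        (abs_nonneg _))
  have hl' : 0 < 1 / l := by positivity
  have hβΦ : ∀ w ∈ W', ∀ v, ‖fderiv ℝ L w (G w v) (Φ w)‖ ≤ β * ‖v‖ := fun w hw v =>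
    (ContinuousLinearMap.le_opNorm _ _).trans ((mul_le_of_le_one_right (norm_nonneg _)
      (hΦ1 w hw)).trans (hLβ w hw v))
  have hχK : ∀ w ∈ W', ‖fderiv ℝ χ w ∘L G w‖ ≤ 1 / l * (|K₁| * |K|) + β := fun w hw => by
    refine ContinuousLinearMap.opNorm_le_bound _ (by positivity) fun v => ?_
    rw [hχd w hw v, add_mul]
    refine (norm_add_le _ _).trans (add_le_add ?_ (hβΦ w hw v))
    rw [mul_assoc]
    refine (ContinuousLinearMap.le_opNorm _ _).trans (mul_le_mul (hLl w hw) ?_ (norm_nonneg _) hl'.le)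
    exact (ContinuousLinearMap.le_opNorm _ _).trans
      (mul_le_mul_of_nonneg_right (hΦK w hw) (norm_nonneg _))
  have hmain := hcut W W' F G M (1 / l) χ hW hWv hF hG hFG hW' hW'o hM hl' hχC (fun w hw => by
    refine (ContinuousLinearMap.le_opNorm _ _).trans ?_
    exact (mul_le_of_le_one_right (norm_nonneg _) (hΦ1 w hw)).trans (hLl w hw)) ⟨_, hχK⟩
  have hpt : ∀ w ∈ W', planeTrace (fderiv ℝ Φ w ∘L (G w ∘L L w)) ≤
      planeTrace (fderiv ℝ χ w ∘L G w) + 2 * β := fun w hw => by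
    have e : fderiv ℝ χ w ∘L G w = L w ∘L (fderiv ℝ Φ w ∘L G w) +
        (fderiv ℝ χ w ∘L G w - L w ∘L (fderiv ℝ Φ w ∘L G w)) := by abel
    have h1 : |planeTrace (fderiv ℝ χ w ∘L G w - L w ∘L (fderiv ℝ Φ w ∘L G w))| ≤ 2 * β := by
      refine abs_planeTrace_le_of_apply fun v => ?_
      rw [_root_.sub_apply, hχd w hw v, ContinuousLinearMap.comp_apply (L w), add_sub_cancel_left]
      exact hβΦ w hw v
    rw [e, planeTrace_add, planeTrace_comp_comm (L w), ContinuousLinearMap.comp_assoc]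
    linarith [(abs_le.1 h1).1]
  have hGL : ContinuousOn (fun w => G w ∘L L w) W' := (hG.mono hsub).clm_comp hL.continuousOn
  have i1 := integrableOn_planeTrace hW'o hW'v (continuousOn_fderiv_comp hW'o hGL hΦ) hK₁
  have i2 := integrableOn_planeTrace hW'o hW'v
    (continuousOn_fderiv_comp hW'o (hG.mono hsub) hχC) hχK
  have i3 : IntegrableOn (fun _ => 2 * β) W' (volume : Measure (ℝ × ℝ)) :=
    integrableOn_const (hW'v.trans_lt ENNReal.one_lt_top).ne
  have h1 := (setIntegral_mono_on i1 (i2.add i3) hW'o.measurableSet hpt).trans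
    (integral_add i2 i3).le
  have h3 : ∫ _ in W', 2 * β ∂(volume : Measure (ℝ × ℝ)) ≤ 2 * β := by
    rw [setIntegral_const, smul_eq_mul]
    refine mul_le_of_le_one_left (by positivity) ?_
    exact ENNReal.toReal_le_of_le_ofReal zero_le_one (by simpa using hW'v)
  have h4 : 2 * (1 / l) * M = 2 / l * M := by ring
  rw [h4] at hmain
  linarith

/-! ### Moving graphs -/

/-- The projection to the `xy`-plane as a continuous linear map. -/
def projXYL : Space3 →L[ℝ] ℝ × ℝ :=
  (ContinuousLinearMap.proj 0).prod (ContinuousLinearMap.proj 1)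

/-- The linear map sending a slope `p` to the vertical displacement it produces. -/
def verticalL : (ℝ × ℝ →L[ℝ] ℝ) →L[ℝ] (ℝ × ℝ →L[ℝ] Space3) :=
  (ContinuousLinearMap.smulRightL ℝ (ℝ × ℝ) Space3).flip (Pi.single 2 1)

/-- The horizontal lift of the plane to the tangent plane with slope `p`. -/
def slopeLift (p : ℝ × ℝ →L[ℝ] ℝ) : ℝ × ℝ →L[ℝ] Space3 :=
  (ContinuousLinearMap.fst ℝ ℝ ℝ).smulRight (Pi.single 0 1) +
    (ContinuousLinearMap.snd ℝ ℝ ℝ).smulRight (Pi.single 1 1) + verticalL p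

theorem projXYL_apply (x : Space3) : projXYL x = (x 0, x 1) := rfl

theorem verticalL_apply (p : ℝ × ℝ →L[ℝ] ℝ) (v : ℝ × ℝ) :
    verticalL p v = p v • (Pi.single 2 1 : Space3) := rfl

theorem slopeLift_apply (p : ℝ × ℝ →L[ℝ] ℝ) (v : ℝ × ℝ) : slopeLift p v = ![v.1, v.2, p v] := by
  ext i
  fin_cases i <;> simp [slopeLift, verticalL_apply]

theorem norm_projXYL_le (x : Space3) : ‖projXYL x‖ ≤ ‖x‖ := by
  rw [projXYL_apply, Prod.norm_def]
  exact max_le (norm_le_pi_norm x 0) (norm_le_pi_norm x 1)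

theorem norm_slopeLift_le {p : ℝ × ℝ →L[ℝ] ℝ} {s : ℝ} (hs : 1 ≤ s) (hp : ‖p‖ ≤ s) (v : ℝ × ℝ) :
    ‖slopeLift p v‖ ≤ s * ‖v‖ := by
  rw [slopeLift_apply, pi_norm_le_iff_of_nonneg (by positivity)]
  intro i
  have h1 : ‖v‖ ≤ s * ‖v‖ := le_mul_of_one_le_left (norm_nonneg _) hs
  fin_cases i
  · exact (norm_fst_le v).trans h1
  · exact (norm_snd_le v).trans h1
  · exact (p.le_opNorm v).trans (mul_le_mul_of_nonneg_right hp (norm_nonneg _))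

theorem contDiff_slopeLift : ContDiff ℝ 1 slopeLift := by
  unfold slopeLift
  exact contDiff_const.add verticalL.contDiff

theorem space3_apply_eq (X : Space3 →L[ℝ] Space3) (x : Space3) (i : Fin 3) :
    X x i = x 0 * X (Pi.single 0 1) i + x 1 * X (Pi.single 1 1) i + x 2 * X (Pi.single 2 1) i := by
  have h : x = x 0 • (Pi.single 0 1 : Space3) + x 1 • (Pi.single 1 1 : Space3) +
      x 2 • (Pi.single 2 1 : Space3) := by
    ext j; fin_cases j <;> simp
  conv_lhs => rw [h]
  simp only [map_add, map_smul, Pi.add_apply, Pi.smul_apply, smul_eq_mul]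

/-- A surface moved by the dynamics, parametrized by `u` on the open set `W` of the plane: `G` is
the inverse of the derivative of its projection to the `xy`-plane, `p` its slope, at most `s`, `Q`
bounds its second derivatives and `M` the variation of its projected density. -/
structure IsMovingGraph (u : ℝ × ℝ → Space3) (W : Set (ℝ × ℝ)) (G : ℝ × ℝ → ℝ × ℝ →L[ℝ] ℝ × ℝ)
    (p : ℝ × ℝ → ℝ × ℝ →L[ℝ] ℝ) (s Q M : ℝ) : Prop where
  isOpen : IsOpen W
  volume_le : volume W ≤ 1
  mapsTo : MapsTo u W cubeR
  contDiffOn : ContDiffOn ℝ 1 u W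
  continuousOn_frame : ContinuousOn G W
  tangent : ∀ w ∈ W, fderiv ℝ u w ∘L G w = slopeLift (p w)
  frame_comp : ∀ w ∈ W, G w ∘L (projXYL ∘L fderiv ℝ u w) = ContinuousLinearMap.id ℝ _
  contDiffOn_slope : ContDiffOn ℝ 1 p W
  slope_le : ∀ w ∈ W, ‖p w‖ ≤ s
  fderiv_slope_le : ∀ w ∈ W, ∀ v, ‖fderiv ℝ p w (G w v)‖ ≤ Q * ‖v‖
  variation : FrameVariationLE W G M

/-! ### Regularity of the map off the singular set -/

theorem isClosed_cutSet (A B : Finset ℝ) : IsClosed {p : Space3 | p 0 ∈ A ∨ p 1 ∈ B} := by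
  have h1 : IsClosed {p : Space3 | p 0 ∈ A} :=
    A.finite_toSet.isClosed.preimage (continuous_apply 0)
  have h2 : IsClosed {p : Space3 | p 1 ∈ B} :=
    B.finite_toSet.isClosed.preimage (continuous_apply 1)
  exact h1.union h2

theorem regularSet_eq (A B : Finset ℝ) :
    regularSet A B = cubeR ∩ {p : Space3 | p 0 ∈ A ∨ p 1 ∈ B}ᶜ := by
  ext p
  simp only [regularSet, singularSet, Set.mem_sdiff, mem_ofPred_eq, mem_inter_iff, mem_compl_iff]
  tauto

theorem cubeR_eq : cubeR = Set.pi univ fun _ : Fin 3 => Icc (0 : ℝ) 1 := by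
  ext p
  simp only [cubeR, mem_ofPred_eq, Set.mem_pi, mem_univ, forall_const]

/-- The set is relatively open in the cube, so one-sided derivatives on the faces are well
determined and the rules of calculus apply to `fderivWithin`. -/
theorem uniqueDiffOn_regularSet (A B : Finset ℝ) : UniqueDiffOn ℝ (regularSet A B) := by
  rw [regularSet_eq]
  refine UniqueDiffOn.inter ?_ (isClosed_cutSet A B).isOpen_compl
  rw [cubeR_eq]
  exact UniqueDiffOn.univ_pi fun _ => uniqueDiffOn_Icc zero_lt_one

theorem SmoothBounded.exists_bounds {A B : Finset ℝ} {f : Space3 → Space3}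
    (hf : SmoothBounded A B f) : ∃ C : ℝ, 0 ≤ C ∧
      ContDiffOn ℝ 1 (fderivWithin ℝ f (regularSet A B)) (regularSet A B) ∧
      ∀ q ∈ regularSet A B, ‖fderivWithin ℝ f (regularSet A B) q‖ ≤ C ∧
        ‖fderivWithin ℝ (fderivWithin ℝ f (regularSet A B)) (regularSet A B) q‖ ≤ C := by
  obtain ⟨hf2, C, hC⟩ := hf
  have hu := uniqueDiffOn_regularSet A B
  refine ⟨|C|, abs_nonneg _, hf2.fderivWithin hu (by norm_num), fun q hq => ⟨?_, ?_⟩⟩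
  · have := (hC q hq).1
    rw [norm_iteratedFDerivWithin_one _ (hu q hq)] at this
    exact this.trans (le_abs_self _)
  · have := (hC q hq).2
    rw [← norm_iteratedFDerivWithin_fderivWithin hu hq, norm_iteratedFDerivWithin_one _ (hu q hq)]
      at this
    exact this.trans (le_abs_self _)

/-! ### Inverting families of expanding linear maps -/

theorem isUnit_of_expanding {X : ℝ × ℝ →L[ℝ] ℝ × ℝ} {l : ℝ} (hl : 0 < l)
    (hX : ∀ v, l * ‖v‖ ≤ ‖X v‖) : IsUnit X := by
  have hinj : Function.Injective X.toLinearMap := by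
    rw [← LinearMap.ker_eq_bot, LinearMap.ker_eq_bot']
    intro v hv
    have h1 := hX v
    have h2 : X v = 0 := hv
    rw [h2, norm_zero] at h1
    exact norm_eq_zero.1 (le_antisymm (by nlinarith [norm_nonneg v]) (norm_nonneg _))
  set e := (LinearEquiv.ofInjectiveEndo X.toLinearMap hinj).toContinuousLinearEquiv with he
  have h1 : (e : ℝ × ℝ →L[ℝ] ℝ × ℝ) = X := by ext <;> rfl
  rw [← h1]
  exact ⟨ContinuousLinearEquiv.toUnit e, rfl⟩

theorem ringInverse_of_expanding {X : ℝ × ℝ →L[ℝ] ℝ × ℝ} {l : ℝ} (hl : 0 < l)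
    (hX : ∀ v, l * ‖v‖ ≤ ‖X v‖) :
    X ∘L Ring.inverse X = ContinuousLinearMap.id ℝ _ ∧
      Ring.inverse X ∘L X = ContinuousLinearMap.id ℝ _ ∧ ‖Ring.inverse X‖ ≤ 1 / l := by
  have hu := isUnit_of_expanding hl hX
  have h1 : X ∘L Ring.inverse X = ContinuousLinearMap.id ℝ _ := Ring.mul_inverse_cancel X hu
  refine ⟨h1, Ring.inverse_mul_cancel X hu, ?_⟩
  refine ContinuousLinearMap.opNorm_le_bound _ (by positivity) fun v => ?_
  have h2 := hX (Ring.inverse X v)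
  have h3 : X (Ring.inverse X v) = v := congrArg (fun L => L v) h1
  rw [h3] at h2
  rw [one_div, inv_mul_eq_div, le_div_iff₀ hl, mul_comm]
  exact h2

/-- This is the rule `(X⁻¹)' = -X⁻¹ X' X⁻¹`; the two inverse factors produce the `l ^ 2` in the
curvature estimates. -/
theorem hasFDerivAt_ringInverse_comp {X : ℝ × ℝ → ℝ × ℝ →L[ℝ] ℝ × ℝ} {w : ℝ × ℝ}
    {X' : ℝ × ℝ →L[ℝ] ℝ × ℝ →L[ℝ] ℝ × ℝ} (hu : IsUnit (X w)) (hX : HasFDerivAt X X' w) :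
    ∃ Y' : ℝ × ℝ →L[ℝ] ℝ × ℝ →L[ℝ] ℝ × ℝ, HasFDerivAt (fun w => Ring.inverse (X w)) Y' w ∧
      ∀ d, Y' d = -(Ring.inverse (X w) ∘L X' d ∘L Ring.inverse (X w)) := by
  obtain ⟨U, hU⟩ := hu
  have h1 := hasFDerivAt_ringInverse (𝕜 := ℝ) U
  rw [hU] at h1
  refine ⟨_, h1.comp w hX, fun d => ?_⟩
  rw [← hU, Ring.inverse_unit]
  rfl

/-! ### One step of the dynamics on moving graphs -/

theorem projXYL_comp_slopeLift (p : ℝ × ℝ →L[ℝ] ℝ) :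
    projXYL ∘L slopeLift p = ContinuousLinearMap.id ℝ _ := by
  refine ContinuousLinearMap.ext fun v => ?_
  simp only [ContinuousLinearMap.comp_apply, slopeLift_apply, projXYL_apply]
  rfl

/-- The worst case leaves the factor `|a| - |b| - s * |c|`. For `s ≤ 1` it is at least `lam`; for `s
≥ 1` it loses at most `(s - 1) * lam / 8`, leaving `lam * (9 - s) / 8`. -/
theorem abs_combination_ge {a b c x y z lam l s : ℝ} (h : lam ≤ |a| - |b| - |c|)
    (hc : |c| ≤ lam / 8) (hl1 : l ≤ lam) (hl2 : l ≤ lam * (9 - s) / 8)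
    (hyx : |y| ≤ |x|) (hz : |z| ≤ s * |x|) : l * |x| ≤ |x * a + y * b + z * c| := by
  have h1 : |x * a| ≤ |x * a + y * b + z * c| + |y * b| + |z * c| := by
    have e : x * a = (x * a + y * b + z * c) - y * b - z * c := by ring
    conv_lhs => rw [e]
    exact (abs_sub _ _).trans (add_le_add_left (abs_sub _ _) _)
  rw [abs_mul, abs_mul y b, abs_mul z c] at h1
  have h2 : |y| * |b| ≤ |x| * |b| := mul_le_mul_of_nonneg_right hyx (abs_nonneg _)
  have h3 : |z| * |c| ≤ s * |x| * |c| := mul_le_mul_of_nonneg_right hz (abs_nonneg _)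
  have h4 : l ≤ |a| - |b| - s * |c| := by
    rcases le_total s 1 with hs | hs
    · nlinarith [abs_nonneg c]
    · nlinarith [abs_nonneg c]
  nlinarith [abs_nonneg x]

section Expansion

variable {X : Space3 →L[ℝ] Space3} {p : ℝ × ℝ →L[ℝ] ℝ} {lam l s : ℝ}

/-- In the sup norm it is enough to look at the larger coordinate of `v`: the corresponding row of
the derivative is dominated by its diagonal entry. -/
theorem expanding_of_dominated
    (h0 : lam ≤ |X (Pi.single 0 1) 0| - |X (Pi.single 1 1) 0| - |X (Pi.single 2 1) 0|)
    (h1 : lam ≤ |X (Pi.single 1 1) 1| - |X (Pi.single 0 1) 1| - |X (Pi.single 2 1) 1|)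
    (hc : ∀ i, |X (Pi.single 2 1) i| ≤ lam / 8) (hl1 : l ≤ lam)
    (hl2 : l ≤ lam * (9 - s) / 8) (hp : ‖p‖ ≤ s) (v : ℝ × ℝ) :
    l * ‖v‖ ≤ ‖(projXYL ∘L X ∘L slopeLift p) v‖ := by
  have hpv : |p v| ≤ s * ‖v‖ :=
    (p.le_opNorm v).trans (mul_le_mul_of_nonneg_right hp (norm_nonneg _))
  have e : ∀ i, X (slopeLift p v) i = v.1 * X (Pi.single 0 1) i + v.2 * X (Pi.single 1 1) i +
      p v * X (Pi.single 2 1) i := fun i => by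
    rw [space3_apply_eq, slopeLift_apply]; rfl
  simp only [ContinuousLinearMap.comp_apply, projXYL_apply]
  rcases le_total |v.2| |v.1| with hv | hv
  · have hn : ‖v‖ = |v.1| := by rw [Prod.norm_def]; exact max_eq_left hv
    rw [hn] at hpv ⊢
    refine le_trans ?_ (norm_fst_le _)
    simp only [e]
    exact abs_combination_ge h0 (hc 0) hl1 hl2 hv hpv
  · have hn : ‖v‖ = |v.2| := by rw [Prod.norm_def]; exact max_eq_right hv
    rw [hn] at hpv ⊢
    refine le_trans ?_ (norm_snd_le _)
    simp only [e]
    rw [add_comm (v.1 * _)]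
    exact abs_combination_ge h1 (hc 1) hl1 hl2 hv hpv

/-- Each of the three terms carries a factor `lam / 8`. Divided by the horizontal expansion `l`,
this estimate gives the slope of the image surface. -/
theorem abs_vertical_le (h : ∀ j, |X (Pi.single j 1) 2| ≤ lam / 8) (hp : ‖p‖ ≤ s) (v : ℝ × ℝ) :
    |X (slopeLift p v) 2| ≤ lam / 8 * (2 + s) * ‖v‖ := by
  have hlam : 0 ≤ lam / 8 := (abs_nonneg _).trans (h 0)
  have hpv : |p v| ≤ s * ‖v‖ :=
    (p.le_opNorm v).trans (mul_le_mul_of_nonneg_right hp (norm_nonneg _))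
  have h1 : |v.1| ≤ ‖v‖ := norm_fst_le v
  have h2 : |v.2| ≤ ‖v‖ := norm_snd_le v
  rw [space3_apply_eq, slopeLift_apply]
  have e0 : (![v.1, v.2, p v] : Space3) 0 = v.1 := rfl
  have e1 : (![v.1, v.2, p v] : Space3) 1 = v.2 := rfl
  have e2 : (![v.1, v.2, p v] : Space3) 2 = p v := rfl
  rw [e0, e1, e2]
  refine (abs_add_three _ _ _).trans ?_
  rw [abs_mul, abs_mul, abs_mul]
  have i0 := mul_le_mul h1 (h 0) (abs_nonneg _) (norm_nonneg v)
  have i1 := mul_le_mul h2 (h 1) (abs_nonneg _) (norm_nonneg v)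
  have i2 := mul_le_mul hpv (h 2) (abs_nonneg _) ((abs_nonneg _).trans hpv)
  linarith

end Expansion

/-- The surface flattens because horizontal expansion `l` beats the vertical derivative, which is at
most `l / 2` along it. The old second derivative `Q` enters the new one only through the small
column `∂f/∂z` and is divided by `l ^ 2`; the rest comes from the second derivatives of `f`. -/
theorem IsMovingGraph.exists_step {A B : Finset ℝ} {f : Space3 → Space3} {lam : ℝ}
    (hfR : MapsTo f cubeR cubeR) (hf0 : SmoothBounded A B f) (hf1 : DominatedExpansion A B f lam)
    (hf2 : SmallCoupling A B f lam) (hlam : 0 < lam) :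
    ∃ K C : ℝ, 0 ≤ K ∧ 0 ≤ C ∧ ∀ u W G p s Q M l, IsMovingGraph u W G p s Q M → 0 ≤ Q → s ≤ 3 / 2 →
      0 < l → l ≤ lam → l ≤ lam * (9 - s) / 8 → lam / 8 * (2 + s) ≤ l / 2 →
      ∃ G' p', IsMovingGraph (f ∘ u) {w ∈ W | (u w) 0 ∉ A ∧ (u w) 1 ∉ B} G' p' (1 / 2)
        ((K + 3 / 16 * lam * Q) / l ^ 2)
        (2 / l * M + (1 / l * C + 2 * ((K + lam / 8 * Q) / l ^ 2))) := by
  obtain ⟨C₂, hC₂, hDf, hDfb⟩ := hf0.exists_bounds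
  obtain ⟨C, hC, hstep⟩ := exists_frameVariation_step A B
  set R := regularSet A B with hR
  set D := fderivWithin ℝ f R with hD
  have huR : UniqueDiffOn ℝ R := uniqueDiffOn_regularSet A B
  -- The estimates below produce `9/4 * C₂` for `L` and `27/8 * C₂` for the slope; `4 * C₂` covers
  -- both.
  refine ⟨4 * C₂, C, by positivity, hC, ?_⟩
  intro u W G p s Q M l hu hQ hs hl hl1 hl2 hl3
  set W' := {w ∈ W | (u w) 0 ∉ A ∧ (u w) 1 ∉ B} with hW'
  have hsub : W' ⊆ W := sep_subset _ _
  have huR' : MapsTo u W' R := fun w hw =>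
    ⟨hu.mapsTo hw.1, fun h => h.2.elim hw.2.1 hw.2.2⟩
  have hW'o : IsOpen W' := by
    have h1 : W' = W ∩ u ⁻¹' {q : Space3 | q 0 ∈ A ∨ q 1 ∈ B}ᶜ := by
      ext w
      simp only [hW', mem_ofPred_eq, mem_inter_iff, mem_preimage, mem_compl_iff, not_or]
    rw [h1]
    exact hu.contDiffOn.continuousOn.isOpen_inter_preimage hu.isOpen
      (isClosed_cutSet A B).isOpen_compl
  have hnhds : ∀ w ∈ W', W' ∈ 𝓝 w := fun w hw => hW'o.mem_nhds hw
  have huC : ContDiffOn ℝ 1 u W' := hu.contDiffOn.mono hsub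
  have hpC : ContDiffOn ℝ 1 p W' := hu.contDiffOn_slope.mono hsub
  have hud : ∀ w ∈ W', HasFDerivAt u (fderiv ℝ u w) w := fun w hw =>
    ((huC.differentiableOn one_ne_zero).differentiableAt (hnhds w hw)).hasFDerivAt
  have hpd : ∀ w ∈ W', HasFDerivAt p (fderiv ℝ p w) w := fun w hw =>
    ((hpC.differentiableOn one_ne_zero).differentiableAt (hnhds w hw)).hasFDerivAt
  have hs2 : ∀ w ∈ W', ‖p w‖ ≤ 3 / 2 := fun w hw => (hu.slope_le w hw.1).trans hs
  have hTg : ∀ w ∈ W', ∀ v, fderiv ℝ u w (G w v) = slopeLift (p w) v := fun w hw v =>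
    congrArg (fun L => L v) (hu.tangent w hw.1)
  -- entries of the derivative
  have h0 : ∀ w ∈ W', lam ≤ |D (u w) (Pi.single 0 1) 0| - |D (u w) (Pi.single 1 1) 0| -
      |D (u w) (Pi.single 2 1) 0| := fun w hw => (hf1 _ (huR' hw)).1
  have h1 : ∀ w ∈ W', lam ≤ |D (u w) (Pi.single 1 1) 1| - |D (u w) (Pi.single 0 1) 1| -
      |D (u w) (Pi.single 2 1) 1| := fun w hw => (hf1 _ (huR' hw)).2
  have h2 : ∀ w ∈ W', ∀ i, |D (u w) (Pi.single 2 1) i| ≤ lam / 8 := fun w hw i =>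
    hf2 _ (huR' hw) i 2 (by simp) (by simp)
  have h3 : ∀ w ∈ W', ∀ j, |D (u w) (Pi.single j 1) 2| ≤ lam / 8 := fun w hw j =>
    hf2 _ (huR' hw) 2 j (by simp) (by simp)
  -- the derivative along the surface
  set N : ℝ × ℝ → ℝ × ℝ →L[ℝ] Space3 := fun w => D (u w) ∘L slopeLift (p w) with hN
  set X : ℝ × ℝ → ℝ × ℝ →L[ℝ] ℝ × ℝ := fun w => projXYL ∘L N w with hX
  set L : ℝ × ℝ → ℝ × ℝ →L[ℝ] ℝ × ℝ := fun w => Ring.inverse (X w) with hL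
  have hexp : ∀ w ∈ W', ∀ v, l * ‖v‖ ≤ ‖X w v‖ := fun w hw v =>
    expanding_of_dominated (h0 w hw) (h1 w hw) (h2 w hw) hl1 hl2 (hu.slope_le w hw.1) v
  have hXL : ∀ w ∈ W', X w ∘L L w = ContinuousLinearMap.id ℝ _ := fun w hw =>
    (ringInverse_of_expanding hl (hexp w hw)).1
  have hLX : ∀ w ∈ W', L w ∘L X w = ContinuousLinearMap.id ℝ _ := fun w hw =>
    (ringInverse_of_expanding hl (hexp w hw)).2.1
  have hLl : ∀ w ∈ W', ‖L w‖ ≤ 1 / l := fun w hw =>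
    (ringInverse_of_expanding hl (hexp w hw)).2.2
  have hLv : ∀ w ∈ W', ∀ v, ‖L w v‖ ≤ ‖v‖ / l := fun w hw v => by
    refine ((L w).le_opNorm v).trans ?_
    rw [div_eq_inv_mul, ← one_div]
    exact mul_le_mul_of_nonneg_right (hLl w hw) (norm_nonneg _)
  have hXLv : ∀ w ∈ W', ∀ v, projXYL (N w (L w v)) = v := fun w hw v =>
    congrArg (fun T => T v) (hXL w hw)
  have hNC : ContDiffOn ℝ 1 N W' :=
    (hDf.comp huC huR').clm_comp (contDiff_slopeLift.comp_contDiffOn hpC)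
  have hXC : ContDiffOn ℝ 1 X W' := contDiffOn_const.clm_comp hNC
  have hLC : ContDiffOn ℝ 1 L W' := fun w hw => by
    obtain ⟨U, hU⟩ := isUnit_of_expanding hl (hexp w hw)
    have h4 : ContDiffAt ℝ 1 Ring.inverse (X w) := hU ▸ contDiffAt_ringInverse ℝ U
    exact h4.comp_contDiffWithinAt w (hXC w hw)
  -- derivatives along the frame
  have hNd : ∀ w ∈ W', ∃ N' : ℝ × ℝ →L[ℝ] ℝ × ℝ →L[ℝ] Space3, HasFDerivAt N N' w ∧
      ∀ v y, ∃ a : Space3, ‖a‖ ≤ 9 / 4 * C₂ * ‖v‖ * ‖y‖ ∧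
        N' (G w v) y = a + fderiv ℝ p w (G w v) y • D (u w) (Pi.single 2 1) := fun w hw => by
    have hD2 : HasFDerivWithinAt D (fderivWithin ℝ D R (u w)) R (u w) :=
      (hDf.differentiableOn one_ne_zero _ (huR' hw)).hasFDerivWithinAt
    have hDu : HasFDerivAt (fun w => D (u w)) ((fderivWithin ℝ D R (u w)) ∘L fderiv ℝ u w) w :=
      (hD2.comp w (hud w hw).hasFDerivWithinAt huR').hasFDerivAt (hnhds w hw)
    have hsl : HasFDerivAt (fun w => slopeLift (p w)) (verticalL ∘L fderiv ℝ p w) w :=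
      (verticalL.hasFDerivAt.comp w (hpd w hw)).const_add _
    -- The first term is the second derivative of `f` on two tangent vectors, each lift costing a
    -- factor `3/2`; the second is the variation of the slope times the column `∂f/∂z`.
    refine ⟨_, hDu.clm_comp hsl, fun v y =>
      ⟨fderivWithin ℝ D R (u w) (slopeLift (p w) v) (slopeLift (p w) y), ?_, ?_⟩⟩
    · have i1 := norm_slopeLift_le (by norm_num) (hs2 w hw) v
      have i2 := norm_slopeLift_le (by norm_num) (hs2 w hw) y
      calc _ ≤ ‖fderivWithin ℝ D R (u w)‖ * ‖slopeLift (p w) v‖ * ‖slopeLift (p w) y‖ :=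
            ContinuousLinearMap.le_opNorm₂ _ _ _
        _ ≤ C₂ * (3 / 2 * ‖v‖) * (3 / 2 * ‖y‖) := by
            gcongr
            exact (hDfb _ (huR' hw)).2
        _ = _ := by ring
    · simp only [_root_.add_apply, ContinuousLinearMap.comp_apply,
        ContinuousLinearMap.compL_apply, ContinuousLinearMap.flip_apply, hTg w hw v]
      rw [add_comm, verticalL_apply, map_smul]
  have hdp : ∀ w ∈ W', ∀ v y, |fderiv ℝ p w (G w v) y| ≤ Q * ‖v‖ * ‖y‖ := fun w hw v y =>
    (ContinuousLinearMap.le_opNorm _ _).trans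
      (mul_le_mul_of_nonneg_right (hu.fderiv_slope_le w hw.1 v) (norm_nonneg _))
  have hLβ : ∀ w ∈ W', ∀ v, ‖fderiv ℝ L w (G w v)‖ ≤ (4 * C₂ + lam / 8 * Q) / l ^ 2 * ‖v‖ := by
    intro w hw v
    obtain ⟨N', hN', hN'v⟩ := hNd w hw
    have hX' : HasFDerivAt X ((ContinuousLinearMap.compL ℝ _ _ _ projXYL) ∘L N') w :=
      (ContinuousLinearMap.compL ℝ (ℝ × ℝ) Space3 (ℝ × ℝ) projXYL).hasFDerivAt.comp w hN'
    obtain ⟨Y, hY, hYd⟩ := hasFDerivAt_ringInverse_comp (isUnit_of_expanding hl (hexp w hw)) hX'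
    rw [hY.fderiv, hYd, norm_neg]
    refine ContinuousLinearMap.opNorm_le_bound _ (by positivity) fun x => ?_
    obtain ⟨a, ha, hae⟩ := hN'v v (L w x)
    have i1 : ‖N' (G w v) (L w x)‖ ≤ (4 * C₂ + lam / 8 * Q) * ‖v‖ * ‖L w x‖ := by
      rw [hae]
      refine (norm_add_le _ _).trans ?_
      rw [norm_smul]
      have i2 : ‖D (u w) (Pi.single 2 1)‖ ≤ lam / 8 :=
        (pi_norm_le_iff_of_nonneg (by positivity)).2 (h2 w hw)
      have i3 := mul_le_mul (hdp w hw v (L w x)) i2 (norm_nonneg _) (by positivity)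
      have i4 : 0 ≤ C₂ * ‖v‖ * ‖L w x‖ := by positivity
      rw [Real.norm_eq_abs]
      nlinarith
    calc ‖L w (projXYL (N' (G w v) (L w x)))‖ ≤ ‖projXYL (N' (G w v) (L w x))‖ / l := hLv w hw _
      _ ≤ ((4 * C₂ + lam / 8 * Q) * ‖v‖ * (‖x‖ / l)) / l := by
          gcongr
          refine (norm_projXYL_le _).trans (i1.trans ?_)
          gcongr
          exact hLv w hw x
      _ = _ := by field_simp
  -- the new slope
  set π₂ : Space3 →L[ℝ] ℝ := ContinuousLinearMap.proj 2 with hπ₂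
  set p' : ℝ × ℝ → ℝ × ℝ →L[ℝ] ℝ := fun w => π₂ ∘L (N w ∘L L w) with hp'
  have hp'le : ∀ w ∈ W', ‖p' w‖ ≤ 1 / 2 := fun w hw => by
    refine ContinuousLinearMap.opNorm_le_bound _ (by norm_num) fun v => ?_
    have i1 := abs_vertical_le (h3 w hw) (hu.slope_le w hw.1) (L w v)
    have i2 : lam / 8 * (2 + s) * ‖L w v‖ ≤ l / 2 * (‖v‖ / l) := by
      refine mul_le_mul hl3 (hLv w hw v) (norm_nonneg _) (by positivity)
    have i3 : l / 2 * (‖v‖ / l) = 1 / 2 * ‖v‖ := by field_simp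
    exact i1.trans (i2.trans i3.le)
  have hdp' : ∀ w ∈ W', ∀ v, ‖fderiv ℝ p' w (G w (L w v))‖ ≤
      (4 * C₂ + 3 / 16 * lam * Q) / l ^ 2 * ‖v‖ := by
    intro w hw v
    obtain ⟨N', hN', hN'v⟩ := hNd w hw
    have hX' : HasFDerivAt X ((ContinuousLinearMap.compL ℝ _ _ _ projXYL) ∘L N') w :=
      (ContinuousLinearMap.compL ℝ (ℝ × ℝ) Space3 (ℝ × ℝ) projXYL).hasFDerivAt.comp w hN'
    obtain ⟨Y, hY, hYd⟩ := hasFDerivAt_ringInverse_comp (isUnit_of_expanding hl (hexp w hw)) hX'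
    have hp'd : HasFDerivAt p' _ w :=
      (ContinuousLinearMap.compL ℝ (ℝ × ℝ) Space3 ℝ π₂).hasFDerivAt.comp w (hN'.clm_comp hY)
    rw [hp'd.fderiv]
    refine ContinuousLinearMap.opNorm_le_bound _ (by positivity) fun x => ?_
    obtain ⟨a, ha, hae⟩ := hN'v (L w v) (L w x)
    set c := D (u w) (Pi.single 2 1) with hc
    -- With `z` the derivative of `N` applied to `L w x`, the product rule leaves `z 2 - p' w
    -- (projXYL z)`, the vertical defect of `z` from the new tangent plane. As the new slope is at
    -- most `1/2`, the defect is at most `3/2 * ‖z‖`.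
    have e : ((ContinuousLinearMap.compL ℝ (ℝ × ℝ) Space3 ℝ π₂ ∘L
        (ContinuousLinearMap.compL ℝ (ℝ × ℝ) (ℝ × ℝ) Space3 (N w) ∘L Y +
          (ContinuousLinearMap.compL ℝ (ℝ × ℝ) (ℝ × ℝ) Space3).flip (L w) ∘L N')) (G w (L w v))) x =
        (a 2 - p' w (projXYL a)) +
          fderiv ℝ p w (G w (L w v)) (L w x) * (c 2 - p' w (projXYL c)) := by
      have e1 : ∀ z, p' w z = (N w (L w z)) 2 := fun z => rfl
      simp only [_root_.add_apply, ContinuousLinearMap.comp_apply,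
        ContinuousLinearMap.compL_apply, ContinuousLinearMap.flip_apply, hYd,
        _root_.neg_apply, map_add, map_neg]
      have e2 : ∀ z : Space3, π₂ z = z 2 := fun z => rfl
      have e3 : ∀ z, π₂ (N w (L w z)) = p' w z := fun z => rfl
      change -p' w (projXYL (N' (G w (L w v)) (L w x))) + (N' (G w (L w v)) (L w x)) 2 = _
      rw [hae]
      simp only [map_add, map_smul, Pi.add_apply, Pi.smul_apply, smul_eq_mul]
      ring
    refine (congrArg norm e).le.trans ?_
    have hω : ∀ z : Space3, |z 2 - p' w (projXYL z)| ≤ 3 / 2 * ‖z‖ := fun z => by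
      have i1 : |z 2| ≤ ‖z‖ := norm_le_pi_norm z 2
      have i2 : |p' w (projXYL z)| ≤ 1 / 2 * ‖z‖ := ((p' w).le_opNorm _).trans
        (mul_le_mul (hp'le w hw) (norm_projXYL_le z) (norm_nonneg _) (by norm_num))
      exact (abs_sub _ _).trans (by linarith)
    have i2 : ‖c‖ ≤ lam / 8 := (pi_norm_le_iff_of_nonneg (by positivity)).2 (h2 w hw)
    have i3 : |fderiv ℝ p w (G w (L w v)) (L w x) * (c 2 - p' w (projXYL c))| ≤
        Q * ‖L w v‖ * ‖L w x‖ * (3 / 2 * (lam / 8)) := by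
      rw [abs_mul]
      refine mul_le_mul (hdp w hw _ _) ((hω c).trans (by gcongr)) (abs_nonneg _) (by positivity)
    have i4 : |a 2 - p' w (projXYL a)| ≤ 3 / 2 * (9 / 4 * C₂ * ‖L w v‖ * ‖L w x‖) :=
      (hω a).trans (by gcongr)
    calc _ ≤ 3 / 2 * (9 / 4 * C₂ * ‖L w v‖ * ‖L w x‖) +
          Q * ‖L w v‖ * ‖L w x‖ * (3 / 2 * (lam / 8)) := (abs_add_le _ _).trans (add_le_add i4 i3)
      _ = (27 / 8 * C₂ + 3 / 16 * lam * Q) * ‖L w v‖ * ‖L w x‖ := by ring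
      _ ≤ (4 * C₂ + 3 / 16 * lam * Q) * (‖v‖ / l) * (‖x‖ / l) := by
          gcongr ?_ * ?_ * ?_
          · linarith
          · exact hLv w hw v
          · exact hLv w hw x
      _ = _ := by field_simp
  have hfd : ∀ w ∈ W', fderiv ℝ (f ∘ u) w = D (u w) ∘L fderiv ℝ u w := fun w hw => by
    have h4 : HasFDerivWithinAt f (D (u w)) R (u w) :=
      (hf0.1.differentiableOn two_ne_zero _ (huR' hw)).hasFDerivWithinAt
    exact ((h4.comp w (hud w hw).hasFDerivWithinAt huR').hasFDerivAt (hnhds w hw)).fderiv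
  have hlift : ∀ w ∈ W', N w ∘L L w = slopeLift (p' w) := fun w hw => by
    refine ContinuousLinearMap.ext fun v => ?_
    rw [slopeLift_apply]
    have h4 := hXLv w hw v
    rw [projXYL_apply] at h4
    ext i
    fin_cases i
    · exact congrArg Prod.fst h4
    · exact congrArg Prod.snd h4
    · rfl
  have hDN : ∀ w ∈ W', D (u w) ∘L fderiv ℝ u w ∘L G w = N w := fun w hw => by
    rw [hu.tangent w hw.1]
  have hFd : ∀ w ∈ W, fderiv ℝ (projXYL ∘ u) w = projXYL ∘L fderiv ℝ u w := fun w hw =>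
    (projXYL.hasFDerivAt.comp w ((hu.contDiffOn.differentiableOn one_ne_zero).differentiableAt
      (hu.isOpen.mem_nhds hw)).hasFDerivAt).fderiv
  have hvar := hstep W W' (projXYL ∘ u) G L M l ((4 * C₂ + lam / 8 * Q) / l ^ 2) hu.isOpen
    hu.volume_le (projXYL.contDiff.comp_contDiffOn hu.contDiffOn) hu.continuousOn_frame
    (fun w hw => by
      rw [hFd w hw, ContinuousLinearMap.comp_assoc, hu.tangent w hw, projXYL_comp_slopeLift])
    rfl hW'o hu.variation hl (by positivity) hLC hLl hLβ
    ⟨C₂ * (3 / 2), fun w hw => ⟨X w, by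
      refine ContinuousLinearMap.opNorm_le_bound _ (by positivity) fun v => ?_
      refine (norm_projXYL_le _).trans (((D (u w)).le_opNorm _).trans ?_)
      rw [mul_assoc]
      exact mul_le_mul (hDfb _ (huR' hw)).1 (norm_slopeLift_le (by norm_num) (hs2 w hw) v)
        (norm_nonneg _) hC₂, hLX w hw⟩⟩
  have hπu : ∀ w ∈ W', slopeLift (p w) ∘L (projXYL ∘L fderiv ℝ u w) = fderiv ℝ u w := fun w hw => by
    rw [← hu.tangent w hw.1, ContinuousLinearMap.comp_assoc, hu.frame_comp w hw.1,
      ContinuousLinearMap.comp_id]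
  refine ⟨fun w => G w ∘L L w, p', ?_⟩
  exact
    { isOpen := hW'o
      volume_le := (measure_mono hsub).trans hu.volume_le
      mapsTo := fun w hw => hfR (hu.mapsTo hw.1)
      contDiffOn := (hf0.1.of_le (by norm_num)).comp huC huR'
      continuousOn_frame := (hu.continuousOn_frame.mono hsub).clm_comp hLC.continuousOn
      tangent := fun w hw => by
        rw [hfd w hw, ← hlift w hw, ← hDN w hw]
        rfl
      frame_comp := fun w hw => by
        rw [hfd w hw]
        have e : (G w ∘L L w) ∘L (projXYL ∘L (D (u w) ∘L fderiv ℝ u w)) =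
            G w ∘L (L w ∘L X w) ∘L (projXYL ∘L fderiv ℝ u w) := by
          conv_lhs => rw [← hπu w hw]
          rfl
        rw [e, hLX w hw, ContinuousLinearMap.id_comp, hu.frame_comp w hw.1]
      contDiffOn_slope := contDiffOn_const.clm_comp (hNC.clm_comp hLC)
      slope_le := hp'le
      fderiv_slope_le := hdp'
      variation := hvar }

/-! ### Moving graphs have absolutely continuous projections -/

namespace IsMovingGraph

variable {u : ℝ × ℝ → Space3} {W : Set (ℝ × ℝ)} {G : ℝ × ℝ → ℝ × ℝ →L[ℝ] ℝ × ℝ}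
  {p : ℝ × ℝ → ℝ × ℝ →L[ℝ] ℝ} {s Q M : ℝ}

theorem mono (hu : IsMovingGraph u W G p s Q M) {Q' M' : ℝ} (hQ : Q ≤ Q') (hM : M ≤ M') :
    IsMovingGraph u W G p s Q' M' :=
  { hu with
    fderiv_slope_le := fun w hw v => (hu.fderiv_slope_le w hw v).trans
      (mul_le_mul_of_nonneg_right hQ (norm_nonneg _))
    variation := fun Φ h1 h2 h3 => (hu.variation Φ h1 h2 h3).trans hM }

/-- The derivative of the pulled-back field along the frame is the derivative of `ψ` at the
projected point, so its trace is the divergence. -/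
theorem integral_planeDiv_le (hu : IsMovingGraph u W G p s Q M) {ψ : ℝ × ℝ → ℝ × ℝ}
    (hψ : ContDiff ℝ 1 ψ) (hψc : HasCompactSupport ψ) (hψ1 : ∀ q, |(ψ q).1| ≤ 1 ∧ |(ψ q).2| ≤ 1) :
    ∫ w in W, planeDiv ψ (projXY (u w)) ≤ M := by
  have hd : ∀ w ∈ W, fderiv ℝ (fun w => ψ (projXYL (u w))) w ∘L G w =
      fderiv ℝ ψ (projXY (u w)) := fun w hw => by
    have h1 : HasFDerivAt u (fderiv ℝ u w) w :=
      ((hu.contDiffOn.differentiableOn one_ne_zero).differentiableAt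
        (hu.isOpen.mem_nhds hw)).hasFDerivAt
    have h2 : HasFDerivAt ψ (fderiv ℝ ψ (projXYL (u w))) (projXYL (u w)) :=
      (hψ.differentiable one_ne_zero _).hasFDerivAt
    have h3 : HasFDerivAt (fun w => ψ (projXYL (u w))) _ w :=
      h2.comp w (projXYL.hasFDerivAt.comp w h1)
    rw [h3.fderiv, ContinuousLinearMap.comp_assoc, ContinuousLinearMap.comp_assoc,
      hu.tangent w hw, projXYL_comp_slopeLift, ContinuousLinearMap.comp_id]
    rfl
  obtain ⟨K, hK⟩ := (hψc.fderiv ℝ).exists_bound_of_continuous (hψ.continuous_fderiv one_ne_zero)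
  have h := hu.variation (fun w => ψ (projXYL (u w)))
    (hψ.comp_contDiffOn (projXYL.contDiff.comp_contDiffOn hu.contDiffOn))
    (fun w _ => max_le (hψ1 _).1 (hψ1 _).2) ⟨K, fun w hw => by rw [hd w hw]; exact hK _⟩
  refine le_trans (le_of_eq ?_) h
  refine setIntegral_congr_fun hu.isOpen.measurableSet fun w hw => ?_
  simp only [hd w hw]
  rfl

theorem aemeasurable (hu : IsMovingGraph u W G p s Q M) : AEMeasurable u (volume.restrict W) :=
  hu.contDiffOn.continuousOn.aemeasurable hu.isOpen.measurableSet

theorem isFiniteMeasure_restrict (hu : IsMovingGraph u W G p s Q M) :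
    IsFiniteMeasure (volume.restrict W) :=
  ⟨by simpa using hu.volume_le.trans_lt ENNReal.one_lt_top⟩

end IsMovingGraph

theorem continuous_projXY : Continuous projXY := projXYL.continuous

theorem continuous_planeDiv {ψ : ℝ × ℝ → ℝ × ℝ} (hψ : ContDiff ℝ 1 ψ) :
    Continuous (planeDiv ψ) := by
  have h := hψ.continuous_fderiv one_ne_zero
  unfold planeDiv
  exact (h.clm_apply continuous_const).fst.add (h.clm_apply continuous_const).snd

/-- The vertical and horizontal cut lines in the plane are Lebesgue null. -/
theorem volume_cutLines (A B : Finset ℝ) :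
    volume {q : ℝ × ℝ | q.1 ∈ A ∨ q.2 ∈ B} = 0 := by
  have h : {q : ℝ × ℝ | q.1 ∈ A ∨ q.2 ∈ B} ⊆
      ((A : Set ℝ) ×ˢ (univ : Set ℝ)) ∪ ((univ : Set ℝ) ×ˢ (B : Set ℝ)) := by
    rintro q (hq | hq)
    · exact Or.inl ⟨hq, mem_univ _⟩
    · exact Or.inr ⟨mem_univ _, hq⟩
  refine measure_mono_null h (measure_union_null ?_ ?_)
  · rw [Measure.volume_eq_prod, Measure.prod_prod, A.finite_toSet.measure_zero, zero_mul]
  · rw [Measure.volume_eq_prod, Measure.prod_prod, B.finite_toSet.measure_zero, mul_zero]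

namespace IsMovingGraph

variable {u : ℝ × ℝ → Space3} {W : Set (ℝ × ℝ)} {G : ℝ × ℝ → ℝ × ℝ →L[ℝ] ℝ × ℝ}
  {p : ℝ × ℝ → ℝ × ℝ →L[ℝ] ℝ} {s Q M : ℝ}

/-- The projected measure has bounded variation, hence is absolutely continuous, and the cut lines
are null. This keeps almost every initial point in the domain after the next cut. -/
theorem volume_preimage_cutLines (hu : IsMovingGraph u W G p s Q M) (A B : Finset ℝ) :
    volume {w ∈ W | (u w) 0 ∈ A ∨ (u w) 1 ∈ B} = 0 := by
  have := hu.isFiniteMeasure_restrict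
  have hm : AEMeasurable (fun w => projXY (u w)) (volume.restrict W) :=
    continuous_projXY.measurable.comp_aemeasurable hu.aemeasurable
  set ν := (volume.restrict W).map (fun w => projXY (u w)) with hν
  have hac : ν ≪ volume := by
    refine absolutelyContinuous_of_integral_planeDiv_le ν
      ((isCompact_Icc (a := (0 : ℝ)) (b := 1)).prod (isCompact_Icc (a := (0 : ℝ)) (b := 1))) ?_
      (M := M) fun ψ h1 h2 h3 => ?_
    · rw [hν, Measure.map_apply_of_aemeasurable hm (measurableSet_Icc.prod measurableSet_Icc).compl]
      have h : ∀ᵐ w ∂volume.restrict W, projXY (u w) ∈ Icc (0 : ℝ) 1 ×ˢ Icc (0 : ℝ) 1 :=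
        (ae_restrict_mem hu.isOpen.measurableSet).mono fun w hw =>
          ⟨hu.mapsTo hw 0, hu.mapsTo hw 1⟩
      exact h
    · rw [hν, integral_map hm (continuous_planeDiv h1).aestronglyMeasurable]
      exact hu.integral_planeDiv_le h1 h2 h3
  have h0 := hac (volume_cutLines A B)
  have hT : MeasurableSet {q : ℝ × ℝ | q.1 ∈ A ∨ q.2 ∈ B} :=
    (measurable_fst A.measurableSet).union (measurable_snd B.measurableSet)
  rw [hν, Measure.map_apply_of_aemeasurable hm hT,
    Measure.restrict_apply' hu.isOpen.measurableSet] at h0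
  refine measure_mono_null (fun w hw => ?_) h0
  exact ⟨hw.2, hw.1⟩

end IsMovingGraph

/-! ### The initial graph -/

/-- The integral of the bounded derivative of a bounded function over an open interval. -/
theorem setIntegral_deriv_le_two {a b : ℝ} (hab : a < b) {g g' : ℝ → ℝ}
    (hg : ∀ x ∈ Ioo a b, HasDerivAt g (g' x) x) (hg' : ContinuousOn g' (Ioo a b)) {K : ℝ}
    (hK : ∀ x ∈ Ioo a b, |g' x| ≤ K) (hg1 : ∀ x ∈ Ioo a b, |g x| ≤ 1) :
    ∫ x in Ioo a b, g' x ≤ 2 := by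
  have hK0 : 0 ≤ K := (abs_nonneg _).trans (hK ((a + b) / 2) ⟨by linarith, by linarith⟩)
  have hlip : LipschitzOnWith ⟨K, hK0⟩ g (Ioo a b) :=
    (convex_Ioo a b).lipschitzOnWith_of_nnnorm_hasDerivWithin_le
      (fun x hx => (hg x hx).hasDerivWithinAt) fun x hx => hK x hx
  -- Nothing is known at the endpoints, but a bounded derivative makes `g` Lipschitz; its extension
  -- inherits `|g| ≤ 1` on the closure, and the fundamental theorem applies there.
  obtain ⟨h, hh, hgh⟩ := hlip.extend_real
  have hd : ∀ x ∈ Ioo a b, HasDerivAt h (g' x) x := fun x hx =>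
    (hg x hx).congr_of_eventuallyEq (by
      filter_upwards [Ioo_mem_nhds hx.1 hx.2] with y hy using (hgh hy).symm)
  have hb : ∀ x ∈ Icc a b, |h x| ≤ 1 := fun x hx => by
    rw [← closure_Ioo hab.ne] at hx
    exact closure_minimal (s := Ioo a b) (t := {x | |h x| ≤ 1})
      (fun y hy => by rw [mem_ofPred_eq, ← hgh hy]; exact hg1 y hy)
      (isClosed_le hh.continuous.abs continuous_const) hx
  have hi : IntegrableOn g' (Ioo a b) volume :=
    Integrable.of_bound (C := K) (hg'.aestronglyMeasurable measurableSet_Ioo)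
      ((ae_restrict_mem measurableSet_Ioo).mono fun x hx => hK x hx)
  have hi' : IntervalIntegrable g' volume a b := by
    rw [intervalIntegrable_iff_integrableOn_Ioo_of_le hab.le]; exact hi
  rw [← integral_Ioc_eq_integral_Ioo, ← intervalIntegral.integral_of_le hab.le,
    intervalIntegral.integral_eq_sub_of_hasDerivAt_of_le hab.le hh.continuous.continuousOn hd hi']
  have h1 := abs_le.1 (hb b (right_mem_Icc.2 hab.le))
  have h2 := abs_le.1 (hb a (left_mem_Icc.2 hab.le))
  linarith

/-- On each line parallel to an axis the derivative of a component integrates to at most 2. The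
transverse side has length at most 1, and there are two components. -/
theorem frameVariationLE_rectangle {x₀ x₁ y₀ y₁ : ℝ} (hx : x₀ < x₁) (hx1 : x₁ ≤ x₀ + 1)
    (hy : y₀ < y₁) (hy1 : y₁ ≤ y₀ + 1) :
    FrameVariationLE (Ioo x₀ x₁ ×ˢ Ioo y₀ y₁) (fun _ => ContinuousLinearMap.id ℝ _) 4 := by
  intro Φ hΦ hΦ1 ⟨K, hK⟩
  simp only [ContinuousLinearMap.comp_id] at hK ⊢
  set W := Ioo x₀ x₁ ×ˢ Ioo y₀ y₁ with hW
  have hWo : IsOpen W := isOpen_Ioo.prod isOpen_Ioo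
  have hc : ContinuousOn (fderiv ℝ Φ) W := hΦ.continuousOn_fderiv_of_isOpen hWo le_rfl
  have hd : ∀ w ∈ W, HasFDerivAt Φ (fderiv ℝ Φ w) w := fun w hw =>
    ((hΦ.differentiableOn one_ne_zero).differentiableAt (hWo.mem_nhds hw)).hasFDerivAt
  have hWv : volume W ≤ 1 := by
    rw [hW, Measure.volume_eq_prod, Measure.prod_prod, Real.volume_Ioo, Real.volume_Ioo]
    exact mul_le_one' (by rw [ENNReal.ofReal_le_one]; linarith)
      (by rw [ENNReal.ofReal_le_one]; linarith)
  have hfin : IsFiniteMeasure (volume.restrict W) :=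
    ⟨by simpa using hWv.trans_lt ENNReal.one_lt_top⟩
  have hc1 : ContinuousOn (fun w => (fderiv ℝ Φ w (1, 0)).1) W :=
    (hc.clm_apply continuousOn_const).fst
  have hc2 : ContinuousOn (fun w => (fderiv ℝ Φ w (0, 1)).2) W :=
    (hc.clm_apply continuousOn_const).snd
  have hn1 : ‖((1 : ℝ), (0 : ℝ))‖ = 1 := by simp [Prod.norm_def]
  have hn2 : ‖((0 : ℝ), (1 : ℝ))‖ = 1 := by simp [Prod.norm_def]
  have hb1 : ∀ w ∈ W, |(fderiv ℝ Φ w (1, 0)).1| ≤ K := fun w hw =>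
    (norm_fst_le _).trans (((fderiv ℝ Φ w).le_opNorm _).trans (by rw [hn1, mul_one]; exact hK w hw))
  have hb2 : ∀ w ∈ W, |(fderiv ℝ Φ w (0, 1)).2| ≤ K := fun w hw =>
    (norm_snd_le _).trans (((fderiv ℝ Φ w).le_opNorm _).trans (by rw [hn2, mul_one]; exact hK w hw))
  have hi1 : IntegrableOn (fun w => (fderiv ℝ Φ w (1, 0)).1) W volume :=
    Integrable.of_bound (C := K) (hc1.aestronglyMeasurable hWo.measurableSet)
      ((ae_restrict_mem hWo.measurableSet).mono fun x hx => hb1 x hx)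
  have hi2 : IntegrableOn (fun w => (fderiv ℝ Φ w (0, 1)).2) W volume :=
    Integrable.of_bound (C := K) (hc2.aestronglyMeasurable hWo.measurableSet)
      ((ae_restrict_mem hWo.measurableSet).mono fun x hx => hb2 x hx)
  have e : (volume : Measure (ℝ × ℝ)).restrict W =
      (volume.restrict (Ioo x₀ x₁)).prod (volume.restrict (Ioo y₀ y₁)) :=
    (Measure.prod_restrict _ _).symm
  have hi1' := hi1
  have hi2' := hi2
  rw [IntegrableOn, e] at hi1' hi2'
  have hlen : ∀ {a b : ℝ}, a < b → b ≤ a + 1 → ∀ {F : ℝ → ℝ}, IntegrableOn F (Ioo a b) →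
      (∀ t ∈ Ioo a b, F t ≤ 2) → ∫ t in Ioo a b, F t ≤ 2 := fun {a b} hab hab1 {F} hF h => by
    have h1 := setIntegral_mono_on hF (integrableOn_const (by simp)) measurableSet_Ioo h
    rw [setIntegral_const, smul_eq_mul, Real.volume_real_Ioo_of_le hab.le] at h1
    linarith
  have h1 : ∫ w in W, (fderiv ℝ Φ w (1, 0)).1 ≤ 2 := by
    rw [e, integral_prod_symm _ hi1']
    · refine hlen hy hy1 hi1'.integral_prod_right fun y hy' => ?_
      · refine setIntegral_deriv_le_two (g := fun x => (Φ (x, y)).1) (K := K) hx (fun x hx' => ?_)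
          ?_ (fun x hx' => hb1 _ ⟨hx', hy'⟩)
          (fun x hx' => (norm_fst_le _).trans (hΦ1 _ ⟨hx', hy'⟩))
        · have := ((hd (x, y) ⟨hx', hy'⟩).comp_hasDerivAt x
            ((hasDerivAt_id x).prodMk (hasDerivAt_const x y)))
          exact this.fst
        · exact hc1.comp (Continuous.continuousOn (by fun_prop)) fun x hx' => ⟨hx', hy'⟩
  have h2 : ∫ w in W, (fderiv ℝ Φ w (0, 1)).2 ≤ 2 := by
    rw [e, integral_prod _ hi2']
    · refine hlen hx hx1 hi2'.integral_prod_left fun x hx' => ?_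
      · refine setIntegral_deriv_le_two (g := fun y => (Φ (x, y)).2) (K := K) hy (fun y hy' => ?_)
          ?_ (fun y hy' => hb2 _ ⟨hx', hy'⟩)
          (fun y hy' => (norm_snd_le _).trans (hΦ1 _ ⟨hx', hy'⟩))
        · have := ((hd (x, y) ⟨hx', hy'⟩).comp_hasDerivAt y
            ((hasDerivAt_const y x).prodMk (hasDerivAt_id y)))
          exact this.snd
        · exact hc2.comp (Continuous.continuousOn (by fun_prop)) fun y hy' => ⟨hx', hy'⟩
  have h3 := integral_add hi1 hi2
  calc _ = _ := h3
    _ ≤ 4 := by linarith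

/-- The angle condition says `a ^ 2 + b ^ 2 ≤ 1`. For the sup norm on the plane the operator norm is
at most `|a| + |b| ≤ √2 < 3/2`. -/
theorem norm_le_of_normalNearZAxis {J : Set (ℝ × ℝ)} {α : ℝ × ℝ → ℝ} (h : NormalNearZAxis J α)
    {w : ℝ × ℝ} (hw : w ∈ J) : ‖fderivWithin ℝ α J w‖ ≤ 3 / 2 := by
  set a := fderivWithin ℝ α J w (1, 0) with ha
  set b := fderivWithin ℝ α J w (0, 1) with hb
  have h1 := h w hw
  have hpos : 0 < 1 + a ^ 2 + b ^ 2 := by positivity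
  have hsq : 0 < Real.sqrt (1 + a ^ 2 + b ^ 2) := Real.sqrt_pos.2 hpos
  rw [abs_of_pos (by positivity), le_div_iff₀ hsq, div_mul_eq_mul_div, div_le_one two_pos,
    ← Real.sqrt_mul zero_le_two, Real.sqrt_le_left two_pos.le] at h1
  have hab : |a| + |b| ≤ 3 / 2 := by
    refine abs_le_of_sq_le_sq' ?_ (by norm_num) |>.2
    nlinarith [sq_nonneg (|a| - |b|), sq_abs a, sq_abs b]
  refine ContinuousLinearMap.opNorm_le_bound _ (by norm_num) fun v => ?_
  have hv : fderivWithin ℝ α J w v = v.1 * a + v.2 * b := by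
    conv_lhs => rw [plane_decomp v]
    rw [map_add, map_smul, map_smul]; rfl
  rw [hv, Real.norm_eq_abs]
  have i1 : |v.1| ≤ ‖v‖ := norm_fst_le v
  have i2 : |v.2| ≤ ‖v‖ := norm_snd_le v
  calc |v.1 * a + v.2 * b| ≤ |v.1| * |a| + |v.2| * |b| := by
        rw [← abs_mul, ← abs_mul]; exact abs_add_le _ _
    _ ≤ ‖v‖ * |a| + ‖v‖ * |b| := by gcongr
    _ = (|a| + |b|) * ‖v‖ := by ring
    _ ≤ 3 / 2 * ‖v‖ := by gcongr

theorem isMovingGraph_initial {x₀ x₁ y₀ y₁ : ℝ} (hx₀ : 0 ≤ x₀) (hx : x₀ < x₁) (hx₁ : x₁ ≤ 1)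
    (hy₀ : 0 ≤ y₀) (hy : y₀ < y₁) (hy₁ : y₁ ≤ 1) {α : ℝ × ℝ → ℝ}
    (hα : ContDiffOn ℝ 2 α (Icc x₀ x₁ ×ˢ Icc y₀ y₁))
    (hα01 : MapsTo α (Icc x₀ x₁ ×ˢ Icc y₀ y₁) (Icc 0 1))
    (hnormal : NormalNearZAxis (Icc x₀ x₁ ×ˢ Icc y₀ y₁) α) :
    ∃ Q, 0 ≤ Q ∧ IsMovingGraph (graphMap α) (Ioo x₀ x₁ ×ˢ Ioo y₀ y₁)
      (fun _ => ContinuousLinearMap.id ℝ _) (fderiv ℝ α) (3 / 2) Q 4 := by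
  set J := Icc x₀ x₁ ×ˢ Icc y₀ y₁ with hJ
  set W := Ioo x₀ x₁ ×ˢ Ioo y₀ y₁ with hW
  have hWo : IsOpen W := isOpen_Ioo.prod isOpen_Ioo
  have hWJ : W ⊆ J := prod_mono Ioo_subset_Icc_self Ioo_subset_Icc_self
  have hJn : ∀ w ∈ W, J ∈ 𝓝 w := fun w hw => mem_of_superset (hWo.mem_nhds hw) hWJ
  have hJu : UniqueDiffOn ℝ J := (uniqueDiffOn_Icc hx).prod (uniqueDiffOn_Icc hy)
  have hD : ContDiffOn ℝ 1 (fderivWithin ℝ α J) J := hα.fderivWithin hJu (by norm_num)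
  have hJc : IsCompact J := isCompact_Icc.prod isCompact_Icc
  obtain ⟨Q, hQ⟩ := hJc.exists_bound_of_continuousOn (hD.continuousOn_fderivWithin hJu le_rfl)
  have hαW : ContDiffOn ℝ 2 α W := hα.mono hWJ
  have hαd : ∀ w ∈ W, HasFDerivAt α (fderiv ℝ α w) w := fun w hw =>
    ((hαW.differentiableOn two_ne_zero).differentiableAt (hWo.mem_nhds hw)).hasFDerivAt
  have hgd : ∀ w ∈ W, fderiv ℝ (graphMap α) w = slopeLift (fderiv ℝ α w) := fun w hw => by
    refine HasFDerivAt.fderiv ?_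
    refine hasFDerivAt_pi'' fun i => ?_
    fin_cases i
    · refine (hasFDerivAt_fst (p := w)).congr_fderiv ?_
      refine ContinuousLinearMap.ext fun v => ?_
      exact (congrFun (slopeLift_apply (fderiv ℝ α w) v) 0).symm
    · refine (hasFDerivAt_snd (p := w)).congr_fderiv ?_
      refine ContinuousLinearMap.ext fun v => ?_
      exact (congrFun (slopeLift_apply (fderiv ℝ α w) v) 1).symm
    · refine (hαd w hw).congr_fderiv ?_
      refine ContinuousLinearMap.ext fun v => ?_
      exact (congrFun (slopeLift_apply (fderiv ℝ α w) v) 2).symm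
  refine ⟨|Q|, abs_nonneg _, ?_⟩
  exact
    { isOpen := hWo
      volume_le := by
        rw [hW, Measure.volume_eq_prod, Measure.prod_prod, Real.volume_Ioo, Real.volume_Ioo]
        exact mul_le_one' (by rw [ENNReal.ofReal_le_one]; linarith)
          (by rw [ENNReal.ofReal_le_one]; linarith)
      mapsTo := fun w hw i => by
        have hw1 : w.1 ∈ Ioo x₀ x₁ := hw.1
        have hw2 : w.2 ∈ Ioo y₀ y₁ := hw.2
        fin_cases i
        · exact ⟨hx₀.trans hw1.1.le, hw1.2.le.trans hx₁⟩
        · exact ⟨hy₀.trans hw2.1.le, hw2.2.le.trans hy₁⟩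
        · exact hα01 (hWJ hw)
      contDiffOn := by
        rw [contDiffOn_pi]
        intro i
        fin_cases i
        · exact contDiff_fst.contDiffOn
        · exact contDiff_snd.contDiffOn
        · exact hαW.of_le (by norm_num)
      continuousOn_frame := continuousOn_const
      tangent := fun w hw => by rw [ContinuousLinearMap.comp_id, hgd w hw]
      frame_comp := fun w hw => by
        rw [ContinuousLinearMap.id_comp, hgd w hw, projXYL_comp_slopeLift]
      contDiffOn_slope := hαW.fderiv_of_isOpen hWo (by norm_num)
      slope_le := fun w hw => by
        rw [← fderivWithin_of_mem_nhds (hJn w hw)]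
        exact norm_le_of_normalNearZAxis hnormal (hWJ hw)
      fderiv_slope_le := fun w hw v => by
        have e1 : fderiv ℝ α =ᶠ[𝓝 w] fderivWithin ℝ α J := by
          filter_upwards [hWo.mem_nhds hw] with w' hw'
          exact (fderivWithin_of_mem_nhds (hJn w' hw')).symm
        rw [e1.fderiv_eq, ← fderivWithin_of_mem_nhds (hJn w hw)]
        exact (ContinuousLinearMap.le_opNorm _ _).trans (mul_le_mul_of_nonneg_right
          ((hQ w (hWJ hw)).trans (le_abs_self Q)) (norm_nonneg _))
      variation := frameVariationLE_rectangle hx (by linarith) hy (by linarith) }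

/-! ### Uniform bounds along the orbit of the initial graph -/

theorem IsMovingGraph.volume_sdiff_step {u : ℝ × ℝ → Space3} {W : Set (ℝ × ℝ)}
    {G : ℝ × ℝ → ℝ × ℝ →L[ℝ] ℝ × ℝ} {p : ℝ × ℝ → ℝ × ℝ →L[ℝ] ℝ} {s Q M : ℝ}
    (hu : IsMovingGraph u W G p s Q M) (A B : Finset ℝ) {J : Set (ℝ × ℝ)} (hJ : volume (J \ W) = 0) :
    volume (J \ {w ∈ W | (u w) 0 ∉ A ∧ (u w) 1 ∉ B}) = 0 := by
  refine measure_mono_null (fun w hw => ?_)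
    (measure_union_null hJ (hu.volume_preimage_cutLines A B))
  by_cases h : w ∈ W
  · refine Or.inr ⟨h, ?_⟩
    by_contra h'
    rw [not_or] at h'
    exact hw.2 ⟨h, h'⟩
  · exact Or.inl ⟨hw.1, h⟩

theorem exists_uniform_movingGraph {A B : Finset ℝ} {f : Space3 → Space3} {lam : ℝ}
    (hfR : MapsTo f cubeR cubeR) (hf0 : SmoothBounded A B f) (hf1 : DominatedExpansion A B f lam)
    (hf2 : SmallCoupling A B f lam) (hlam : 2 < lam) {u : ℝ × ℝ → Space3} {J W₀ : Set (ℝ × ℝ)}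
    {G₀ : ℝ × ℝ → ℝ × ℝ →L[ℝ] ℝ × ℝ} {p₀ : ℝ × ℝ → ℝ × ℝ →L[ℝ] ℝ} {Q₀ M₀ : ℝ}
    (hu : IsMovingGraph u W₀ G₀ p₀ (3 / 2) Q₀ M₀) (hQ₀ : 0 ≤ Q₀) (hW₀ : W₀ ⊆ J)
    (hJ : volume (J \ W₀) = 0) :
    ∃ Q M : ℝ, ∀ k : ℕ, ∃ W G p s, IsMovingGraph (f^[k] ∘ u) W G p s Q M ∧ W ⊆ J ∧
      volume (J \ W) = 0 := by
  have hlam0 : 0 < lam := by linarith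
  obtain ⟨K, C, hK, hC, hstep⟩ := IsMovingGraph.exists_step hfR hf0 hf1 hf2 hlam0
  -- The first step starts from slope `3/2`, for which `lam * (9 - 3/2) / 8 = 15/16 * lam`. Its
  -- factor `2 / l` may exceed 1, but it is used only once: from then on the slope is at most `1/2`
  -- and `l = lam` is allowed.
  obtain ⟨G₁, p₁, hu₁⟩ := hstep u W₀ G₀ p₀ (3 / 2) Q₀ M₀ (15 / 16 * lam) hu hQ₀ le_rfl
    (by positivity) (by linarith) (by linarith) (by linarith)
  set Q₁ := (K + 3 / 16 * lam * Q₀) / (15 / 16 * lam) ^ 2 with hQ₁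
  set M₁ := 2 / (15 / 16 * lam) * M₀ +
    (1 / (15 / 16 * lam) * C + 2 * ((K + lam / 8 * Q₀) / (15 / 16 * lam) ^ 2)) with hM₁
  -- `Q` and `M` are chosen to be preserved by the recursion: `2 * K ≤ Q` suffices for the curvature
  -- since `lam > 2`, and `E / (1 - 2 / lam)` is the fixed point of `M ↦ 2 / lam * M + E`.
  set Q := max Q₀ (max Q₁ (2 * K)) with hQ
  set E := 1 / lam * C + 2 * ((K + lam / 8 * Q) / lam ^ 2) with hE
  set M := max M₀ (max M₁ (E / (1 - 2 / lam))) with hM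
  have hQ0 : 0 ≤ Q := hQ₀.trans (le_max_left _ _)
  have hQK : 2 * K ≤ Q := (le_max_right _ _).trans (le_max_right _ _)
  have hQstep : (K + 3 / 16 * lam * Q) / lam ^ 2 ≤ Q := by
    rw [div_le_iff₀ (by positivity)]
    nlinarith [mul_nonneg hQ0 hlam0.le, mul_nonneg (mul_nonneg hQ0 hlam0.le) (sub_pos.2 hlam).le]
  have h2 : 2 / lam < 1 := by rw [div_lt_one hlam0]; exact hlam
  have hMstep : 2 / lam * M + E ≤ M := by
    have h3 : E / (1 - 2 / lam) ≤ M := (le_max_right _ _).trans (le_max_right _ _)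
    rw [div_le_iff₀ (by linarith)] at h3
    linarith
  have hsub : ∀ {W : Set (ℝ × ℝ)} {v : ℝ × ℝ → Space3}, W ⊆ J →
      {w ∈ W | (v w) 0 ∉ A ∧ (v w) 1 ∉ B} ⊆ J := fun h => (sep_subset _ _).trans h
  have hind : ∀ k : ℕ, ∃ W G p, IsMovingGraph (f^[k + 1] ∘ u) W G p (1 / 2) Q M ∧ W ⊆ J ∧
      volume (J \ W) = 0 := by
    intro k
    induction k with
    | zero =>
      exact ⟨_, G₁, p₁, hu₁.mono ((le_max_left _ _).trans (le_max_right _ _))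
        ((le_max_left _ _).trans (le_max_right _ _)), hsub hW₀, hu.volume_sdiff_step A B hJ⟩
    | succ k ih =>
      obtain ⟨W, G, p, h, hWJ, hJW⟩ := ih
      obtain ⟨G', p', h'⟩ := hstep _ W G p (1 / 2) Q M lam h hQ0 (by norm_num) hlam0 le_rfl
        (by linarith) (by linarith)
      have e : f^[k + 1 + 1] ∘ u = f ∘ (f^[k + 1] ∘ u) := by
        rw [Function.iterate_succ' f (k + 1)]; rfl
      rw [e]
      exact ⟨_, G', p', h'.mono hQstep hMstep, hsub hWJ, h.volume_sdiff_step A B hJW⟩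
  refine ⟨Q, M, fun k => ?_⟩
  cases k with
  | zero => exact ⟨W₀, G₀, p₀, _, hu.mono (le_max_left _ _) (le_max_left _ _), hW₀, hJ⟩
  | succ k =>
    obtain ⟨W, G, p, h⟩ := hind k
    exact ⟨W, G, p, _, h⟩

/-! ### Densities of bounded variation -/

theorem exists_isBVDensity (ν : Measure (ℝ × ℝ)) [IsFiniteMeasure ν]
    (hν : ν (Icc (0 : ℝ) 1 ×ˢ Icc (0 : ℝ) 1)ᶜ = 0) {M : ℝ≥0}
    (hM : ∀ ψ : ℝ × ℝ → ℝ × ℝ, ContDiff ℝ 1 ψ → HasCompactSupport ψ →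
      (∀ q, |(ψ q).1| ≤ 1 ∧ |(ψ q).2| ≤ 1) → ∫ q, planeDiv ψ q ∂ν ≤ M) :
    ∃ ρ, IsBVDensity ν ρ M := by
  set S : Set (ℝ × ℝ) := Icc (0 : ℝ) 1 ×ˢ Icc (0 : ℝ) 1 with hS
  have hSm : MeasurableSet S := measurableSet_Icc.prod measurableSet_Icc
  have hac := absolutelyContinuous_of_integral_planeDiv_le ν (isCompact_Icc.prod isCompact_Icc) hν hM
  set g := ν.rnDeriv volume with hg
  have hgm : Measurable g := Measure.measurable_rnDeriv _ _
  have hgfin : ∀ᵐ x, g x < ⊤ := Measure.rnDeriv_lt_top ν volume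
  have hνg : volume.withDensity g = ν := Measure.withDensity_rnDeriv_eq _ _ hac
  -- The Radon-Nikodym derivative is determined only almost everywhere, and the indicator forces the
  -- support into the square at every point.
  set ρ : ℝ × ℝ → ℝ := S.indicator fun q => (g q).toReal with hρ
  have hρm : Measurable ρ := hgm.ennreal_toReal.indicator hSm
  have hρ0 : ∀ q, 0 ≤ ρ q := fun q => indicator_nonneg (fun _ _ => ENNReal.toReal_nonneg) q
  have heq : ν = volume.withDensity fun q => ENNReal.ofReal (ρ q) := by
    have h1 : ν = ν.restrict S :=
      (Measure.restrict_eq_self_of_ae_mem (by rw [ae_iff]; exact hν)).symm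
    conv_lhs => rw [h1, ← hνg, restrict_withDensity hSm, ← withDensity_indicator hSm]
    refine withDensity_congr_ae ?_
    filter_upwards [hgfin] with q hq
    by_cases hqS : q ∈ S
    · simp [hρ, hqS, ENNReal.ofReal_toReal hq.ne]
    · simp [hρ, hqS]
  have hρi : Integrable ρ volume := by
    refine ⟨hρm.aestronglyMeasurable, ?_⟩
    rw [hasFiniteIntegral_iff_ofReal (ae_of_all _ hρ0), ← setLIntegral_univ,
      ← withDensity_apply _ MeasurableSet.univ, ← heq]
    exact measure_lt_top _ _
  refine ⟨ρ, hρi, support_indicator_subset, hρ0, heq, ?_⟩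
  refine iSup_le fun ψ => iSup_le fun h1 => iSup_le fun h2 => iSup_le fun h3 => ?_
  have h4 : ∫ q, ρ q * planeDiv ψ q = ∫ q, planeDiv ψ q ∂ν := by
    rw [heq, integral_withDensity_eq_integral_toReal_smul hρm.ennreal_ofReal
      (ae_of_all _ fun _ => ENNReal.ofReal_lt_top)]
    simp [ENNReal.toReal_ofReal (hρ0 _)]
  rw [h4]
  exact (ENNReal.ofReal_le_ofReal (hM ψ h1 h2 h3)).trans (ENNReal.ofReal_coe_nnreal).le

/-! ### Measures on the cube whose projections have bounded variation -/

/-- The variation of the projection of `μ` to the `xy`-plane is at most `M`. -/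
def ProjVariationLE (μ : Measure Space3) (M : ℝ) : Prop :=
  ∀ ψ : ℝ × ℝ → ℝ × ℝ, ContDiff ℝ 1 ψ → HasCompactSupport ψ →
    (∀ q, |(ψ q).1| ≤ 1 ∧ |(ψ q).2| ≤ 1) → ∫ x, planeDiv ψ (projXY x) ∂μ ≤ M

theorem isClosed_cubeR : IsClosed cubeR := by
  rw [cubeR_eq]; exact isClosed_set_pi fun _ _ => isClosed_Icc

theorem isCompact_cubeR : IsCompact cubeR := by
  rw [cubeR_eq]; exact isCompact_univ_pi fun _ => isCompact_Icc

theorem measurableSet_regularSet (A B : Finset ℝ) : MeasurableSet (regularSet A B) := by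
  rw [regularSet_eq]
  exact isClosed_cubeR.measurableSet.inter (isClosed_cutSet A B).measurableSet.compl

section ProjVariation

variable {μ : Measure Space3} {M : ℝ≥0}

theorem map_projXY_compl_square (hμ : μ cubeRᶜ = 0) :
    μ.map projXY (Icc (0 : ℝ) 1 ×ˢ Icc (0 : ℝ) 1)ᶜ = 0 := by
  rw [Measure.map_apply continuous_projXY.measurable
    (measurableSet_Icc.prod measurableSet_Icc).compl]
  have hsub : projXY ⁻¹' (Icc (0 : ℝ) 1 ×ˢ Icc (0 : ℝ) 1)ᶜ ⊆ cubeRᶜ :=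
    fun x hx (h : x ∈ cubeR) => hx ⟨h 0, h 1⟩
  exact measure_mono_null hsub hμ

theorem ProjVariationLE.map_projXY (h : ProjVariationLE μ M) (ψ : ℝ × ℝ → ℝ × ℝ)
    (h1 : ContDiff ℝ 1 ψ) (h2 : HasCompactSupport ψ) (h3 : ∀ q, |(ψ q).1| ≤ 1 ∧ |(ψ q).2| ≤ 1) :
    ∫ q, planeDiv ψ q ∂(μ.map projXY) ≤ M := by
  rw [integral_map continuous_projXY.aemeasurable (continuous_planeDiv h1).aestronglyMeasurable]
  exact h ψ h1 h2 h3

variable [IsFiniteMeasure μ]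

theorem ProjVariationLE.exists_isBVDensity (h : ProjVariationLE μ M) (hμ : μ cubeRᶜ = 0) :
    ∃ ρ, IsBVDensity (μ.map projXY) ρ M :=
  _root_.exists_isBVDensity _ (map_projXY_compl_square hμ) h.map_projXY

theorem ProjVariationLE.measure_cutSet (h : ProjVariationLE μ M) (hμ : μ cubeRᶜ = 0)
    (A B : Finset ℝ) : μ {x : Space3 | x 0 ∈ A ∨ x 1 ∈ B} = 0 := by
  have hac := absolutelyContinuous_of_integral_planeDiv_le (μ.map projXY)
    (isCompact_Icc.prod isCompact_Icc) (map_projXY_compl_square hμ) h.map_projXY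
  have h0 := hac (volume_cutLines A B)
  have hT : MeasurableSet {q : ℝ × ℝ | q.1 ∈ A ∨ q.2 ∈ B} :=
    (measurable_fst A.measurableSet).union (measurable_snd B.measurableSet)
  rwa [Measure.map_apply continuous_projXY.measurable hT] at h0

theorem ProjVariationLE.ae_mem_regularSet (h : ProjVariationLE μ M) (hμ : μ cubeRᶜ = 0)
    (A B : Finset ℝ) : ∀ᵐ x ∂μ, x ∈ regularSet A B := by
  have h1 : ∀ᵐ x ∂μ, x ∈ cubeR := hμ
  have h2 : ∀ᵐ x ∂μ, x ∉ {x : Space3 | x 0 ∈ A ∨ x 1 ∈ B} :=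
    measure_eq_zero_iff_ae_notMem.1 (h.measure_cutSet hμ A B)
  filter_upwards [h1, h2] with x hx hx'
  rw [regularSet_eq]
  exact ⟨hx, hx'⟩

/-- Nothing is assumed about the measurability of `f` on the cuts or outside the cube; both are null
for `μ`, and `f` is continuous on what remains. -/
theorem ProjVariationLE.aemeasurable (h : ProjVariationLE μ M) (hμ : μ cubeRᶜ = 0)
    {A B : Finset ℝ} {f : Space3 → Space3} (hf : ContinuousOn f (regularSet A B)) :
    AEMeasurable f μ := by
  have h1 := hf.aemeasurable (μ := μ) (measurableSet_regularSet A B)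
  rwa [Measure.restrict_eq_self_of_ae_mem (h.ae_mem_regularSet hμ A B)] at h1

end ProjVariation

/-! ### Convergence of integrals of functions continuous off the cut planes -/

/-- The retraction of space onto the cube. -/
def clampCube (x : Space3) : Space3 := fun i => max 0 (min 1 (x i))

theorem continuous_clampCube : Continuous clampCube := by unfold clampCube; fun_prop

theorem clampCube_mem (x : Space3) : clampCube x ∈ cubeR := fun _ =>
  ⟨le_max_left _ _, max_le zero_le_one (min_le_left _ _)⟩

theorem clampCube_eq {x : Space3} (hx : x ∈ cubeR) : clampCube x = x := by
  ext i
  rw [clampCube, min_eq_right (hx i).2, max_eq_right (hx i).1]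

/-- A continuous function vanishing exactly on the cut planes. -/
def cutDistance (A B : Finset ℝ) (x : Space3) : ℝ :=
  (∏ a ∈ A, |x 0 - a|) * ∏ b ∈ B, |x 1 - b|

theorem continuous_cutDistance (A B : Finset ℝ) : Continuous (cutDistance A B) := by
  unfold cutDistance; fun_prop

theorem cutDistance_nonneg (A B : Finset ℝ) (x : Space3) : 0 ≤ cutDistance A B x :=
  mul_nonneg (Finset.prod_nonneg fun _ _ => abs_nonneg _) (Finset.prod_nonneg fun _ _ => abs_nonneg _)

theorem cutDistance_eq_zero_iff {A B : Finset ℝ} {x : Space3} :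
    cutDistance A B x = 0 ↔ x 0 ∈ A ∨ x 1 ∈ B := by
  rw [cutDistance, mul_eq_zero, Finset.prod_eq_zero_iff, Finset.prod_eq_zero_iff]
  refine or_congr ?_ ?_ <;>
  · constructor
    · rintro ⟨a, ha, h⟩
      rw [abs_eq_zero, sub_eq_zero] at h
      rwa [h]
    · exact fun h => ⟨_, h, by simp⟩

/-- A continuous cutoff, zero on the cut planes and one at some distance from them. -/
def planeCutoff (A B : Finset ℝ) (n : ℕ) (x : Space3) : ℝ := min 1 (n * cutDistance A B x)

theorem continuous_planeCutoff (A B : Finset ℝ) (n : ℕ) : Continuous (planeCutoff A B n) :=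
  continuous_const.min (continuous_const.mul (continuous_cutDistance A B))

theorem planeCutoff_mem_Icc (A B : Finset ℝ) (n : ℕ) (x : Space3) :
    planeCutoff A B n x ∈ Icc (0 : ℝ) 1 :=
  ⟨le_min zero_le_one (mul_nonneg n.cast_nonneg (cutDistance_nonneg A B x)), min_le_left _ _⟩

theorem planeCutoff_eq_zero {A B : Finset ℝ} {n : ℕ} {x : Space3} (hx : x 0 ∈ A ∨ x 1 ∈ B) :
    planeCutoff A B n x = 0 := by
  rw [planeCutoff, cutDistance_eq_zero_iff.2 hx]; simp

theorem tendsto_planeCutoff {A B : Finset ℝ} {x : Space3} (hx : ¬(x 0 ∈ A ∨ x 1 ∈ B)) :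
    Tendsto (fun n => planeCutoff A B n x) atTop (𝓝 1) := by
  have hpos : 0 < cutDistance A B x :=
    lt_of_le_of_ne (cutDistance_nonneg A B x) fun h => hx (cutDistance_eq_zero_iff.1 h.symm)
  have h1 : Tendsto (fun n : ℕ => (n : ℝ) * cutDistance A B x) atTop atTop :=
    tendsto_natCast_atTop_atTop.atTop_mul_const hpos
  refine tendsto_const_nhds.congr' ?_
  filter_upwards [h1.eventually_ge_atTop 1] with n hn
  rw [planeCutoff, min_eq_left hn]

/-- At a cut plane `h` may jump, but it is bounded and the cutoff tends to zero. Composing with the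
retraction extends the product continuously from the cube to the whole space. -/
theorem continuous_cutoff_mul {A B : Finset ℝ} {h : Space3 → ℝ} {b : ℝ}
    (hh : ContinuousOn h (regularSet A B)) (hb : ∀ x, |h x| ≤ b) (n : ℕ) :
    Continuous fun x => h (clampCube x) * planeCutoff A B n (clampCube x) := by
  have hc : ContinuousOn (fun x => h x * planeCutoff A B n x) cubeR := by
    intro x hx
    by_cases hx' : x 0 ∈ A ∨ x 1 ∈ B
    · have h0 : Tendsto (planeCutoff A B n) (𝓝[cubeR] x) (𝓝 0) := by
        have := (continuous_planeCutoff A B n).tendsto x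
        rw [planeCutoff_eq_zero hx'] at this
        exact this.mono_left nhdsWithin_le_nhds
      have h1 : Tendsto (fun y => h y * planeCutoff A B n y) (𝓝[cubeR] x) (𝓝 0) := by
        refine squeeze_zero_norm (a := fun y => b * planeCutoff A B n y) (fun y => ?_) ?_
        · rw [norm_mul, Real.norm_eq_abs, Real.norm_of_nonneg (planeCutoff_mem_Icc A B n y).1]
          exact mul_le_mul_of_nonneg_right (hb y) (planeCutoff_mem_Icc A B n y).1
        · simpa using h0.const_mul b
      rw [ContinuousWithinAt, planeCutoff_eq_zero hx', mul_zero]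
      exact h1
    · have hxr : x ∈ regularSet A B := by rw [regularSet_eq]; exact ⟨hx, hx'⟩
      have h1 : ContinuousWithinAt h cubeR x := by
        have h2 := hh x hxr
        rw [regularSet_eq] at h2
        exact (continuousWithinAt_inter ((isClosed_cutSet A B).isOpen_compl.mem_nhds hx')).1 h2
      exact h1.mul (continuous_planeCutoff A B n).continuousWithinAt
  exact hc.comp_continuous continuous_clampCube clampCube_mem

/-- Replacing `h` by its cut-off version costs at most `b * ∫ d n`. This is small for `μ` because
the cuts are null, and, `d n` being continuous, then also for `ν i` with `i` large. -/
theorem tendsto_integral_of_continuousOn_regularSet {A B : Finset ℝ} {ν : ℕ → Measure Space3}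
    {μ : Measure Space3} [∀ i, IsProbabilityMeasure (ν i)] [IsProbabilityMeasure μ]
    (hν : ∀ i, ν i cubeRᶜ = 0) (hμ : μ cubeRᶜ = 0)
    (hlim : ∀ φ : Space3 →ᵇ ℝ, Tendsto (fun i => ∫ x, φ x ∂(ν i)) atTop (𝓝 (∫ x, φ x ∂μ)))
    (hμcut : μ {x : Space3 | x 0 ∈ A ∨ x 1 ∈ B} = 0) {h : Space3 → ℝ} {b : ℝ}
    (hh : ContinuousOn h (regularSet A B)) (hb : ∀ x, |h x| ≤ b)
    (hmν : ∀ i, AEStronglyMeasurable h (ν i)) (hmμ : AEStronglyMeasurable h μ) :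
    Tendsto (fun i => ∫ x, h x ∂(ν i)) atTop (𝓝 (∫ x, h x ∂μ)) := by
  have hb0 : 0 ≤ b := (abs_nonneg _).trans (hb 0)
  -- bounded continuous minorants and majorants
  set g : ℕ → Space3 → ℝ := fun n x => h (clampCube x) * planeCutoff A B n (clampCube x) with hg
  set d : ℕ → Space3 → ℝ := fun n x => 1 - planeCutoff A B n (clampCube x) with hd
  have hgc : ∀ n, Continuous (g n) := continuous_cutoff_mul hh hb
  have hdc : ∀ n, Continuous (d n) := fun n =>
    continuous_const.sub ((continuous_planeCutoff A B n).comp continuous_clampCube)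
  have hd01 : ∀ n x, d n x ∈ Icc (0 : ℝ) 1 := fun n x => by
    have := planeCutoff_mem_Icc A B n (clampCube x)
    exact ⟨by simp only [hd]; linarith [this.2], by simp only [hd]; linarith [this.1]⟩
  have hgb : ∀ n x, ‖g n x‖ ≤ b := fun n x => by
    have := planeCutoff_mem_Icc A B n (clampCube x)
    rw [norm_mul, Real.norm_of_nonneg this.1]
    exact (mul_le_of_le_one_right (norm_nonneg _) this.2).trans (hb _)
  have hdb : ∀ n x, ‖d n x‖ ≤ 1 := fun n x => by
    rw [Real.norm_of_nonneg (hd01 n x).1]; exact (hd01 n x).2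
  have hglim : ∀ n, Tendsto (fun i => ∫ x, g n x ∂(ν i)) atTop (𝓝 (∫ x, g n x ∂μ)) := fun n =>
    hlim (BoundedContinuousFunction.ofNormedAddCommGroup (g n) (hgc n) b (hgb n))
  have hdlim : ∀ n, Tendsto (fun i => ∫ x, d n x ∂(ν i)) atTop (𝓝 (∫ x, d n x ∂μ)) := fun n =>
    hlim (BoundedContinuousFunction.ofNormedAddCommGroup (d n) (hdc n) 1 (hdb n))
  have hcomp : ∀ m : Measure Space3, IsProbabilityMeasure m → m cubeRᶜ = 0 →
      AEStronglyMeasurable h m → ∀ n,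
      |∫ x, h x ∂m - ∫ x, g n x ∂m| ≤ b * ∫ x, d n x ∂m := fun m _ hm hmm n => by
    have ih : Integrable h m := Integrable.of_bound hmm b (ae_of_all _ hb)
    have ig : Integrable (g n) m :=
      Integrable.of_bound (hgc n).aestronglyMeasurable b (ae_of_all _ (hgb n))
    have id : Integrable (d n) m :=
      Integrable.of_bound (hdc n).aestronglyMeasurable 1 (ae_of_all _ (hdb n))
    rw [← integral_sub ih ig, ← integral_const_mul, ← Real.norm_eq_abs]
    refine norm_integral_le_of_norm_le (id.const_mul b) ?_
    have hm' : ∀ᵐ x ∂m, x ∈ cubeR := hm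
    filter_upwards [hm'] with x hx
    have e : h x - g n x = h x * d n x := by simp only [hg, hd, clampCube_eq hx]; ring
    rw [e, norm_mul, Real.norm_of_nonneg (hd01 n x).1]
    exact mul_le_mul_of_nonneg_right (hb x) (hd01 n x).1
  have hd0 : Tendsto (fun n => ∫ x, d n x ∂μ) atTop (𝓝 0) := by
    have h1 : Tendsto (fun n => ∫ x, d n x ∂μ) atTop (𝓝 (∫ _, (0 : ℝ) ∂μ)) := by
      refine tendsto_integral_of_dominated_convergence (fun _ => 1)
        (fun n => (hdc n).aestronglyMeasurable) (integrable_const _)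
        (fun n => ae_of_all _ (hdb n)) ?_
      have h2 : ∀ᵐ x ∂μ, x ∈ cubeR := hμ
      have h3 : ∀ᵐ x ∂μ, x ∉ {x : Space3 | x 0 ∈ A ∨ x 1 ∈ B} :=
        measure_eq_zero_iff_ae_notMem.1 hμcut
      filter_upwards [h2, h3] with x hx hx'
      have := (tendsto_const_nhds (x := (1 : ℝ))).sub (tendsto_planeCutoff (A := A) (B := B) hx')
      simpa [hd, clampCube_eq hx] using this
    simpa using h1
  rw [Metric.tendsto_atTop]
  intro ε hε
  obtain ⟨n, hn⟩ : ∃ n, b * ∫ x, d n x ∂μ < ε / 4 := by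
    have h1 : Tendsto (fun n => b * ∫ x, d n x ∂μ) atTop (𝓝 0) := by
      simpa using hd0.const_mul b
    exact (h1.eventually (gt_mem_nhds (by linarith))).exists
  have h1 : Tendsto (fun i => b * ∫ x, d n x ∂(ν i)) atTop (𝓝 (b * ∫ x, d n x ∂μ)) :=
    (hdlim n).const_mul b
  have h2 := (Metric.tendsto_atTop.1 (hglim n)) (ε / 4) (by linarith)
  obtain ⟨N₁, hN₁⟩ := eventually_atTop.1 (h1.eventually (gt_mem_nhds hn))
  obtain ⟨N₂, hN₂⟩ := h2
  refine ⟨max N₁ N₂, fun i hi => ?_⟩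
  have h3 := hN₁ i ((le_max_left _ _).trans hi)
  have h4 := hN₂ i ((le_max_right _ _).trans hi)
  have h5 := abs_le.1 (hcomp (ν i) inferInstance (hν i) (hmν i) n)
  have h6 := abs_le.1 (hcomp μ inferInstance hμ hmμ n)
  rw [Real.dist_eq, abs_lt] at h4 ⊢
  constructor <;> linarith [h5.1, h5.2, h6.1, h6.2, h4.1, h4.2]

/-! ### Existence of the invariant measure -/

/-- The average of `μs 1, …, μs (n + 1)`. -/
def cesaroMeasure (μs : ℕ → Measure Space3) (n : ℕ) : Measure Space3 :=
  ((n + 1 : ℕ) : ℝ≥0∞)⁻¹ • ∑ k ∈ Finset.Icc 1 (n + 1), μs k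

section Cesaro

variable {μs : ℕ → Measure Space3}

theorem isProbabilityMeasure_cesaroMeasure (h : ∀ k, IsProbabilityMeasure (μs k)) (n : ℕ) :
    IsProbabilityMeasure (cesaroMeasure μs n) := by
  constructor
  rw [cesaroMeasure, Measure.smul_apply, Measure.finsetSum_apply]
  simp only [measure_univ, Finset.sum_const, Nat.card_Icc, smul_eq_mul, nsmul_eq_mul, mul_one]
  rw [Nat.add_sub_cancel]
  exact ENNReal.inv_mul_cancel (by positivity) (ENNReal.natCast_ne_top _)

theorem cesaroMeasure_apply_eq_zero {s : Set Space3} (h : ∀ k, μs k s = 0) (n : ℕ) :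
    cesaroMeasure μs n s = 0 := by
  rw [cesaroMeasure, Measure.smul_apply, Measure.finsetSum_apply, Finset.sum_eq_zero fun k _ => h k,
    smul_zero]

theorem integral_cesaroMeasure {φ : Space3 → ℝ} (h : ∀ k, Integrable φ (μs k)) (n : ℕ) :
    ∫ x, φ x ∂(cesaroMeasure μs n) =
      (1 / ((n + 1 : ℕ) : ℝ)) * ∑ k ∈ Finset.Icc 1 (n + 1), ∫ x, φ x ∂(μs k) := by
  rw [cesaroMeasure, integral_smul_measure, integral_finsetSum_measure fun k _ => h k,
    ENNReal.toReal_inv, ENNReal.toReal_natCast, one_div, smul_eq_mul]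

end Cesaro

/-- Measures carried by one compact set are tight, so Prokhorov's theorem gives a limit; the
portmanteau inequality on the open complement keeps the limit on the cube. -/
theorem exists_subseq_tendsto_of_cubeR {ν : ℕ → Measure Space3}
    (hprob : ∀ i, IsProbabilityMeasure (ν i)) (hν : ∀ i, ν i cubeRᶜ = 0) :
    ∃ (μ : Measure Space3) (n : ℕ → ℕ), IsProbabilityMeasure μ ∧ μ cubeRᶜ = 0 ∧ StrictMono n ∧
      ∀ φ : Space3 →ᵇ ℝ, Tendsto (fun i => ∫ x, φ x ∂(ν (n i))) atTop (𝓝 (∫ x, φ x ∂μ)) := by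
  set P : ℕ → ProbabilityMeasure Space3 := fun i => ⟨ν i, hprob i⟩ with hP
  have htight : IsTightMeasureSet {x | ∃ μ ∈ range P, (μ : Measure Space3) = x} := by
    rw [isTightMeasureSet_iff_exists_isCompact_measure_compl_le]
    refine fun ε _ => ⟨cubeR, isCompact_cubeR, ?_⟩
    rintro _ ⟨_, ⟨i, rfl⟩, rfl⟩
    exact (hν i).le.trans zero_le
  obtain ⟨μ, _, n, hn, hlim⟩ := (isCompact_closure_of_isTightMeasureSet htight).tendsto_subseq
    fun i => subset_closure (mem_range_self i)
  refine ⟨μ, n, inferInstance, ?_, hn, ?_⟩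
  · have h1 := ProbabilityMeasure.le_liminf_measure_open_of_tendsto hlim
      isClosed_cubeR.isOpen_compl
    have h2 : ∀ i, ((P ∘ n) i : Measure Space3) cubeRᶜ = 0 := fun i => hν (n i)
    simp only [h2, liminf_const] at h1
    exact le_antisymm h1 zero_le
  · exact fun φ => (ProbabilityMeasure.tendsto_iff_forall_integral_tendsto.1 hlim) φ

theorem exists_invariant_cesaroLimit {A B : Finset ℝ} {f : Space3 → Space3}
    (hf : ContinuousOn f (regularSet A B)) {μs : ℕ → Measure Space3}
    (hprob : ∀ k, IsProbabilityMeasure (μs k)) (hcube : ∀ k, μs k cubeRᶜ = 0) {M : ℝ≥0}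
    (hM : ∀ k, ProjVariationLE (μs k) M) (hstep : ∀ k, (μs k).map f = μs (k + 1)) :
    ∃ μ : Measure Space3, IsInvariantProbability f μ ∧ IsCesaroLimit μs μ ∧
      ∃ ρ, IsBVDensity (μ.map projXY) ρ M := by
  set ν := cesaroMeasure μs
  have hνp := isProbabilityMeasure_cesaroMeasure hprob
  have hνc := cesaroMeasure_apply_eq_zero hcube
  obtain ⟨μ, n, hμp, hμc, hn, hlim⟩ := exists_subseq_tendsto_of_cubeR hνp hνc
  have hbcf : ∀ (φ : Space3 →ᵇ ℝ) k, Integrable φ (μs k) := fun φ k => φ.integrable _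
  have hνM : ∀ i, ProjVariationLE (ν i) M := fun i ψ h1 h2 h3 => by
    have hc : Continuous fun x => planeDiv ψ (projXY x) :=
      (continuous_planeDiv h1).comp continuous_projXY
    obtain ⟨K, hK⟩ : ∃ K, ∀ q, ‖planeDiv ψ q‖ ≤ K := by
      obtain ⟨K, hK⟩ := (h2.fderiv ℝ).exists_bound_of_continuous (h1.continuous_fderiv one_ne_zero)
      exact ⟨2 * K, fun q => (abs_planeTrace_le (fderiv ℝ ψ q)).trans (by linarith [hK q])⟩
    rw [integral_cesaroMeasure fun k =>
      Integrable.of_bound hc.aestronglyMeasurable K (ae_of_all _ fun x => hK _)]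
    have h4 : ∑ k ∈ Finset.Icc 1 (i + 1), ∫ x, planeDiv ψ (projXY x) ∂(μs k) ≤
        ((i + 1 : ℕ) : ℝ) * M := by
      refine (Finset.sum_le_sum fun k _ => hM k ψ h1 h2 h3).trans_eq ?_
      simp
    rw [one_div, inv_mul_le_iff₀ (by positivity)]
    exact h4
  have hμM : ProjVariationLE μ M := fun ψ h1 h2 h3 => by
    have hc : Continuous fun x => planeDiv ψ (projXY x) :=
      (continuous_planeDiv h1).comp continuous_projXY
    obtain ⟨K, hK⟩ : ∃ K, ∀ q, ‖planeDiv ψ q‖ ≤ K := by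
      obtain ⟨K, hK⟩ := (h2.fderiv ℝ).exists_bound_of_continuous (h1.continuous_fderiv one_ne_zero)
      exact ⟨2 * K, fun q => (abs_planeTrace_le (fderiv ℝ ψ q)).trans (by linarith [hK q])⟩
    -- The divergence of a test field is bounded and continuous, so the bound passes to the weak
    -- limit.
    exact le_of_tendsto' (hlim (BoundedContinuousFunction.ofNormedAddCommGroup _ hc K
      fun x => hK _)) fun i => hνM (n i) ψ h1 h2 h3
  have hfμ : AEMeasurable f μ := hμM.aemeasurable hμc hf
  have hfν : ∀ i, AEMeasurable f (ν i) := fun i => (hνM i).aemeasurable (hνc i) hf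
  have hfμs : ∀ k, AEMeasurable f (μs k) := fun k => (hM k).aemeasurable (hcube k) hf
  have hmapp : IsProbabilityMeasure (μ.map f) := Measure.isProbabilityMeasure_map hfμ
  have hinv : μ.map f = μ := by
    refine ext_of_forall_integral_eq_of_IsFiniteMeasure fun φ => ?_
    rw [integral_map hfμ φ.continuous.aestronglyMeasurable]
    have hb : ∀ x, |φ (f x)| ≤ ‖φ‖ := fun x => φ.norm_coe_le_norm _
    have h1 : Tendsto (fun i => ∫ x, φ (f x) ∂(ν (n i))) atTop (𝓝 (∫ x, φ (f x) ∂μ)) :=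
      tendsto_integral_of_continuousOn_regularSet (fun i => hνc (n i)) hμc hlim
        (hμM.measure_cutSet hμc A B) (φ.continuous.comp_continuousOn hf) hb
        (fun i => (φ.continuous.measurable.comp_aemeasurable (hfν _)).aestronglyMeasurable)
        (φ.continuous.measurable.comp_aemeasurable hfμ).aestronglyMeasurable
    -- Pushing an average forward by `f` shifts its indices by one, so the difference telescopes to
    -- two boundary terms divided by `i + 1`.
    have hdiff : ∀ i, ∫ x, φ (f x) ∂(ν i) - ∫ x, φ x ∂(ν i) =
        (1 / ((i + 1 : ℕ) : ℝ)) * (∫ x, φ x ∂(μs (i + 2)) - ∫ x, φ x ∂(μs 1)) := fun i => by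
      rw [integral_cesaroMeasure (hbcf φ), integral_cesaroMeasure (φ := fun x => φ (f x)) fun k =>
        Integrable.of_bound
          (φ.continuous.measurable.comp_aemeasurable (hfμs k)).aestronglyMeasurable ‖φ‖
          (ae_of_all _ hb), ← mul_sub, ← Finset.sum_sub_distrib]
      congr 1
      have h2 : ∀ k, ∫ x, φ (f x) ∂(μs k) = ∫ x, φ x ∂(μs (k + 1)) := fun k => by
        rw [← hstep k, integral_map (hfμs k) φ.continuous.aestronglyMeasurable]
      simp only [h2]
      have h3 : Finset.Icc 1 (i + 1) = Finset.Ico 1 (i + 2) := by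
        ext k; simp only [Finset.mem_Icc, Finset.mem_Ico]; omega
      rw [h3]
      exact Finset.sum_Ico_sub (fun k => ∫ x, φ x ∂(μs k)) (by omega)
    have h0 : Tendsto (fun i => ∫ x, φ (f x) ∂(ν i) - ∫ x, φ x ∂(ν i)) atTop (𝓝 0) := by
      have h2 : Tendsto (fun i : ℕ => 1 / ((i : ℝ) + 1) * (2 * ‖φ‖)) atTop (𝓝 0) := by
        simpa using tendsto_one_div_add_atTop_nhds_zero_nat.mul_const (2 * ‖φ‖)
      refine squeeze_zero_norm (fun i => ?_) h2
      rw [hdiff, norm_mul, Real.norm_of_nonneg (by positivity), Nat.cast_add, Nat.cast_one]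
      refine mul_le_mul_of_nonneg_left ((norm_sub_le _ _).trans ?_) (by positivity)
      rw [two_mul]
      exact add_le_add (φ.norm_integral_le_norm _) (φ.norm_integral_le_norm _)
    have h2 := h1.sub (hlim φ)
    exact sub_eq_zero.1 (tendsto_nhds_unique h2 (h0.comp hn.tendsto_atTop))
  -- `cesaroMeasure μs n` averages `n + 1` measures, hence the shift of the subsequence.
  refine ⟨μ, ⟨hμp, hμc, hfμ, hinv⟩, ⟨fun i => n i + 1, fun i j hij => ?_, fun φ => ?_⟩,
    hμM.exists_isBVDensity hμc⟩
  · exact Nat.add_lt_add_right (hn hij) 1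
  · refine (hlim φ).congr fun i => ?_
    exact integral_cesaroMeasure (hbcf φ) (n i)

/-! ### The pushed measures -/

theorem volume_rectangle {x₀ x₁ y₀ y₁ : ℝ} :
    volume (Icc x₀ x₁ ×ˢ Icc y₀ y₁) = ENNReal.ofReal (x₁ - x₀) * ENNReal.ofReal (y₁ - y₀) := by
  rw [Measure.volume_eq_prod, Measure.prod_prod, Real.volume_Icc, Real.volume_Icc]

theorem volume_rectangle_sdiff {x₀ x₁ y₀ y₁ : ℝ} :
    volume ((Icc x₀ x₁ ×ˢ Icc y₀ y₁) \ (Ioo x₀ x₁ ×ˢ Ioo y₀ y₁)) = 0 := by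
  have h : (Ioo x₀ x₁ ×ˢ Ioo y₀ y₁ : Set (ℝ × ℝ)) =ᵐ[volume] Icc x₀ x₁ ×ˢ Icc y₀ y₁ := by
    rw [Measure.volume_eq_prod]
    exact Measure.set_prod_ae_eq Ioo_ae_eq_Icc Ioo_ae_eq_Icc
  exact ae_le_set.1 h.symm.le

section Pushed

variable {J : Set (ℝ × ℝ)} {α : ℝ × ℝ → ℝ} {f : Space3 → Space3} {k : ℕ} {W : Set (ℝ × ℝ)}
  {G : ℝ × ℝ → ℝ × ℝ →L[ℝ] ℝ × ℝ} {p : ℝ × ℝ → ℝ × ℝ →L[ℝ] ℝ} {s Q M : ℝ}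

theorem pushedMeasure_eq_map (hg : AEMeasurable (graphMap α) (volume.restrict J))
    (hk : AEMeasurable (f^[k]) (graphMeasure J α)) :
    AEMeasurable (f^[k] ∘ graphMap α) ((volume J)⁻¹ • volume.restrict J) ∧
    pushedMeasure f J α k = ((volume J)⁻¹ • volume.restrict J).map (f^[k] ∘ graphMap α) := by
  have hg' : AEMeasurable (graphMap α) ((volume J)⁻¹ • volume.restrict J) := hg.smul_measure _
  exact ⟨hk.comp_aemeasurable hg', AEMeasurable.map_map_of_aemeasurable hk hg'⟩

theorem isProbabilityMeasure_pushedMeasure (hJ0 : volume J ≠ 0) (hJ : volume J ≠ ⊤)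
    (hg : AEMeasurable (graphMap α) (volume.restrict J))
    (hk : AEMeasurable (f^[k]) (graphMeasure J α)) :
    IsProbabilityMeasure (pushedMeasure f J α k) := by
  obtain ⟨h1, h2⟩ := pushedMeasure_eq_map hg hk
  have : IsProbabilityMeasure ((volume J)⁻¹ • volume.restrict J) := ⟨by
    rw [Measure.smul_apply, Measure.restrict_apply_univ, smul_eq_mul]
    exact ENNReal.inv_mul_cancel hJ0 hJ⟩
  rw [h2]
  exact Measure.isProbabilityMeasure_map h1

theorem IsMovingGraph.pushedMeasure_compl_cubeR
    (hu : IsMovingGraph (f^[k] ∘ graphMap α) W G p s Q M) (hJm : MeasurableSet J)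
    (hJW : volume (J \ W) = 0) (hg : AEMeasurable (graphMap α) (volume.restrict J))
    (hk : AEMeasurable (f^[k]) (graphMeasure J α)) : pushedMeasure f J α k cubeRᶜ = 0 := by
  obtain ⟨h1, h2⟩ := pushedMeasure_eq_map hg hk
  rw [h2, Measure.map_apply_of_aemeasurable h1 isClosed_cubeR.measurableSet.compl,
    Measure.smul_apply, Measure.restrict_apply' hJm]
  have h0 : volume ((f^[k] ∘ graphMap α) ⁻¹' cubeRᶜ ∩ J) = 0 :=
    measure_mono_null (t := J \ W) (fun w hw => ⟨hw.2, fun hwW => hw.1 (hu.mapsTo hwW)⟩) hJW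
  rw [h0, smul_zero]

theorem IsMovingGraph.projVariationLE_pushedMeasure
    (hu : IsMovingGraph (f^[k] ∘ graphMap α) W G p s Q M)
    (hWJ : W ⊆ J) (hJW : volume (J \ W) = 0) (hg : AEMeasurable (graphMap α) (volume.restrict J))
    (hk : AEMeasurable (f^[k]) (graphMeasure J α)) :
    ProjVariationLE (pushedMeasure f J α k) ((volume J)⁻¹.toReal * M) := by
  obtain ⟨h1, h2⟩ := pushedMeasure_eq_map hg hk
  intro ψ hψ hψc hψ1
  have hc : Continuous fun x => planeDiv ψ (projXY x) :=
    (continuous_planeDiv hψ).comp continuous_projXY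
  have hae : (J : Set (ℝ × ℝ)) =ᵐ[volume] W :=
    Filter.EventuallyLE.antisymm (ae_le_set.2 hJW) hWJ.eventuallyLE
  rw [h2, integral_map h1 hc.aestronglyMeasurable, integral_smul_measure,
    setIntegral_congr_set hae]
  exact mul_le_mul_of_nonneg_left (hu.integral_planeDiv_le hψ hψc hψ1) ENNReal.toReal_nonneg

end Pushed

end

/-! ### The main theorem -/

theorem mainTheorem2
    (A B : Finset ℝ) (hA : ∀ a ∈ A, 0 < a ∧ a < 1) (hB : ∀ b ∈ B, 0 < b ∧ b < 1)
    (f : Space3 → Space3) (hfR : MapsTo f cubeR cubeR) (lam : ℝ)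
    (hf0 : SmoothBounded A B f) (hf1 : DominatedExpansion A B f lam)
    (hf2 : SmallCoupling A B f lam) (hf3 : 2 < lam)
    (x₀ x₁ y₀ y₁ : ℝ) (hx₀ : 0 ≤ x₀) (hx : x₀ < x₁) (hx₁ : x₁ ≤ 1)
    (hy₀ : 0 ≤ y₀) (hy : y₀ < y₁) (hy₁ : y₁ ≤ 1)
    (α : ℝ × ℝ → ℝ) (hα : ContDiffOn ℝ 2 α (Icc x₀ x₁ ×ˢ Icc y₀ y₁))
    (hα01 : MapsTo α (Icc x₀ x₁ ×ˢ Icc y₀ y₁) (Icc 0 1))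
    (hnormal : NormalNearZAxis (Icc x₀ x₁ ×ˢ Icc y₀ y₁) α) :
    ∃ M : ℝ≥0,
      (∀ k : ℕ, AEMeasurable (f^[k]) (graphMeasure (Icc x₀ x₁ ×ˢ Icc y₀ y₁) α) ∧
        ∃ ρk : ℝ × ℝ → ℝ,
          IsBVDensity ((pushedMeasure f (Icc x₀ x₁ ×ˢ Icc y₀ y₁) α k).map projXY) ρk M) ∧
      ∃ μ : Measure Space3,
        IsInvariantProbability f μ ∧
        IsCesaroLimit (pushedMeasure f (Icc x₀ x₁ ×ˢ Icc y₀ y₁) α) μ ∧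
        ∃ ρ : ℝ × ℝ → ℝ, IsBVDensity (μ.map projXY) ρ M := by
  set J := Icc x₀ x₁ ×ˢ Icc y₀ y₁ with hJ
  have hJm : MeasurableSet J := measurableSet_Icc.prod measurableSet_Icc
  have hJ0 : volume J ≠ 0 := by
    rw [hJ, volume_rectangle]
    exact mul_ne_zero (ENNReal.ofReal_pos.2 (sub_pos.2 hx)).ne'
      (ENNReal.ofReal_pos.2 (sub_pos.2 hy)).ne'
  have hJt : volume J ≠ ⊤ := by
    rw [hJ, volume_rectangle]
    exact ENNReal.mul_ne_top ENNReal.ofReal_ne_top ENNReal.ofReal_ne_top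
  obtain ⟨Q₀, hQ₀, hu₀⟩ := isMovingGraph_initial hx₀ hx hx₁ hy₀ hy hy₁ hα hα01 hnormal
  obtain ⟨Q, M, hu⟩ := exists_uniform_movingGraph hfR hf0 hf1 hf2 hf3 hu₀ hQ₀
    (prod_mono Ioo_subset_Icc_self Ioo_subset_Icc_self) volume_rectangle_sdiff
  have hg : AEMeasurable (graphMap α) (volume.restrict J) := by
    refine ContinuousOn.aemeasurable (continuousOn_pi.2 fun i => ?_) hJm
    fin_cases i
    exacts [continuous_fst.continuousOn, continuous_snd.continuousOn, hα.continuousOn]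
  have hf : ContinuousOn f (regularSet A B) := hf0.1.continuousOn
  have hprops : ∀ k, AEMeasurable (f^[k]) (graphMeasure J α) →
      IsProbabilityMeasure (pushedMeasure f J α k) ∧ pushedMeasure f J α k cubeRᶜ = 0 ∧
      ProjVariationLE (pushedMeasure f J α k) (Real.toNNReal ((volume J)⁻¹.toReal * M)) := by
    intro k hk
    obtain ⟨W, G, p, s, hW, hWJ, hJW⟩ := hu k
    exact ⟨isProbabilityMeasure_pushedMeasure hJ0 hJt hg hk,
      hW.pushedMeasure_compl_cubeR hJm hJW hg hk, fun ψ h1 h2 h3 =>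
        (hW.projVariationLE_pushedMeasure hWJ hJW hg hk ψ h1 h2 h3).trans (Real.le_coe_toNNReal _)⟩
  have hfk : ∀ k, AEMeasurable (f^[k]) (graphMeasure J α) →
      AEMeasurable f (pushedMeasure f J α k) := fun k hk => by
    obtain ⟨h1, h2, h3⟩ := hprops k hk
    exact h3.aemeasurable h2 hf
  -- Measurability of the iterates has to be obtained by induction: the variation bound at time `k`
  -- shows that the cuts are null for `μ_k`, hence that `f` is almost everywhere measurable for it.
  have hm : ∀ k, AEMeasurable (f^[k]) (graphMeasure J α) := fun k => by
    induction k with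
    | zero => exact aemeasurable_id
    | succ k ih =>
      rw [Function.iterate_succ']
      exact (hfk k ih).comp_aemeasurable ih
  have hstep : ∀ k, (pushedMeasure f J α k).map f = pushedMeasure f J α (k + 1) := fun k => by
    rw [pushedMeasure, pushedMeasure, Function.iterate_succ']
    exact AEMeasurable.map_map_of_aemeasurable (hfk k (hm k)) (hm k)
  refine ⟨_, fun k => ⟨hm k, ?_⟩, exists_invariant_cesaroLimit hf
    (fun k => (hprops k (hm k)).1) (fun k => (hprops k (hm k)).2.1)
    (fun k => (hprops k (hm k)).2.2) hstep⟩
  obtain ⟨h1, h2, h3⟩ := hprops k (hm k)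
  exact h3.exists_isBVDensity h2
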